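/- Theorem 1 (Main Result 1). Let $d\in\mathbb N$, $0<m\le d$ (real), $0<\tau\le 1$, $0<C_{CZ}<\infty$, and $A\in\mathbb R$. There is a constant $C=C(A,m,d,\tau,C_{CZ})$ with the following property. Let $X\subset\mathbb R^d$ and let $k$ be a real- or complex-valued Calderón–Zygmund kernel of order $m$ on $X$, that is, for all $x,x',y\in X$ with $x\neq y$, $$|k(x,y)|\le \frac{C_{CZ}}{|x-y|^m},\qquad |k(y,x)-k(y,x')|+|k(x,y)-k(x',y)|\le C_{CZ}\frac{|x-x'|^\tau}{|x-y|^{m+\tau}}\ \text{ if } |x-x'|\le\tfrac12|x-y|.$$ Let $\mu$ be a Borel probability measure on $\mathbb R^d$ with compact support contained in $X$, and let $H\subset\mathbb R^d$ be an open set that contains every ball $B(x,r)$ ($x\in\mathbb R^d$, $r>0$) with $\mu(B(x,r))>r^m$. With $d(x):=\operatorname{dist}(x,\mathbb R^d\setminus H)\in[0,\infty]$ (and $\operatorname{dist}(x,\emptyset)=\infty$), suppose that $$|k(x,y)|\le\frac1{\max(d(x)^m,d(y)^m)}\qquad\text{for all }x,y\in X .$$ Let $T=T_{\mu,m}$ be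 a bounded operator on $L^2(\mathbb R^d;\mu)$ which is a Calderón–Zygmund operator with kernel $k$, i.e. for every $f\in L^2(\mathbb R^d;\mu)$, $Tf(x)=\int k(x,y)f(y)\,d\mu(y)$ for $\mu$-almost every $x\notin\operatorname{supp}f$ (for instance, the integral operator $Tf(x)=\int k(x,y)f(y)\,d\mu(y)$ when $k$ is a bounded measurable kernel). Let $T^*$ be its transpose, which has kernel $k(y,x)$. If for all axis-parallel cubes $Q\subset\mathbb R^d$ $$\|T\chi_Q\|_{L^2(\mathbb R^d;\mu)}^2\le A\,\mu(Q),\qquad \|T^*\chi_Q\|_{L^2(\mathbb R^d;\mu)}^2\le A\,\mu(Q),$$ then $\|T\|_{L^2(\mathbb R^d;\mu)\to L^2(\mathbb R^d;\mu)}\le C(A,m,d,\tau,C_{CZ})$. -/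

import Mathlib

open MeasureTheory Metric Set
open scoped ENNReal

/-- `k` is a Calderón–Zygmund kernel of order `m` on `X` with constants `C` and `τ`. Only the
values of `k` on `X × X` matter; nothing is asked on the diagonal, where the bounds read `∞`. -/
structure IsCZKernel {d : ℕ} {𝕜 : Type*} [RCLike 𝕜] (X : Set (EuclideanSpace ℝ (Fin d)))
    (m C τ : ℝ) (k : EuclideanSpace ℝ (Fin d) → EuclideanSpace ℝ (Fin d) → 𝕜) : Prop where
  size : ∀ x ∈ X, ∀ y ∈ X, x ≠ y → ‖k x y‖ ≤ C / dist x y ^ m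
  smooth : ∀ x ∈ X, ∀ x' ∈ X, ∀ y ∈ X, x ≠ y → dist x x' ≤ 1 / 2 * dist x y →
    ‖k y x - k y x'‖ + ‖k x y - k x' y‖ ≤ C * (dist x x' ^ τ / dist x y ^ (m + τ))

/-- All balls `B(x,r)` with `μ (B(x,r)) > r ^ m` (the non-Ahlfors balls) lie in `H`. -/
def NonAhlforsBallsIn {d : ℕ} (μ : Measure (EuclideanSpace ℝ (Fin d))) (m : ℝ)
    (H : Set (EuclideanSpace ℝ (Fin d))) : Prop :=
  ∀ (x : EuclideanSpace ℝ (Fin d)) (r : ℝ), 0 < r →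
    ENNReal.ofReal (r ^ m) < μ (ball x r) → ball x r ⊆ H

/-- The Bergman-type bound `|k(x,y)| ≤ 1 / max (d(x)^m, d(y)^m)` on `X`, where `d` is the distance
to the complement of `H`. Everything is computed in `[0,∞]`, so that the bound is void where
`d(x) = d(y) = 0`, and `d = ∞` when `H` is the whole space. -/
def HasBergmanBound {d : ℕ} {𝕜 : Type*} [RCLike 𝕜] (X H : Set (EuclideanSpace ℝ (Fin d)))
    (m : ℝ) (k : EuclideanSpace ℝ (Fin d) → EuclideanSpace ℝ (Fin d) → 𝕜) : Prop :=
  ∀ x ∈ X, ∀ y ∈ X, ‖k x y‖ₑ ≤ 1 / max (infEDist x Hᶜ ^ m) (infEDist y Hᶜ ^ m)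

/-- The essential support of `f` with respect to `μ`: the complement of the largest open set on
which `f = 0` almost everywhere. -/
def essSupport {d : ℕ} {𝕜 : Type*} [RCLike 𝕜] (μ : Measure (EuclideanSpace ℝ (Fin d)))
    (f : EuclideanSpace ℝ (Fin d) → 𝕜) : Set (EuclideanSpace ℝ (Fin d)) :=
  (μ.restrict {x | f x ≠ 0}).support

/-- The bounded operator `T` on `L²(μ)` is a Calderón–Zygmund operator with kernel `k`:
`T f (x) = ∫ k(x,y) f(y) dμ(y)` for (almost) all `x` outside the support of `f`. -/
def IsCZOperator {d : ℕ} {𝕜 : Type*} [RCLike 𝕜] (μ : Measure (EuclideanSpace ℝ (Fin d)))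
    (k : EuclideanSpace ℝ (Fin d) → EuclideanSpace ℝ (Fin d) → 𝕜)
    (T : Lp 𝕜 2 μ →L[𝕜] Lp 𝕜 2 μ) : Prop :=
  ∀ f : Lp 𝕜 2 μ, ∀ᵐ x ∂μ, x ∉ essSupport μ f → T f x = ∫ y, k x y * f y ∂μ

/-- The half-open axis-parallel cube with corner `a` and side length `l`. -/
def cube {d : ℕ} (a : EuclideanSpace ℝ (Fin d)) (l : ℝ) : Set (EuclideanSpace ℝ (Fin d)) :=
  {x | ∀ i, x i ∈ Ico (a i) (a i + l)}

theorem measurableSet_cube {d : ℕ} (a : EuclideanSpace ℝ (Fin d)) (l : ℝ) :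
    MeasurableSet (cube a l) := by
  have h : cube a l = ⋂ i, (fun x : EuclideanSpace ℝ (Fin d) => x i) ⁻¹' Ico (a i) (a i + l) := by
    ext x
    simp [cube]
  rw [h]
  exact MeasurableSet.iInter fun i =>
    (by fun_prop : Measurable fun x : EuclideanSpace ℝ (Fin d) => x i) measurableSet_Ico

/-- The indicator function of a cube as an element of `L²(μ)`. -/
noncomputable def cubeIndicator {d : ℕ} (𝕜 : Type*) [RCLike 𝕜]
    (μ : Measure (EuclideanSpace ℝ (Fin d))) [IsFiniteMeasure μ]
    (a : EuclideanSpace ℝ (Fin d)) (l : ℝ) : Lp 𝕜 2 μ :=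
  indicatorConstLp 2 (measurableSet_cube a l) (measure_ne_top μ (cube a l)) (1 : 𝕜)

/-- The testing condition `‖T χ_Q‖² ≤ A μ(Q)` for all cubes `Q`. -/
def T1Condition {d : ℕ} {𝕜 : Type*} [RCLike 𝕜] (μ : Measure (EuclideanSpace ℝ (Fin d)))
    [IsFiniteMeasure μ] (A : ℝ) (T : Lp 𝕜 2 μ →L[𝕜] Lp 𝕜 2 μ) : Prop :=
  ∀ (a : EuclideanSpace ℝ (Fin d)) (l : ℝ), 0 < l →
    ‖T (cubeIndicator 𝕜 μ a l)‖ ^ 2 ≤ A * μ.real (cube a l)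

/-! Put δ(x) = dist(x, Hᶜ). Above the scale δ(x) the measure has growth μ(B(x,r)) ≤ r^m, and at
every distance the kernel is at most δ(x)^(-m), so each hypothesis covers the range in which the
other fails. A Lipschitz cutoff at distances comparable to δ(x) + δ(y) splits the kernel into
`localKernel` and `farKernel`. The local part lives in |x - y| < δ(x) and passes the Schur test with
constant 2^m. The far part keeps the Calderón–Zygmund smoothness and vanishes at distances where
growth is unavailable, so its off-diagonal integrals converge (`lintegral_dist_rpow_neg_le`). After
subtraction of the local part, the nonhomogeneous T1 argument of Nazarov, Treil and Volberg applies.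

That argument is run on a finite model. A cube around the support is cut into small cells; on step
functions T becomes a matrix indexed by the cells of positive measure, and the cubes of a shifted
dyadic grid give a tree of partitions, with level 0 the points and larger levels coarser. In
`norm_bilin_le_of_isUpperT1Form` both functions are expanded in martingale differences, and by
symmetry a fine difference of f meets a coarser one of g. At comparable levels, nearby cells are
handled by testing, because the bound on T χ_Q over the whole space also covers adjacent cubes;
separated cells are handled by mean zero and smoothness. At much coarser levels the constant value
of g on the ancestor cell is subtracted. What remains lives outside that ancestor, hence far away if
the cell of f is good, and decays geometrically in the level gap. The subtracted values form a
paraproduct, bounded by the Carleson embedding theorem, whose hypothesis follows from testing the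
transpose.

A given cell is bad for only a small proportion of the shifts, so some shift makes the bad parts of
both functions small (`exists_shift_normSq_bad_le`). Their contribution is at most half of ‖T‖ and
is absorbed, since T is bounded a priori. No constant depends on the mesh, so density of step
functions concludes. -/

/-! ### Conditional expectations on a finite weighted set. -/

section CellAverages

variable {P ι 𝕜 : Type*} [Fintype P] [DecidableEq ι] [RCLike 𝕜]

/-- The average of `f` over the cell `{q | c q = c p}` with respect to the weights `w`. -/
noncomputable def cellAvg (w : P → ℝ) (c : P → ι) : (P → 𝕜) →ₗ[𝕜] (P → 𝕜) where
  toFun f p := ((∑ q with c q = c p, w q : ℝ) : 𝕜)⁻¹ * ∑ q with c q = c p, (w q : 𝕜) * f q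
  map_add' f g := by
    ext p
    simp [mul_add, Finset.sum_add_distrib]
  map_smul' r f := by
    ext p
    simp only [Pi.smul_apply, smul_eq_mul, RingHom.id_apply, Finset.mul_sum]
    exact Finset.sum_congr rfl fun q _ => by ring

/-- The squared weighted `ℓ²` norm. -/
noncomputable def normSq (w : P → ℝ) (f : P → 𝕜) : ℝ := ∑ p, w p * ‖f p‖ ^ 2

/-- The total weight of the cell of `p`. -/
noncomputable def cellMass (w : P → ℝ) (c : P → ι) (p : P) : ℝ := ∑ q with c q = c p, w q

variable {w : P → ℝ} {c c' : P → ι}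

theorem cellAvg_apply (f : P → 𝕜) (p : P) :
    cellAvg w c f p = ((cellMass w c p : ℝ) : 𝕜)⁻¹ * ∑ q with c q = c p, (w q : 𝕜) * f q := rfl

theorem cellMass_pos (hw : ∀ p, 0 < w p) (p : P) : 0 < cellMass w c p :=
  Finset.sum_pos (fun q _ => hw q) ⟨p, by simp⟩

theorem cellMass_congr {p q : P} (h : c p = c q) : cellMass w c p = cellMass w c q := by
  simp [cellMass, h]

theorem cellAvg_congr (f : P → 𝕜) {p q : P} (h : c p = c q) :
    cellAvg w c f p = cellAvg w c f q := by
  simp [cellAvg_apply, cellMass, h]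

theorem cellMass_ne_zero (hw : ∀ p, 0 < w p) (p : P) : ((cellMass w c p : ℝ) : 𝕜) ≠ 0 :=
  RCLike.ofReal_ne_zero.mpr (cellMass_pos hw p).ne'

/-- Averaging commutes with multiplication by functions that are constant on cells. -/
theorem cellAvg_mul_const (f g : P → 𝕜) (hg : ∀ p q, c p = c q → g p = g q) (p : P) :
    cellAvg w c (fun q => g q * f q) p = g p * cellAvg w c f p := by
  rw [cellAvg_apply, cellAvg_apply, mul_left_comm, Finset.mul_sum (a := g p)]
  congr 1
  refine Finset.sum_congr rfl fun q hq => ?_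
  rw [hg q p (by simpa using hq)]
  ring

theorem cellAvg_const (hw : ∀ p, 0 < w p) (g : P → 𝕜) (hg : ∀ p q, c p = c q → g p = g q) :
    cellAvg w c g = g := by
  ext p
  rw [cellAvg_apply, inv_mul_eq_iff_eq_mul₀ (cellMass_ne_zero hw p), cellMass]
  push_cast
  rw [Finset.sum_mul]
  refine Finset.sum_congr rfl fun q hq => ?_
  rw [hg q p (by simpa using hq)]

/-- Averaging is a conditional expectation, hence invisible when paired with a function that is
constant on cells. The tower property and the orthogonality of martingale differences both come from
this. -/
theorem sum_cellAvg_mul (hw : ∀ p, 0 < w p) (f g : P → 𝕜)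
    (hg : ∀ p q, c p = c q → g p = g q) :
    ∑ p, (w p : 𝕜) * cellAvg w c f p * g p = ∑ p, (w p : 𝕜) * f p * g p := by
  have h1 : ∀ p, (w p : 𝕜) * cellAvg w c f p * g p = ∑ q, if c q = c p then
      (w q : 𝕜) * f q * ((cellMass w c q : ℝ) : 𝕜)⁻¹ * ((w p : 𝕜) * g q) else 0 := by
    intro p
    rw [cellAvg_apply, ← Finset.sum_filter, Finset.mul_sum, Finset.mul_sum, Finset.sum_mul]
    refine Finset.sum_congr rfl fun q hq => ?_
    have : c q = c p := by simpa using hq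
    rw [hg q p this, cellMass_congr this]
    ring
  rw [Finset.sum_congr rfl fun p _ => h1 p, Finset.sum_comm]
  refine Finset.sum_congr rfl fun q _ => ?_
  rw [← Finset.sum_filter, ← Finset.mul_sum, ← Finset.sum_mul]
  have h2 : (∑ p with c q = c p, (w p : 𝕜)) = ((cellMass w c q : ℝ) : 𝕜) := by
    rw [cellMass]
    push_cast
    exact Finset.sum_congr (by ext; simp [eq_comm]) fun _ _ => rfl
  rw [h2]
  field_simp [cellMass_ne_zero (𝕜 := 𝕜) (c := c) hw q]

theorem cellAvg_cellAvg_of_le (hw : ∀ p, 0 < w p) (h : ∀ p q, c p = c q → c' p = c' q)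
    (f : P → 𝕜) : cellAvg w c' (cellAvg w c f) = cellAvg w c' f := by
  ext p
  rw [cellAvg_apply, cellAvg_apply]
  congr 1
  have := sum_cellAvg_mul hw f (fun q => if c' q = c' p then (1 : 𝕜) else 0)
    (fun q q' hq => by rw [h q q' hq])
  simpa [Finset.sum_filter] using this

theorem normSq_nonneg (hw : ∀ p, 0 < w p) (f : P → 𝕜) : 0 ≤ normSq w f :=
  Finset.sum_nonneg fun p _ => mul_nonneg (hw p).le (sq_nonneg _)

theorem normSq_add_of_cellAvg_eq_zero (hw : ∀ p, 0 < w p) (u g : P → 𝕜)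
    (hu : cellAvg w c u = 0) (hg : ∀ p q, c p = c q → g p = g q) :
    normSq w (u + g) = normSq w u + normSq w g := by
  have h := sum_cellAvg_mul hw u (fun p => (starRingEnd 𝕜) (g p))
    (fun p q hpq => by rw [hg p q hpq])
  simp only [hu, Pi.zero_apply, mul_zero, zero_mul, Finset.sum_const_zero] at h
  have h2 : ∑ p, w p * RCLike.re (u p * (starRingEnd 𝕜) (g p)) = 0 := by
    have := congrArg RCLike.re h
    simp only [map_zero, map_sum, mul_assoc, RCLike.re_ofReal_mul] at this
    exact this.symm
  have h3 : ∀ p, w p * ‖(u + g) p‖ ^ 2 = w p * ‖u p‖ ^ 2 + w p * ‖g p‖ ^ 2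
      + 2 * (w p * RCLike.re (u p * (starRingEnd 𝕜) (g p))) := by
    intro p
    rw [Pi.add_apply, ← RCLike.normSq_eq_def', ← RCLike.normSq_eq_def', ← RCLike.normSq_eq_def',
      RCLike.normSq_add]
    ring
  rw [normSq, Finset.sum_congr rfl fun p _ => h3 p, Finset.sum_add_distrib,
    Finset.sum_add_distrib, ← Finset.mul_sum, h2, normSq, normSq]
  ring

theorem norm_cellAvg_le (hw : ∀ p, 0 < w p) (f : P → 𝕜) (p : P) :
    ‖cellAvg w c f p‖ ≤ cellAvg w c (fun q => ‖f q‖) p := by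
  rw [cellAvg_apply, cellAvg_apply, norm_mul, norm_inv, RCLike.norm_ofReal,
    abs_of_pos (cellMass_pos hw p)]
  simp only [RCLike.ofReal_real_eq_id, id_eq]
  gcongr
  · exact inv_nonneg.mpr (cellMass_pos hw p).le
  · refine (norm_sum_le _ _).trans_eq (Finset.sum_congr rfl fun q _ => ?_)
    rw [norm_mul, RCLike.norm_ofReal, abs_of_pos (hw q)]

theorem cellAvg_mono (hw : ∀ p, 0 < w p) {f g : P → ℝ} (h : ∀ p, f p ≤ g p) (p : P) :
    cellAvg w c f p ≤ cellAvg w c g p := by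
  rw [cellAvg_apply, cellAvg_apply]
  simp only [RCLike.ofReal_real_eq_id, id_eq]
  refine mul_le_mul_of_nonneg_left (Finset.sum_le_sum fun q _ => ?_)
    (inv_nonneg.mpr (cellMass_pos hw p).le)
  exact mul_le_mul_of_nonneg_left (h q) (hw q).le

/-- Joint convexity of `(X, Y) ↦ X² / Y`, for cell averages. -/
theorem sq_cellAvg_div_le (hw : ∀ p, 0 < w p) (X Y : P → ℝ) (hY : ∀ p, 0 < Y p) (p : P) :
    cellAvg w c X p ^ 2 / cellAvg w c Y p ≤ cellAvg w c (fun q => X q ^ 2 / Y q) p := by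
  have hm := cellMass_pos (c := c) hw p
  have h := Finset.sq_sum_div_le_sum_sq_div (Finset.univ.filter fun q => c q = c p)
    (fun q => w q * X q) (g := fun q => w q * Y q) (fun q _ => mul_pos (hw q) (hY q))
  have h2 : ∀ q, (w q * X q) ^ 2 / (w q * Y q) = w q * (X q ^ 2 / Y q) := fun q => by
    have := (hw q).ne'
    have := (hY q).ne'
    field_simp
  simp only [h2] at h
  have hYs : 0 < ∑ q with c q = c p, w q * Y q :=
    Finset.sum_pos (fun q _ => mul_pos (hw q) (hY q)) ⟨p, by simp⟩
  simp only [cellAvg_apply, RCLike.ofReal_real_eq_id, id_eq]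
  calc _ = (cellMass w c p)⁻¹ * ((∑ q with c q = c p, w q * X q) ^ 2 /
        ∑ q with c q = c p, w q * Y q) := by
        field_simp
    _ ≤ _ := mul_le_mul_of_nonneg_left h (inv_nonneg.mpr hm.le)

end CellAverages

/-! ### Martingale differences and the Carleson embedding theorem. -/

section Martingale

/-- The partitions into the cells of `c n` get coarser with `n`. -/
def NestedCells {P ι : Type*} (c : ℕ → P → ι) : Prop :=
  ∀ n p q, c n p = c n q → c (n + 1) p = c (n + 1) q

theorem NestedCells.mono {P ι : Type*} {c : ℕ → P → ι} (hc : NestedCells c) {i j : ℕ}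
    (hij : i ≤ j) (p q : P) (h : c i p = c i q) : c j p = c j q := by
  induction j, hij using Nat.le_induction with
  | base => exact h
  | succ n _ ih => exact hc n p q ih

variable {P ι 𝕜 : Type*} [Fintype P] [DecidableEq ι] [RCLike 𝕜]

/-- The martingale difference between level `n` and level `n + 1`. -/
noncomputable def cellDiff (w : P → ℝ) (c : ℕ → P → ι) (n : ℕ) : (P → 𝕜) →ₗ[𝕜] (P → 𝕜) :=
  cellAvg w (c n) - cellAvg w (c (n + 1))

variable {w : P → ℝ} {c : ℕ → P → ι}

theorem cellDiff_apply (n : ℕ) (f : P → 𝕜) :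
    cellDiff w c n f = cellAvg w (c n) f - cellAvg w (c (n + 1)) f := rfl

theorem cellDiff_congr (hc : NestedCells c) {n : ℕ} (f : P → 𝕜) {p q : P} (h : c n p = c n q) :
    cellDiff w c n f p = cellDiff w c n f q := by
  simp only [cellDiff_apply, Pi.sub_apply]
  rw [cellAvg_congr f h, cellAvg_congr f (hc n p q h)]

theorem cellAvg_cellDiff (hw : ∀ p, 0 < w p) (hc : NestedCells c) (n : ℕ) (f : P → 𝕜) :
    cellAvg w (c (n + 1)) (cellDiff w c n f) = 0 := by
  rw [cellDiff_apply, map_sub, cellAvg_cellAvg_of_le hw (hc n),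
    cellAvg_cellAvg_of_le hw (fun _ _ h => h), sub_self]

theorem normSq_cellAvg (hw : ∀ p, 0 < w p) (hc : NestedCells c) (n : ℕ) (f : P → 𝕜) :
    normSq w (cellAvg w (c n) f) =
      normSq w (cellDiff w c n f) + normSq w (cellAvg w (c (n + 1)) f) := by
  rw [← normSq_add_of_cellAvg_eq_zero hw _ _ (cellAvg_cellDiff hw hc n f)
    (fun p q h => cellAvg_congr f h), cellDiff_apply, sub_add_cancel]

theorem normSq_eq_sum_cellDiff (hw : ∀ p, 0 < w p) (hc : NestedCells c) (N : ℕ) (f : P → 𝕜) :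
    normSq w (cellAvg w (c 0) f) =
      ∑ n ∈ Finset.range N, normSq w (cellDiff w c n f) + normSq w (cellAvg w (c N) f) := by
  induction N with
  | zero => simp
  | succ N ih => rw [ih, normSq_cellAvg hw hc N, Finset.sum_range_succ]; ring

theorem normSq_cellAvg_le (hw : ∀ p, 0 < w p) (c₀ : P → ι) (f : P → 𝕜) :
    normSq w (cellAvg w c₀ f) ≤ normSq w f := by
  have h : cellAvg w c₀ (f - cellAvg w c₀ f) = 0 := by
    rw [map_sub, cellAvg_cellAvg_of_le hw (fun _ _ h => h), sub_self]
  have h2 := normSq_add_of_cellAvg_eq_zero hw _ (cellAvg w c₀ f) h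
    (fun p q h => cellAvg_congr f h)
  rw [sub_add_cancel] at h2
  linarith [normSq_nonneg hw (f - cellAvg w c₀ f)]

theorem sum_normSq_cellDiff_le (hw : ∀ p, 0 < w p) (hc : NestedCells c) (N : ℕ) (f : P → 𝕜) :
    ∑ n ∈ Finset.range N, normSq w (cellDiff w c n f) ≤ normSq w f := by
  have h1 := normSq_eq_sum_cellDiff hw hc N f
  have h2 := normSq_cellAvg_le hw (c 0) f
  linarith [normSq_nonneg hw (cellAvg w (c N) f)]

theorem cellAvg_eq_sum_cellDiff (n N : ℕ) (f : P → 𝕜) :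
    cellAvg w (c n) f =
      ∑ k ∈ Finset.range N, cellDiff w c (n + k) f + cellAvg w (c (n + N)) f := by
  induction N with
  | zero => simp
  | succ N ih =>
    rw [ih, Finset.sum_range_succ, cellDiff_apply (n + N), ← add_assoc n N 1]
    abel

/-- The Carleson embedding theorem for cell averages, in Bellman function form. -/
theorem bellman_carleson (hw : ∀ p, 0 < w p) (hc : NestedCells c) {C : ℝ} (hC : 0 < C)
    (a : ℕ → P → ℝ) (ha : ∀ n p, 0 ≤ a n p)
    (hcar : ∀ n p, cellAvg w (c n) (fun q => ∑ l ∈ Finset.range (n + 1), a l q) p ≤ C)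
    (g : P → ℝ) (n : ℕ) (p : P) :
    cellAvg w (c n) (fun q => ∑ l ∈ Finset.range (n + 1), a l q * cellAvg w (c l) g q ^ 2) p ≤
      4 * C * (cellAvg w (c n) (fun q => g q ^ 2) p - cellAvg w (c n) g p ^ 2 /
        (1 + cellAvg w (c n) (fun q => ∑ l ∈ Finset.range (n + 1), a l q) p / C)) := by
  -- For `C = 1` the Bellman function is 4(F - f²/(1 + A)). Its derivative in A is 4f²/(1 + A)²,
  -- which is at least f² as long as A ≤ 1; this is the origin of the factor 4.
  have key : ∀ G a₀ A : ℝ, 0 ≤ a₀ → 0 ≤ A → a₀ + A ≤ C →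
      a₀ * G ^ 2 ≤ 4 * C * (G ^ 2 / (1 + A / C) - G ^ 2 / (1 + (a₀ + A) / C)) := by
    intro G a₀ A h0 hA hle
    have e : 4 * C * (G ^ 2 / (1 + A / C) - G ^ 2 / (1 + (a₀ + A) / C)) =
        a₀ * G ^ 2 * (4 * C ^ 2 / ((C + A) * (C + (a₀ + A)))) := by
      have : C + A ≠ 0 := by positivity
      have : C + (a₀ + A) ≠ 0 := by positivity
      field_simp
      ring
    rw [e]
    refine le_mul_of_one_le_right (by positivity) ?_
    rw [one_le_div (by positivity)]
    nlinarith
  have avg0 : ∀ (n : ℕ) (f : P → ℝ) (p : P), (∀ q, 0 ≤ f q) → 0 ≤ cellAvg w (c n) f p := by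
    intro n f p hf
    simpa using cellAvg_mono (c := c n) hw (f := 0) (g := f) hf p
  have split : ∀ (n : ℕ) (p : P), cellAvg w (c n) (fun q => a n q * cellAvg w (c n) g q ^ 2) p =
      cellAvg w (c n) (a n) p * cellAvg w (c n) g p ^ 2 := by
    intro n p
    have := cellAvg_mul_const (w := w) (c := c n) (a n) (fun q => cellAvg w (c n) g q ^ 2)
      (fun p q h => by rw [cellAvg_congr g h]) p
    simp only [mul_comm (a n _)]
    rw [this, mul_comm]
  have add : ∀ (n : ℕ) (u v : P → ℝ) (p : P), cellAvg w (c n) (fun q => u q + v q) p =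
      cellAvg w (c n) u p + cellAvg w (c n) v p := by
    intro n u v p
    exact congrFun (map_add (cellAvg w (c n)) u v) p
  induction n generalizing p with
  | zero =>
    simp only [zero_add, Finset.range_one, Finset.sum_singleton] at hcar ⊢
    have h0 := hcar 0 p
    simp only [zero_add, Finset.range_one, Finset.sum_singleton] at h0
    have h1 := sq_cellAvg_div_le (c := c 0) hw g (fun _ => 1) (fun _ => one_pos) p
    have h2 : cellAvg w (c 0) (fun _ => (1 : ℝ)) p = 1 :=
      congrFun (cellAvg_const hw _ fun _ _ _ => rfl) p
    simp only [h2, div_one] at h1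
    have h3 := key (cellAvg w (c 0) g p) (cellAvg w (c 0) (a 0) p) 0 (avg0 _ _ _ (ha 0)) le_rfl
      (by simpa using h0)
    rw [split]
    simp only [zero_div, add_zero, div_one] at h3
    refine h3.trans ?_
    gcongr
  | succ n ih =>
    set A : P → ℝ := fun q => cellAvg w (c n) (fun q => ∑ l ∈ Finset.range (n + 1), a l q) q
      with hA
    have hA0 : ∀ q, 0 ≤ A q := fun q => avg0 _ _ _ fun q => Finset.sum_nonneg fun l _ => ha l q
    have tower : ∀ f : P → ℝ, cellAvg w (c (n + 1)) f p =
        cellAvg w (c (n + 1)) (cellAvg w (c n) f) p := fun f => by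
      rw [cellAvg_cellAvg_of_le hw (hc n)]
    have h1 := cellAvg_mono (c := c (n + 1)) hw ih p
    rw [← tower] at h1
    -- Passage to the coarser level: by joint convexity the average of the quotients dominates the
    -- quotient of the averages. The new coefficient `a (n + 1)` is then paid for by `key`.
    have h2 := sq_cellAvg_div_le (c := c (n + 1)) hw (cellAvg w (c n) g) (fun q => 1 + A q / C)
      (fun q => by have := hA0 q; positivity) p
    rw [← tower] at h2
    have h3 : cellAvg w (c (n + 1)) (fun q => 1 + A q / C) p =
        1 + cellAvg w (c (n + 1)) (fun q => ∑ l ∈ Finset.range (n + 1), a l q) p / C := by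
      rw [add, congrFun (cellAvg_const hw (fun _ => (1 : ℝ)) fun _ _ _ => rfl) p,
        tower (fun q => ∑ l ∈ Finset.range (n + 1), a l q)]
      congr 1
      have := congrFun (map_smul (cellAvg w (c (n + 1))) C⁻¹ A) p
      simp only [Pi.smul_apply, smul_eq_mul] at this
      rw [div_eq_inv_mul]
      refine Eq.trans (congrFun (congrArg _ ?_) p) this
      ext q
      simp [div_eq_inv_mul]
    rw [h3] at h2
    have h4 : cellAvg w (c (n + 1)) (fun q => 4 * C * (cellAvg w (c n) (fun q => g q ^ 2) q -
        cellAvg w (c n) g q ^ 2 / (1 + A q / C))) p = 4 * C *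
        (cellAvg w (c (n + 1)) (fun q => g q ^ 2) p -
          cellAvg w (c (n + 1)) (fun q => cellAvg w (c n) g q ^ 2 / (1 + A q / C)) p) := by
      rw [tower (fun q => g q ^ 2)]
      exact (congrFun (map_smul (cellAvg w (c (n + 1))) (4 * C)
        (cellAvg w (c n) (fun q => g q ^ 2) -
          fun q => cellAvg w (c n) g q ^ 2 / (1 + A q / C))) p).trans (by rw [map_sub])
    simp only [hA] at h4 h2
    rw [h4] at h1
    have h5 : ∀ q, ∑ l ∈ Finset.range (n + 1 + 1), a l q * cellAvg w (c l) g q ^ 2 =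
        ∑ l ∈ Finset.range (n + 1), a l q * cellAvg w (c l) g q ^ 2 +
          a (n + 1) q * cellAvg w (c (n + 1)) g q ^ 2 := fun q => Finset.sum_range_succ _ _
    have h6 : ∀ q, ∑ l ∈ Finset.range (n + 1 + 1), a l q =
        ∑ l ∈ Finset.range (n + 1), a l q + a (n + 1) q := fun q => Finset.sum_range_succ _ _
    have hle := hcar (n + 1) p
    simp only [h5, h6] at hle ⊢
    rw [add] at hle
    rw [add, add, split]
    set A₁ := cellAvg w (c (n + 1)) (fun q => ∑ l ∈ Finset.range (n + 1), a l q) p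
    have hA1 : 0 ≤ A₁ := avg0 _ _ _ fun q => Finset.sum_nonneg fun l _ => ha l q
    have h7 := key (cellAvg w (c (n + 1)) g p) (cellAvg w (c (n + 1)) (a (n + 1)) p) A₁
      (avg0 _ _ _ (ha _)) hA1 (by linarith)
    rw [add_comm (cellAvg w (c (n + 1)) (a (n + 1)) p) A₁] at h7
    have h8 := mul_le_mul_of_nonneg_left h2 (by positivity : 0 ≤ 4 * C)
    change _ ≤ _ at h1
    rw [mul_sub] at h1 h7 ⊢
    linarith

/-- The Carleson embedding theorem for cell averages. -/
theorem carleson_embedding (hw : ∀ p, 0 < w p) (hc : NestedCells c) {C : ℝ} (hC : 0 < C)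
    (a : ℕ → P → ℝ) (ha : ∀ n p, 0 ≤ a n p)
    (hcar : ∀ n p, cellAvg w (c n) (fun q => ∑ l ∈ Finset.range (n + 1), a l q) p ≤ C)
    (g : P → 𝕜) (N : ℕ) :
    ∑ n ∈ Finset.range N, ∑ p, w p * (a n p * ‖cellAvg w (c n) g p‖ ^ 2) ≤
      4 * C * normSq w g := by
  rcases N with _ | n
  · have := normSq_nonneg hw g
    simp only [Finset.range_zero, Finset.sum_empty]
    positivity
  have tot : ∀ f : P → ℝ, ∑ p, w p * cellAvg w (c n) f p = ∑ p, w p * f p := by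
    intro f
    simpa using sum_cellAvg_mul (c := c n) hw f (fun _ => 1) (fun _ _ _ => rfl)
  calc ∑ n ∈ Finset.range (n + 1), ∑ p, w p * (a n p * ‖cellAvg w (c n) g p‖ ^ 2)
      ≤ ∑ n ∈ Finset.range (n + 1), ∑ p, w p *
          (a n p * cellAvg w (c n) (fun q => ‖g q‖) p ^ 2) := by
        gcongr with n _ p _
        · exact (hw p).le
        · exact ha n p
        · exact norm_cellAvg_le hw g p
    _ = ∑ p, w p * ∑ n ∈ Finset.range (n + 1),
          (a n p * cellAvg w (c n) (fun q => ‖g q‖) p ^ 2) := by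
        rw [Finset.sum_comm]
        simp only [Finset.mul_sum]
    _ = ∑ p, w p * cellAvg w (c n) (fun p => ∑ n ∈ Finset.range (n + 1),
          (a n p * cellAvg w (c n) (fun q => ‖g q‖) p ^ 2)) p := (tot _).symm
    _ ≤ ∑ p, w p * (4 * C * cellAvg w (c n) (fun q => ‖g q‖ ^ 2) p) := by
        refine Finset.sum_le_sum fun p _ => mul_le_mul_of_nonneg_left ?_ (hw p).le
        refine (bellman_carleson hw hc hC a ha hcar (fun q => ‖g q‖) n p).trans ?_
        refine mul_le_mul_of_nonneg_left (sub_le_self _ ?_) (by positivity)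
        have : 0 ≤ cellAvg w (c n) (fun q => ∑ l ∈ Finset.range (n + 1), a l q) p := by
          simpa using cellAvg_mono (c := c n) hw (f := 0)
            (fun q => Finset.sum_nonneg fun l _ => ha l q) p
        positivity
    _ = 4 * C * ∑ p, w p * cellAvg w (c n) (fun q => ‖g q‖ ^ 2) p := by
        rw [Finset.mul_sum]
        exact Finset.sum_congr rfl fun p _ => by ring
    _ = 4 * C * normSq w g := by rw [tot, normSq]

end Martingale

/-! ### The Schur test. -/

section Schur

theorem Finset.sum_le_sqrt_mul_sqrt {α : Type*} (s : Finset α) {r f g : α → ℝ}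
    (hf : ∀ i ∈ s, 0 ≤ f i) (hg : ∀ i ∈ s, 0 ≤ g i) (h : ∀ i ∈ s, r i ^ 2 ≤ f i * g i) :
    ∑ i ∈ s, r i ≤ √(∑ i ∈ s, f i) * √(∑ i ∈ s, g i) := by
  rw [← Real.sqrt_mul (Finset.sum_nonneg hf)]
  exact Real.le_sqrt_of_sq_le (Finset.sum_sq_le_sum_mul_sum_of_sq_le_mul s hf hg h)

/-- The Schur test for finite sums. -/
theorem Finset.schur_test {α β : Type*} (s : Finset α) (t : Finset β) {u : α → β → ℝ}
    (hu : ∀ i j, 0 ≤ u i j) {C : ℝ} (hC : 0 ≤ C) {m : α → ℝ} {m' : β → ℝ}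
    (hrow : ∀ i ∈ s, ∑ j ∈ t, u i j ≤ C * m i) (hcol : ∀ j ∈ t, ∑ i ∈ s, u i j ≤ C * m' j)
    (x : α → ℝ) (y : β → ℝ) :
    ∑ i ∈ s, ∑ j ∈ t, u i j * (x i * y j) ≤
      C * (√(∑ i ∈ s, m i * x i ^ 2) * √(∑ j ∈ t, m' j * y j ^ 2)) := by
  rw [← Finset.sum_product']
  refine (Finset.sum_le_sqrt_mul_sqrt (s ×ˢ t) (f := fun z => u z.1 z.2 * x z.1 ^ 2)
    (g := fun z => u z.1 z.2 * y z.2 ^ 2) (fun z _ => mul_nonneg (hu _ _) (sq_nonneg _))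
    (fun z _ => mul_nonneg (hu _ _) (sq_nonneg _)) (fun z _ => le_of_eq (by ring))).trans ?_
  have h1 : ∑ z ∈ s ×ˢ t, u z.1 z.2 * x z.1 ^ 2 ≤ C * ∑ i ∈ s, m i * x i ^ 2 := by
    rw [Finset.sum_product, Finset.mul_sum]
    refine Finset.sum_le_sum fun i hi => ?_
    simp only
    rw [← Finset.sum_mul, ← mul_assoc]
    exact mul_le_mul_of_nonneg_right (hrow i hi) (sq_nonneg _)
  have h2 : ∑ z ∈ s ×ˢ t, u z.1 z.2 * y z.2 ^ 2 ≤ C * ∑ j ∈ t, m' j * y j ^ 2 := by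
    rw [Finset.sum_product_right, Finset.mul_sum]
    refine Finset.sum_le_sum fun i hi => ?_
    simp only
    rw [← Finset.sum_mul, ← mul_assoc]
    exact mul_le_mul_of_nonneg_right (hcol i hi) (sq_nonneg _)
  calc _ ≤ √(C * ∑ i ∈ s, m i * x i ^ 2) * √(C * ∑ j ∈ t, m' j * y j ^ 2) := by gcongr
    _ = _ := by
      rw [Real.sqrt_mul hC, Real.sqrt_mul hC]
      linear_combination (√(∑ i ∈ s, m i * x i ^ 2) * √(∑ j ∈ t, m' j * y j ^ 2)) *
        Real.mul_self_sqrt hC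

end Schur

/-! ### Bilinear forms on a finite set: testing and decoupling. -/

section TreeForm

variable {P ι 𝕜 : Type*} [Fintype P] [DecidableEq ι] [RCLike 𝕜]

/-- The bilinear form with matrix `b`. -/
def bilin (b : P → P → 𝕜) (f g : P → 𝕜) : 𝕜 := ∑ p, ∑ q, b p q * f p * g q

/-- The testing condition on the cells of `c` for the form with matrix `b`. -/
def CellTesting (w : P → ℝ) (c : P → ι) (b : P → P → 𝕜) (a : ℝ) : Prop :=
  ∀ p₀ (g : P → 𝕜), ‖∑ p with c p = c p₀, ∑ q, b p q * g q‖ ≤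
    a * (√(cellMass w c p₀) * √(normSq w g))

/-- The form with matrix `b`, applied to a mean zero function `h` on the cell of a point `p₀` and
a function `g` supported in the set of all `q` with `S p₀ q`, is controlled by the absolute
values of `h` and `g` through weights that satisfy the Schur test with constant `C`. -/
def Decouples (w : P → ℝ) (c : P → ι) (b : P → P → 𝕜) (S : P → P → Prop) (C : ℝ) : Prop :=
  ∃ u : P → P → ℝ, (∀ p q, 0 ≤ u p q) ∧ (∀ p, ∑ q, u p q ≤ C * w p) ∧
    (∀ q, ∑ p, u p q ≤ C * w q) ∧ ∀ (p₀ : P) (h g : P → 𝕜), (∀ p, h p ≠ 0 → c p = c p₀) →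
      ∑ p, (w p : 𝕜) * h p = 0 → (∀ q, g q ≠ 0 → S p₀ q) →
      ‖bilin b h g‖ ≤ ∑ p, ∑ q, u p q * (‖h p‖ * ‖g q‖)

variable {w : P → ℝ} {b : P → P → 𝕜}

theorem bilin_add_left (f f' g : P → 𝕜) : bilin b (f + f') g = bilin b f g + bilin b f' g := by
  simp [bilin, mul_add, add_mul, Finset.sum_add_distrib]

theorem bilin_add_right (f g g' : P → 𝕜) : bilin b f (g + g') = bilin b f g + bilin b f g' := by
  simp [bilin, mul_add, Finset.sum_add_distrib]

theorem bilin_sum_right {α : Type*} (s : Finset α) (f : P → 𝕜) (g : α → P → 𝕜) :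
    bilin b f (∑ i ∈ s, g i) = ∑ i ∈ s, bilin b f (g i) := by
  simp only [bilin, Finset.sum_apply, Finset.mul_sum]
  exact (Finset.sum_congr rfl fun p _ => Finset.sum_comm).trans Finset.sum_comm

theorem bilin_swap (f g : P → 𝕜) : bilin (fun p q => b q p) f g = bilin b g f := by
  rw [bilin, bilin, Finset.sum_comm]
  exact Finset.sum_congr rfl fun p _ => Finset.sum_congr rfl fun q _ => by ring

/-- Obtained by restricting `f` to one cell at a time, where it has mean zero. The second function
may vary from cell to cell because the value later subtracted from `g` depends on the cell that
carries `f`. -/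
theorem Decouples.exists_weight {c : P → ι} {S : P → P → Prop} {C : ℝ}
    (hD : Decouples w c b S C) :
    ∃ u : P → P → ℝ, (∀ p q, 0 ≤ u p q) ∧ (∀ p, ∑ q, u p q ≤ C * w p) ∧
    (∀ q, ∑ p, u p q ≤ C * w q) ∧ ∀ (f : P → 𝕜) (G : P → P → 𝕜), cellAvg w c f = 0 →
      (∀ p, 0 < w p) → (∀ p p', c p = c p' → G p = G p') →
      (∀ p q, f p ≠ 0 → G p q ≠ 0 → S p q) →
      ‖∑ p, ∑ q, b p q * f p * G p q‖ ≤ ∑ p, ∑ q, u p q * (‖f p‖ * ‖G p q‖) := by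
  obtain ⟨u, hu, hrow, hcol, h⟩ := hD
  refine ⟨u, hu, hrow, hcol, fun f G hf hw hG hS => ?_⟩
  rw [← Finset.sum_fiberwise_of_maps_to (t := Finset.univ.image c) (g := c) (by simp),
    ← Finset.sum_fiberwise_of_maps_to (t := Finset.univ.image c) (g := c) (by simp)
      (fun p => ∑ q, u p q * (‖f p‖ * ‖G p q‖))]
  refine norm_sum_le_of_le _ fun v _ => ?_
  by_cases hv : ∃ p, c p = v ∧ f p ≠ 0
  · obtain ⟨p₀, rfl, hp₀⟩ := hv
    have key := h p₀ (fun p => if c p = c p₀ then f p else 0) (G p₀) (fun p hp => by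
      by_contra hne
      simp [hne] at hp) ?_ (fun q hq => hS p₀ q hp₀ hq)
    · have e1 : bilin b (fun p => if c p = c p₀ then f p else 0) (G p₀) =
          ∑ p with c p = c p₀, ∑ q, b p q * f p * G p q := by
        rw [bilin, Finset.sum_filter]
        refine Finset.sum_congr rfl fun p _ => ?_
        split_ifs with hp
        · rw [hG p p₀ hp]
        · simp
      rw [e1] at key
      refine key.trans_eq ?_
      rw [Finset.sum_filter]
      refine Finset.sum_congr rfl fun p _ => ?_
      split_ifs with hp
      · rw [hG p p₀ hp]
      · simp
    · have h1 := congrFun hf p₀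
      rw [cellAvg_apply, Pi.zero_apply, mul_eq_zero] at h1
      have h2 := h1.resolve_left (inv_ne_zero (cellMass_ne_zero hw p₀))
      simpa [Finset.sum_filter] using h2
  · push Not at hv
    have h0 : ∀ p ∈ Finset.univ.filter (fun p => c p = v), f p = 0 := fun p hp =>
      hv p (by simpa using hp)
    rw [Finset.sum_eq_zero fun p hp => Finset.sum_eq_zero fun q _ => by rw [h0 p hp]; simp,
      Finset.sum_eq_zero fun p hp => Finset.sum_eq_zero fun q _ => by rw [h0 p hp]; simp]
    simp

/-- The part of the form near the diagonal is controlled by testing on cells. -/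
theorem CellTesting.norm_near_le (hw : ∀ p, 0 < w p) {c : P → ι} {a : ℝ} (ha : 0 ≤ a)
    (hT : CellTesting w c b a) {K : ℕ} (R : P → P → Prop) [DecidableRel R]
    (hR : ∀ p p' q q', c p = c p' → c q = c q' → R p q → R p' q')
    (hrow : ∀ p, ((Finset.univ.filter (R p)).image c).card ≤ K)
    (hcol : ∀ q, ((Finset.univ.filter fun p => R p q).image c).card ≤ K) (f g : P → 𝕜)
    (hf : ∀ p q, c p = c q → f p = f q) (hg : ∀ p q, c p = c q → g p = g q) :
    ‖∑ p, ∑ q, b p q * f p * (if R p q then g q else 0)‖ ≤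
      a * K * (√(normSq w f) * √(normSq w g)) := by
  classical
  rcases isEmpty_or_nonempty P with hP | hP
  · simp only [Finset.univ_eq_empty, Finset.sum_empty, norm_zero]
    positivity
  set s : ι → P := Function.invFun c with hs
  have hsc : ∀ p, c (s (c p)) = c p := fun p => Function.invFun_eq ⟨p, rfl⟩
  set I := Finset.univ.image c with hI
  let X : (P → 𝕜) → ι → ℝ := fun f v => √(∑ p with c p = v, w p * ‖f p‖ ^ 2)
  have hX : ∀ (f : P → 𝕜) (p : P), (∀ p q, c p = c q → f p = f q) →
      X f (c p) = ‖f p‖ * √(cellMass w c p) := by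
    intro f p hf
    simp only [X]
    rw [← Real.sqrt_sq (norm_nonneg (f p)), ← Real.sqrt_mul (sq_nonneg _), cellMass,
      Finset.mul_sum]
    congr 1
    refine Finset.sum_congr rfl fun q hq => ?_
    rw [hf q p (by simpa using hq), mul_comm]
  have hXsum : ∀ f : P → 𝕜, ∑ v ∈ I, 1 * X f v ^ 2 = normSq w f := by
    intro f
    rw [normSq, ← Finset.sum_fiberwise_of_maps_to (t := I) (g := c) (by simp [hI])]
    refine Finset.sum_congr rfl fun v _ => ?_
    rw [one_mul, Real.sq_sqrt (Finset.sum_nonneg fun p _ =>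
      mul_nonneg (hw p).le (sq_nonneg _))]
  -- As `f`, `g` and `R` only see cells, the form collapses to a matrix indexed by pairs of cells,
  -- with `s` choosing representatives.
  have e : ∑ p, ∑ q, b p q * f p * (if R p q then g q else 0) =
      ∑ v ∈ I, ∑ v' ∈ I, if R (s v) (s v') then
        f (s v) * g (s v') * ∑ p with c p = v, ∑ q with c q = v', b p q else 0 := by
    rw [← Finset.sum_fiberwise_of_maps_to (t := I) (g := c) (by simp [hI])]
    refine Finset.sum_congr rfl fun v hv => ?_
    rw [Finset.sum_congr rfl fun p _ => (Finset.sum_fiberwise_of_maps_to (t := I) (g := c)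
      (by simp [hI]) _).symm, Finset.sum_comm]
    refine Finset.sum_congr rfl fun v' hv' => ?_
    obtain ⟨p₀, -, rfl⟩ := Finset.mem_image.mp hv
    obtain ⟨q₀, -, rfl⟩ := Finset.mem_image.mp hv'
    rw [Finset.mul_sum]
    simp only [Finset.mul_sum]
    split_ifs with h
    · refine Finset.sum_congr rfl fun p hp => Finset.sum_congr rfl fun q hq => ?_
      have hp : c p = c p₀ := by simpa using hp
      have hq : c q = c q₀ := by simpa using hq
      have h1 : R p q := hR _ _ _ _ ((hsc p₀).trans hp.symm) ((hsc q₀).trans hq.symm) h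
      rw [if_pos h1, hf p _ (hp.trans (hsc p₀).symm), hg q _ (hq.trans (hsc q₀).symm)]
      ring
    · refine Finset.sum_eq_zero fun p hp => Finset.sum_eq_zero fun q hq => ?_
      have hp : c p = c p₀ := by simpa using hp
      have hq : c q = c q₀ := by simpa using hq
      have h1 : ¬R p q := fun h1 =>
        h (hR _ _ _ _ (hp.trans (hsc p₀).symm) (hq.trans (hsc q₀).symm) h1)
      rw [if_neg h1, mul_zero]
  rw [e]
  -- Testing against the indicator of a second cell. No separation is needed, since the testing
  -- bound is not restricted to the tested cell.
  have hcell : ∀ p₀ q₀ : P, ‖∑ p with c p = c p₀, ∑ q with c q = c q₀, b p q‖ ≤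
      a * (√(cellMass w c p₀) * √(cellMass w c q₀)) := by
    intro p₀ q₀
    have := hT p₀ (fun q => if c q = c q₀ then 1 else 0)
    have h1 : normSq w (fun q => if c q = c q₀ then (1 : 𝕜) else 0) = cellMass w c q₀ := by
      rw [normSq, cellMass, Finset.sum_filter]
      refine Finset.sum_congr rfl fun q _ => ?_
      split_ifs <;> simp
    rw [h1] at this
    simpa [Finset.sum_filter] using this
  calc _ ≤ ∑ v ∈ I, ∑ v' ∈ I, (if R (s v) (s v') then a else 0) * (X f v * X g v') := by
        refine norm_sum_le_of_le _ fun v hv => norm_sum_le_of_le _ fun v' hv' => ?_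
        obtain ⟨p₀, -, rfl⟩ := Finset.mem_image.mp hv
        obtain ⟨q₀, -, rfl⟩ := Finset.mem_image.mp hv'
        split_ifs with h
        · rw [norm_mul, norm_mul, hX f _ hf, hX g _ hg, hf _ p₀ (hsc p₀), hg _ q₀ (hsc q₀)]
          calc _ ≤ ‖f p₀‖ * ‖g q₀‖ * (a * (√(cellMass w c p₀) * √(cellMass w c q₀))) := by
                gcongr
                exact hcell p₀ q₀
            _ = _ := by ring
        · simp
    _ ≤ a * K * (√(∑ v ∈ I, 1 * X f v ^ 2) * √(∑ v ∈ I, 1 * X g v ^ 2)) := by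
        refine Finset.schur_test I I (fun i j => by split_ifs <;> simp [ha])
          (by positivity) (fun v hv => ?_) (fun v hv => ?_) (X f) (X g)
        · rw [← Finset.sum_filter, Finset.sum_const, nsmul_eq_mul, mul_one, mul_comm]
          refine mul_le_mul_of_nonneg_left (Nat.cast_le.mpr ((Finset.card_le_card ?_).trans
            (hrow (s v)))) ha
          intro v' hv'
          simp only [Finset.mem_filter] at hv'
          refine Finset.mem_image.mpr ⟨s v', by simpa using hv'.2, ?_⟩
          obtain ⟨q₀, -, rfl⟩ := Finset.mem_image.mp hv'.1
          exact hsc q₀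
        · rw [← Finset.sum_filter, Finset.sum_const, nsmul_eq_mul, mul_one, mul_comm]
          refine mul_le_mul_of_nonneg_left (Nat.cast_le.mpr ((Finset.card_le_card ?_).trans
            (hcol (s v)))) ha
          intro v' hv'
          simp only [Finset.mem_filter] at hv'
          refine Finset.mem_image.mpr ⟨s v', by simpa using hv'.2, ?_⟩
          obtain ⟨q₀, -, rfl⟩ := Finset.mem_image.mp hv'.1
          exact hsc q₀
    _ = _ := by rw [hXsum, hXsum]

end TreeForm

/-! ### Estimates for martingale differences and the Carleson condition. -/

section TreeTheorem

variable {P ι 𝕜 : Type*} [Fintype P] [DecidableEq ι] [RCLike 𝕜]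

/-- The hypotheses of the `T1` theorem on a finite tree that are used for the interactions of
martingale differences with martingale differences at the same or a coarser level. -/
structure IsUpperT1Form (w : P → ℝ) (c : ℕ → P → ι) (b : P → P → 𝕜) (near : ι → ι → Prop)
    (good : ℕ → P → Prop) (r K : ℕ) (a C θ : ℝ) : Prop where
  testing : ∀ n, CellTesting w (c n) b a
  testing_swap : ∀ n, CellTesting w (c n) (fun p q => b q p) a
  near_far : ∀ n, Decouples w (c n) b (fun p q => ¬near (c n p) (c n q)) C
  good_far : ∀ n k, r ≤ k →
    Decouples w (c n) b (fun p q => good n p ∧ c (n + k) q ≠ c (n + k) p) (C * θ ^ k)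

/-- Every cell has at most `K` subcells, one level finer, of cells that are near to it. -/
def NearCard (c : ℕ → P → ι) (near : ι → ι → Prop) [DecidableRel near]
    (K : ℕ) : Prop :=
  ∀ n p, ((Finset.univ.filter fun q => near (c (n + 1) p) (c (n + 1) q)).image (c n)).card ≤ K

/-- A function all of whose martingale differences live on good cells. -/
def IsGoodFunction (w : P → ℝ) (c : ℕ → P → ι) (good : ℕ → P → Prop) (f : P → 𝕜) : Prop :=
  ∀ n p, cellDiff w c n f p ≠ 0 → good (n + 1) p

variable {w : P → ℝ} {c : ℕ → P → ι} {b : P → P → 𝕜}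

/-- The difference operator is the orthogonal projection onto the functions that are constant on the
finer cells and have mean zero on the coarser ones. -/
theorem sum_cellDiff_mul (hw : ∀ p, 0 < w p) (n : ℕ) (f g : P → 𝕜)
    (hg : ∀ p q, c n p = c n q → g p = g q) (hg0 : cellAvg w (c (n + 1)) g = 0) :
    ∑ p, (w p : 𝕜) * cellDiff w c n f p * g p = ∑ p, (w p : 𝕜) * f p * g p := by
  have h1 := sum_cellAvg_mul (c := c n) hw f g hg
  have h2 := sum_cellAvg_mul (c := c (n + 1)) hw g (cellAvg w (c (n + 1)) f)
    (fun p q h => cellAvg_congr f h)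
  simp only [hg0, Pi.zero_apply, mul_zero, zero_mul, Finset.sum_const_zero] at h2
  have h3 : ∑ p, (w p : 𝕜) * cellAvg w (c (n + 1)) f p * g p = 0 := by
    rw [h2]
    exact Finset.sum_congr rfl fun p _ => by ring
  simp only [cellDiff_apply, Pi.sub_apply, mul_sub, sub_mul, Finset.sum_sub_distrib]
  rw [h1, h3, sub_zero]

/-- Multipliers that are constant on the coarser cells preserve the range of the difference
operator. They serve as indicators of good or bad cells and as averages of `g` in the paraproduct.
-/
theorem cellDiff_mul_of_const (hw : ∀ p, 0 < w p) (hc : NestedCells c) (n : ℕ) (f e : P → 𝕜)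
    (he : ∀ p q, c (n + 1) p = c (n + 1) q → e p = e q) :
    (∀ p q, c n p = c n q → e p * cellDiff w c n f p = e q * cellDiff w c n f q) ∧
      cellAvg w (c (n + 1)) (fun p => e p * cellDiff w c n f p) = 0 := by
  refine ⟨fun p q h => by rw [he p q (hc n p q h), cellDiff_congr hc f h], ?_⟩
  ext p
  rw [cellAvg_mul_const _ _ he, cellAvg_cellDiff hw hc]
  simp

/-- Cauchy–Schwarz and orthogonality at a fixed level gap `k`: all interactions with this gap
together cost a single constant, so only summability in `k` remains to be secured. -/
theorem sum_sqrt_normSq_cellDiff_le (hw : ∀ p, 0 < w p) (hc : NestedCells c) (f g : P → 𝕜)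
    (N k : ℕ) :
    ∑ n ∈ Finset.range N, √(normSq w (cellDiff w c n f)) * √(normSq w (cellDiff w c (k + n) g)) ≤
      √(normSq w f) * √(normSq w g) := by
  refine (Real.sum_sqrt_mul_sqrt_le _ (fun n => normSq_nonneg hw _)
    (fun n => normSq_nonneg hw _)).trans ?_
  gcongr
  · exact sum_normSq_cellDiff_le hw hc N f
  · exact sum_normSq_cellDiff_le (c := fun n => c (k + n)) hw (fun n => hc (k + n)) N g

variable {near : ι → ι → Prop} {good : ℕ → P → Prop} {r K : ℕ} {a C θ : ℝ}

/-- The Schur test treats the part with `g q`. The subtracted value `g' p` depends on `p` alone, so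
row sums of the weights and Cauchy–Schwarz suffice for it. -/
theorem Decouples.norm_le {c₀ : P → ι} {S : P → P → Prop} {D : ℝ} (hD : Decouples w c₀ b S D)
    (hw : ∀ p, 0 < w p) (hD0 : 0 ≤ D) (f g g' : P → 𝕜) (R : P → P → Prop) [DecidableRel R]
    (hf : cellAvg w c₀ f = 0)
    (hR : ∀ p p' q, c₀ p = c₀ p' → (R p q ↔ R p' q)) (hRS : ∀ p q, f p ≠ 0 → R p q → S p q)
    (hg' : ∀ p q, c₀ p = c₀ q → g' p = g' q) :
    ‖∑ p, ∑ q, b p q * f p * (if R p q then g q - g' p else 0)‖ ≤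
      D * (√(normSq w f) * (√(normSq w g) + √(normSq w g'))) := by
  obtain ⟨u, hu, hrow, hcol, h⟩ := hD.exists_weight
  have h1 := h f (fun p q => if R p q then g q - g' p else 0) hf hw (fun p p' hp => by
    ext q
    simp only [hR p p' q hp, hg' p p' hp]) (fun p q hp hq => hRS p q hp (by
      by_contra hne
      simp [hne] at hq))
  refine h1.trans ?_
  have h2 : ∑ p, ∑ q, u p q * (‖f p‖ * ‖if R p q then g q - g' p else 0‖) ≤
      ∑ p, ∑ q, u p q * (‖f p‖ * ‖g q‖) + ∑ p, ∑ q, u p q * (‖f p‖ * ‖g' p‖) := by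
    rw [← Finset.sum_add_distrib]
    refine Finset.sum_le_sum fun p _ => ?_
    rw [← Finset.sum_add_distrib]
    refine Finset.sum_le_sum fun q _ => ?_
    rw [← mul_add, ← mul_add]
    refine mul_le_mul_of_nonneg_left (mul_le_mul_of_nonneg_left ?_ (norm_nonneg _)) (hu p q)
    split_ifs
    · exact norm_sub_le _ _
    · rw [norm_zero]
      positivity
  have h3 : ∑ p, ∑ q, u p q * (‖f p‖ * ‖g q‖) ≤ D * (√(normSq w f) * √(normSq w g)) :=
    Finset.schur_test Finset.univ Finset.univ hu hD0 (fun p _ => hrow p) (fun q _ => hcol q)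
      (fun p => ‖f p‖) (fun q => ‖g q‖)
  have h4 : ∑ p, ∑ q, u p q * (‖f p‖ * ‖g' p‖) ≤ D * (√(normSq w f) * √(normSq w g')) := by
    calc ∑ p, ∑ q, u p q * (‖f p‖ * ‖g' p‖) ≤ ∑ p, D * (w p * (‖f p‖ * ‖g' p‖)) := by
          refine Finset.sum_le_sum fun p _ => ?_
          rw [← Finset.sum_mul, ← mul_assoc D]
          exact mul_le_mul_of_nonneg_right (hrow p) (by positivity)
      _ ≤ _ := by
          rw [← Finset.mul_sum]
          refine mul_le_mul_of_nonneg_left (Finset.sum_le_sqrt_mul_sqrt _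
            (fun p _ => mul_nonneg (hw p).le (sq_nonneg _))
            (fun p _ => mul_nonneg (hw p).le (sq_nonneg _)) fun p _ => le_of_eq ?_) hD0
          ring
  calc _ ≤ _ := h2
    _ ≤ D * (√(normSq w f) * √(normSq w g)) + D * (√(normSq w f) * √(normSq w g')) :=
      add_le_add h3 h4
    _ = _ := by ring

/-- Interaction of martingale differences of comparable levels. -/
theorem IsUpperT1Form.norm_bilin_cellDiff_le [DecidableRel near]
    (H : IsUpperT1Form w c b near good r K a C θ)
    (hw : ∀ p, 0 < w p) (hc : NestedCells c) (ha : 0 ≤ a) (hC : 0 ≤ C)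
    (hsymm : ∀ v v', near v v' → near v' v) (hcard : NearCard c near K) (f g : P → 𝕜)
    (n k : ℕ) :
    ‖bilin b (cellDiff w c n f) (cellDiff w c (k + n) g)‖ ≤ (a * K + C) *
      (√(normSq w (cellDiff w c n f)) * √(normSq w (cellDiff w c (k + n) g))) := by
  set F := cellDiff w c n f
  set G := cellDiff w c (k + n) g
  have hG : ∀ p q, c n p = c n q → G p = G q := fun p q h =>
    cellDiff_congr hc g (hc.mono (Nat.le_add_left n k) p q h)
  -- Nearness is measured between parent cells, on which `F` has mean zero; testing is applied to
  -- the children, on which both functions are constant.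
  have e : bilin b F G =
      ∑ p, ∑ q, b p q * F p * (if near (c (n + 1) p) (c (n + 1) q) then G q else 0) +
      ∑ p, ∑ q, b p q * F p * (if ¬near (c (n + 1) p) (c (n + 1) q) then
        G q - (0 : P → 𝕜) p else 0) := by
    rw [bilin, ← Finset.sum_add_distrib]
    refine Finset.sum_congr rfl fun p _ => ?_
    rw [← Finset.sum_add_distrib]
    refine Finset.sum_congr rfl fun q _ => ?_
    by_cases h : near (c (n + 1) p) (c (n + 1) q) <;> simp [h]
  have h1 := (H.testing n).norm_near_le hw ha
    (K := K) (fun p q => near (c (n + 1) p) (c (n + 1) q))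
    (fun p p' q q' hp hq h => by rwa [← hc n _ _ hp, ← hc n _ _ hq]) (hcard n)
    (fun q => by
      refine (Finset.card_le_card (Finset.image_subset_image fun p => ?_)).trans (hcard n q)
      simpa using hsymm _ _) F G (fun p q h => cellDiff_congr hc f h) hG
  have h2 := (H.near_far (n + 1)).norm_le hw hC F G 0
    (fun p q => ¬near (c (n + 1) p) (c (n + 1) q)) (cellAvg_cellDiff hw hc n f)
    (fun p p' q h => by rw [h]) (fun p q _ h => h) (fun _ _ _ => rfl)
  have h3 : normSq w (0 : P → 𝕜) = 0 := by simp [normSq]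
  rw [h3, Real.sqrt_zero, add_zero] at h2
  rw [e, add_mul]
  exact (norm_add_le _ _).trans (add_le_add h1 h2)

/-- Interaction of a martingale difference of a good function with a coarser one, after
subtraction of its constant value. -/
theorem IsUpperT1Form.norm_sum_sub_le (H : IsUpperT1Form w c b near good r K a C θ)
    (hw : ∀ p, 0 < w p) (hc : NestedCells c) (hC : 0 ≤ C) (hθ : 0 ≤ θ) {f : P → 𝕜}
    (hf : IsGoodFunction w c good f) (g : P → 𝕜) (n k : ℕ) (hk : r ≤ k) :
    ‖∑ p, ∑ q, b p q * cellDiff w c n f p *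
      (cellDiff w c (n + 1 + k) g q - cellDiff w c (n + 1 + k) g p)‖ ≤ 2 * C * θ ^ k *
      (√(normSq w (cellDiff w c n f)) * √(normSq w (cellDiff w c (n + 1 + k) g))) := by
  set G := cellDiff w c (n + 1 + k) g
  have h := (H.good_far (n + 1) k hk).norm_le hw (by positivity) (cellDiff w c n f) G G
    (fun p q => c (n + 1 + k) q ≠ c (n + 1 + k) p) (cellAvg_cellDiff hw hc n f)
    (fun p p' q h => by rw [hc.mono (Nat.le_add_right (n + 1) k) p p' h])
    (fun p q hp hq => ⟨hf n p hp, hq⟩)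
    (fun p q h => cellDiff_congr hc g (hc.mono (Nat.le_add_right (n + 1) k) p q h))
  -- Within the ancestor of `p` at level `n + 1 + k` the coarse difference is constant, so the
  -- bracket vanishes there.
  calc _ = _ := by
        congr 1
        refine Finset.sum_congr rfl fun p _ => Finset.sum_congr rfl fun q _ => ?_
        split_ifs with hq
        · rfl
        · rw [show G q = G p from cellDiff_congr hc g (not_not.mp hq), sub_self]
    _ ≤ _ := h
    _ = _ := by ring

/-- The Carleson condition for the paraproduct. -/
theorem IsUpperT1Form.carleson_condition (H : IsUpperT1Form w c b near good r K a C θ)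
    [∀ n, DecidablePred (good n)]
    (hw : ∀ p, 0 < w p) (hc : NestedCells c) (hC : 0 ≤ C) (hθ : 0 ≤ θ) (hθ1 : θ < 1)
    (hgood : ∀ n p q, c n p = c n q → good n p → good n q) (n : ℕ) (p₀ : P) :
    cellAvg w (c (n + r + 1)) (fun p => ∑ l ∈ Finset.range (n + 1), if good (l + 1) p then
      ‖cellDiff w c l (fun p => (w p : 𝕜)⁻¹ * ∑ q, b p q) p‖ ^ 2 else 0) p₀ ≤
      2 * a ^ 2 + 2 * C ^ 2 / (1 - θ) := by
  classical
  set J := n + r + 1 with hJ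
  set m := cellMass w (c J) p₀ with hm
  have hm0 : 0 < m := cellMass_pos hw p₀
  have hw' : ∀ p, (w p : 𝕜) ≠ 0 := fun p => RCLike.ofReal_ne_zero.mpr (hw p).ne'
  -- `β` is the density of the transpose applied to 1. It is split according to whether `q` lies
  -- inside or outside the cell of `p₀` at level `J`.
  set β : P → 𝕜 := fun p => (w p : 𝕜)⁻¹ * ∑ q, b p q
  set β₁ : P → 𝕜 := fun p => (w p : 𝕜)⁻¹ * ∑ q with c J q = c J p₀, b p q with hβ₁
  set β₂ : P → 𝕜 := fun p => (w p : 𝕜)⁻¹ * ∑ q with ¬c J q = c J p₀, b p q with hβ₂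
  have hβ : β = β₁ + β₂ := by
    ext p
    simp only [β, hβ₁, hβ₂, Pi.add_apply, ← mul_add]
    rw [Finset.sum_filter_add_sum_filter_not]
  -- Duality: the transposed testing condition is applied to the conjugate of `β₁` itself.
  have hinside : normSq w β₁ ≤ a ^ 2 * m := by
    have h := H.testing_swap J p₀ (fun p => (starRingEnd 𝕜) (β₁ p))
    have e : ∑ q with c J q = c J p₀, ∑ p, b p q * (starRingEnd 𝕜) (β₁ p) =
        ((normSq w β₁ : ℝ) : 𝕜) := by
      rw [Finset.sum_comm, normSq]
      push_cast
      refine Finset.sum_congr rfl fun p _ => ?_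
      rw [← Finset.sum_mul, ← RCLike.mul_conj, ← mul_assoc]
      congr 1
      rw [hβ₁, mul_inv_cancel_left₀ (hw' p)]
    have e2 : normSq w (fun p => (starRingEnd 𝕜) (β₁ p)) = normSq w β₁ := by simp [normSq]
    rw [e, e2, RCLike.norm_ofReal, abs_of_nonneg (normSq_nonneg hw _)] at h
    have h0 := normSq_nonneg hw β₁
    set x := √(normSq w β₁)
    have hx : x ^ 2 = normSq w β₁ := Real.sq_sqrt h0
    have hy : √m ^ 2 = m := Real.sq_sqrt hm0.le
    rcases (Real.sqrt_nonneg (normSq w β₁)).eq_or_lt with h1 | h1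
    · rw [← hx, show x = 0 from h1.symm, zero_pow two_ne_zero]
      positivity
    · have h2 : x ≤ a * √m := by
        refine le_of_mul_le_mul_right ?_ h1
        change x * x ≤ _
        rw [← sq, hx]
        linarith
      rw [← hx]
      calc x ^ 2 ≤ (a * √m) ^ 2 := by gcongr
        _ = a ^ 2 * m := by rw [mul_pow, hy]
  -- The good differences of the conjugate of `β₂` inside the cell are paired with the indicator of
  -- its complement. Good cells of level `l + 1` are far from that complement, and the level gap `k
  -- + r` produces the decay; the part θ ^ k kept here is enough for a geometric series in `l`.
  have houtside : ∀ l ≤ n, ∑ p with c J p = c J p₀, w p * (if good (l + 1) p then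
      ‖cellDiff w c l β₂ p‖ ^ 2 else 0) ≤ C ^ 2 * θ ^ (n - l) * m := by
    intro l hl
    obtain ⟨k, rfl⟩ := Nat.exists_eq_add_of_le hl
    have hJk : J = l + 1 + (k + r) := by omega
    have hlJ : l + 1 ≤ J := by omega
    set e : P → 𝕜 := fun p => if c J p = c J p₀ ∧ good (l + 1) p then 1 else 0 with he
    have hec : ∀ p q, c (l + 1) p = c (l + 1) q → e p = e q := by
      intro p q h
      have h1 : good (l + 1) p ↔ good (l + 1) q := ⟨hgood _ _ _ h, hgood _ _ _ h.symm⟩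
      simp only [he, hc.mono hlJ p q h, h1]
    set F : P → 𝕜 := fun p => e p * cellDiff w c l (fun p => (starRingEnd 𝕜) (β₂ p)) p with hF
    obtain ⟨hF1, hF2⟩ := cellDiff_mul_of_const hw hc l (fun p => (starRingEnd 𝕜) (β₂ p)) e hec
    have hconj : ∀ p, cellDiff w c l (fun p => (starRingEnd 𝕜) (β₂ p)) p =
        (starRingEnd 𝕜) (cellDiff w c l β₂ p) := by
      intro p
      simp [cellDiff_apply, cellAvg_apply]
    have hnorm : ∑ p with c J p = c J p₀, w p * (if good (l + 1) p then
        ‖cellDiff w c l β₂ p‖ ^ 2 else 0) = normSq w F := by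
      rw [normSq, Finset.sum_filter]
      refine Finset.sum_congr rfl fun p _ => ?_
      simp only [hF, hconj, he]
      by_cases h1 : c J p = c J p₀ <;> by_cases h2 : good (l + 1) p <;> simp [h1, h2]
    rw [hnorm]
    obtain ⟨u, hu, hrow, -, hdec⟩ := (H.good_far (l + 1) (k + r)
      (Nat.le_add_left r k)).exists_weight
    have h1 := hdec F (fun _ q => if c J q = c J p₀ then 0 else 1) hF2 hw (fun _ _ _ => rfl)
      (by
        intro p q hp hq
        have hp1 : c J p = c J p₀ ∧ good (l + 1) p := by
          by_contra hne
          simp [hF, he, hne] at hp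
        refine ⟨hp1.2, ?_⟩
        rw [← hJk, hp1.1]
        intro hne
        simp [hne] at hq)
    have h2 : ∑ p, ∑ q, b p q * F p * (if c J q = c J p₀ then (0 : 𝕜) else 1) =
        ((normSq w F : ℝ) : 𝕜) := by
      have h3 := sum_cellDiff_mul hw l β₂ F hF1 hF2
      have h4 : ∀ p, ∑ q, b p q * F p * (if c J q = c J p₀ then (0 : 𝕜) else 1) =
          (w p : 𝕜) * β₂ p * F p := by
        intro p
        rw [hβ₂, mul_inv_cancel_left₀ (hw' p), Finset.sum_filter, Finset.sum_mul]
        refine Finset.sum_congr rfl fun q _ => ?_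
        split_ifs <;> simp
      rw [Finset.sum_congr rfl fun p _ => h4 p, ← h3, normSq]
      push_cast
      refine Finset.sum_congr rfl fun p _ => ?_
      rw [← RCLike.mul_conj, mul_assoc]
      congr 1
      simp only [hF, hconj, he]
      split_ifs <;> simp [mul_comm]
    rw [h2, RCLike.norm_ofReal, abs_of_nonneg (normSq_nonneg hw _)] at h1
    have h5 : ∑ p, ∑ q, u p q * (‖F p‖ * ‖if c J q = c J p₀ then (0 : 𝕜) else 1‖) ≤
        C * θ ^ (k + r) * (√(normSq w F) * √m) := by
      calc _ ≤ ∑ p, ∑ q, u p q * ‖F p‖ := by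
            refine Finset.sum_le_sum fun p _ => Finset.sum_le_sum fun q _ => ?_
            refine mul_le_mul_of_nonneg_left ?_ (hu p q)
            split_ifs <;> simp
        _ ≤ ∑ p, C * θ ^ (k + r) * (w p * ‖F p‖) := by
            refine Finset.sum_le_sum fun p _ => ?_
            rw [← Finset.sum_mul, ← mul_assoc]
            exact mul_le_mul_of_nonneg_right (hrow p) (norm_nonneg _)
        _ ≤ _ := by
            rw [← Finset.mul_sum]
            refine mul_le_mul_of_nonneg_left ?_ (by positivity)
            have h6 := Finset.sum_le_sqrt_mul_sqrt Finset.univ (r := fun p => w p * ‖F p‖)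
              (f := fun p => w p * ‖F p‖ ^ 2) (g := fun p => if c J p = c J p₀ then w p else 0)
              (fun p _ => mul_nonneg (hw p).le (sq_nonneg _))
              (fun p _ => by split_ifs <;> simp [(hw p).le]) (fun p _ => by
                split_ifs with h
                · exact le_of_eq (by ring)
                · simp [hF, he, h])
            rwa [← Finset.sum_filter] at h6
    have h0 := normSq_nonneg hw F
    set x := √(normSq w F)
    have hx : x ^ 2 = normSq w F := Real.sq_sqrt h0
    have hy : √m ^ 2 = m := Real.sq_sqrt hm0.le
    have hxle : x ≤ C * θ ^ (k + r) * √m := by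
      rcases (Real.sqrt_nonneg (normSq w F)).eq_or_lt with h | h
      · rw [show x = 0 from h.symm]
        positivity
      · refine le_of_mul_le_mul_right ?_ h
        change x * x ≤ _
        rw [← sq, hx]
        refine (h1.trans h5).trans_eq ?_
        ring
    rw [← hx, Nat.add_sub_cancel_left]
    calc x ^ 2 ≤ (C * θ ^ (k + r) * √m) ^ 2 := by gcongr
      _ = C ^ 2 * θ ^ (2 * (k + r)) * m := by rw [mul_pow, hy]; ring
      _ ≤ C ^ 2 * θ ^ k * m := by
        have : θ ^ (2 * (k + r)) ≤ θ ^ k := pow_le_pow_of_le_one hθ hθ1.le (by omega)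
        gcongr
  have htotal : ∑ p with c J p = c J p₀, w p * ∑ l ∈ Finset.range (n + 1),
      (if good (l + 1) p then ‖cellDiff w c l β p‖ ^ 2 else 0) ≤
      (2 * a ^ 2 + 2 * C ^ 2 / (1 - θ)) * m := by
    have hle : ∀ l p, w p * (if good (l + 1) p then ‖cellDiff w c l β p‖ ^ 2 else 0) ≤
        2 * (w p * ‖cellDiff w c l β₁ p‖ ^ 2) +
        2 * (w p * (if good (l + 1) p then ‖cellDiff w c l β₂ p‖ ^ 2 else 0)) := by
      intro l p
      have hw0 := (hw p).le
      split_ifs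
      · rw [hβ, map_add, Pi.add_apply]
        have h1 : ‖cellDiff w c l β₁ p + cellDiff w c l β₂ p‖ ^ 2 ≤
            2 * ‖cellDiff w c l β₁ p‖ ^ 2 + 2 * ‖cellDiff w c l β₂ p‖ ^ 2 := by
          have h2 := norm_add_le (cellDiff w c l β₁ p) (cellDiff w c l β₂ p)
          nlinarith [norm_nonneg (cellDiff w c l β₁ p + cellDiff w c l β₂ p),
            sq_nonneg (‖cellDiff w c l β₁ p‖ - ‖cellDiff w c l β₂ p‖)]
        nlinarith
      · simp only [mul_zero, add_zero]
        positivity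
    have hgeom : ∑ l ∈ Finset.range (n + 1), θ ^ (n - l) ≤ 1 / (1 - θ) := by
      have e := Finset.sum_range_reflect (fun l => θ ^ l) (n + 1)
      simp only [Nat.add_sub_cancel] at e
      rw [e, geom_sum_eq hθ1.ne, ← neg_div_neg_eq, neg_sub, neg_sub]
      have : 0 < 1 - θ := by linarith
      gcongr
      linarith [pow_nonneg hθ (n + 1)]
    calc _ = ∑ l ∈ Finset.range (n + 1), ∑ p with c J p = c J p₀,
          w p * (if good (l + 1) p then ‖cellDiff w c l β p‖ ^ 2 else 0) := by
          rw [Finset.sum_comm]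
          simp only [Finset.mul_sum]
      _ ≤ ∑ l ∈ Finset.range (n + 1), (2 * normSq w (cellDiff w c l β₁) +
            2 * (C ^ 2 * θ ^ (n - l) * m)) := by
          refine Finset.sum_le_sum fun l hl => ?_
          refine (Finset.sum_le_sum fun p _ => hle l p).trans ?_
          rw [Finset.sum_add_distrib, ← Finset.mul_sum, ← Finset.mul_sum]
          refine add_le_add (mul_le_mul_of_nonneg_left ?_ zero_le_two)
            (mul_le_mul_of_nonneg_left (houtside l (by simpa [Nat.lt_succ_iff] using hl))
              zero_le_two)
          exact Finset.sum_le_sum_of_subset_of_nonneg (Finset.filter_subset _ _)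
            fun p _ _ => mul_nonneg (hw p).le (sq_nonneg _)
      _ = 2 * ∑ l ∈ Finset.range (n + 1), normSq w (cellDiff w c l β₁) +
            2 * C ^ 2 * m * ∑ l ∈ Finset.range (n + 1), θ ^ (n - l) := by
          rw [Finset.sum_add_distrib, Finset.mul_sum, Finset.mul_sum]
          congr 1
          exact Finset.sum_congr rfl fun l _ => by ring
      _ ≤ 2 * (a ^ 2 * m) + 2 * C ^ 2 * m * (1 / (1 - θ)) := by
          gcongr
          exact (sum_normSq_cellDiff_le hw hc (n + 1) β₁).trans hinside
      _ = _ := by ring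
  rw [cellAvg_apply]
  simp only [RCLike.ofReal_real_eq_id, id_eq]
  rw [inv_mul_le_iff₀ hm0, mul_comm m]
  exact htotal

end TreeTheorem

/-! ### The paraproduct, the tree T1 theorem and removal of bad differences. -/

section TreeTheorem

variable {P ι 𝕜 : Type*} [Fintype P] [DecidableEq ι] [RCLike 𝕜]
variable {w : P → ℝ} {c : ℕ → P → ι} {b : P → P → 𝕜}
variable {near : ι → ι → Prop} {good : ℕ → P → Prop} {r K : ℕ} {a C θ : ℝ}

/-- The bound for the paraproduct. -/
theorem IsUpperT1Form.norm_paraproduct_le (H : IsUpperT1Form w c b near good r K a C θ)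
    (hw : ∀ p, 0 < w p) (hc : NestedCells c) (hC : 0 < C) (hθ : 0 ≤ θ) (hθ1 : θ < 1)
    (hgood : ∀ n p q, c n p = c n q → good n p → good n q) {f : P → 𝕜}
    (hf : IsGoodFunction w c good f) (g : P → 𝕜) (N : ℕ) :
    ‖∑ n ∈ Finset.range N, ∑ p, cellDiff w c n f p * cellAvg w (c (n + r + 1)) g p *
      ∑ q, b p q‖ ≤ √(4 * (2 * a ^ 2 + 2 * C ^ 2 / (1 - θ))) *
        (√(normSq w f) * √(normSq w g)) := by
  classical
  have hθ' : 0 < 1 - θ := by linarith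
  have hw' : ∀ p, (w p : 𝕜) ≠ 0 := fun p => RCLike.ofReal_ne_zero.mpr (hw p).ne'
  set β : P → 𝕜 := fun p => (w p : 𝕜)⁻¹ * ∑ q, b p q with hβ
  set α : ℕ → P → ℝ := fun l p => if good (l + 1) p then ‖cellDiff w c l β p‖ ^ 2 else 0 with hα
  have hα0 : ∀ n p, 0 ≤ α n p := fun n p => by
    simp only [hα]
    split_ifs <;> positivity
  -- A difference of level `n` meets the average of `g` at level `n + r + 1`, so the embedding is
  -- used for the filtration that starts `r + 1` levels higher.
  have hcar := carleson_embedding (c := fun n => c (n + r + 1)) hw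
    (fun n p q h => by
      have := hc (n + r + 1) p q h
      simpa only [show n + 1 + r + 1 = n + r + 1 + 1 by ring] using this)
    (C := 2 * a ^ 2 + 2 * C ^ 2 / (1 - θ)) (by positivity) α hα0
    (fun n p => H.carleson_condition hw hc hC.le hθ hθ1 hgood n p) g N
  have hterm : ∀ n, ‖∑ p, cellDiff w c n f p * cellAvg w (c (n + r + 1)) g p * ∑ q, b p q‖ ≤
      √(normSq w (cellDiff w c n f)) *
        √(∑ p, w p * (α n p * ‖cellAvg w (c (n + r + 1)) g p‖ ^ 2)) := by
    intro n
    have hconst : ∀ p q, c (n + 1) p = c (n + 1) q →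
        cellAvg w (c (n + r + 1)) g p = cellAvg w (c (n + r + 1)) g q := fun p q h =>
      cellAvg_congr g (hc.mono (by omega) p q h)
    obtain ⟨h1, h2⟩ := cellDiff_mul_of_const hw hc n f _ hconst
    have h3 := sum_cellDiff_mul hw n β _ h1 h2
    -- The average of `g` times the difference of `f` is again in the range of the difference
    -- operator, so `β` may be replaced by its own difference of level `n`, and only its good cells
    -- matter.
    have e : ∑ p, cellDiff w c n f p * cellAvg w (c (n + r + 1)) g p * ∑ q, b p q =
        ∑ p, (w p : 𝕜) * cellDiff w c n β p *
          (cellAvg w (c (n + r + 1)) g p * cellDiff w c n f p) := by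
      rw [h3]
      refine Finset.sum_congr rfl fun p _ => ?_
      rw [hβ, mul_inv_cancel_left₀ (hw' p)]
      ring
    rw [e]
    refine (norm_sum_le _ _).trans ?_
    refine Finset.sum_le_sqrt_mul_sqrt _ (fun p _ => mul_nonneg (hw p).le (sq_nonneg _))
      (fun p _ => mul_nonneg (hw p).le (mul_nonneg (hα0 n p) (sq_nonneg _))) fun p _ => ?_
    by_cases h0 : cellDiff w c n f p = 0
    · simp [h0]
    · simp only [hα, if_pos (hf n p h0), norm_mul, RCLike.norm_ofReal, abs_of_pos (hw p)]
      exact le_of_eq (by ring)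
  refine (norm_sum_le_of_le _ fun n _ => hterm n).trans ?_
  refine (Real.sum_sqrt_mul_sqrt_le _ (fun n => normSq_nonneg hw _) (fun n =>
    Finset.sum_nonneg fun p _ => mul_nonneg (hw p).le
      (mul_nonneg (hα0 n p) (sq_nonneg _)))).trans ?_
  calc _ ≤ √(normSq w f) * √(4 * (2 * a ^ 2 + 2 * C ^ 2 / (1 - θ)) * normSq w g) := by
        gcongr
        exact sum_normSq_cellDiff_le hw hc N f
    _ = _ := by
        rw [Real.sqrt_mul (by positivity)]
        ring

/-- The bound in the upper triangular half of the `T1` theorem on a finite tree. -/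
noncomputable def upperConst (r K : ℕ) (a C θ : ℝ) : ℝ :=
  (r + 1) * (a * K + C) + 2 * C / (1 - θ) + √(4 * (2 * a ^ 2 + 2 * C ^ 2 / (1 - θ)))

/-- The average of `g` at level `n` is expanded upwards. Its first `r + 1` differences are at
comparable levels. In the remaining average the value at `p` is subtracted: the differences of what
is left decay like θ ^ j, and the subtracted values are exactly the averages at level `n + r + 1` in
the paraproduct. -/
theorem IsUpperT1Form.norm_sum_bilin_le [DecidableRel near]
    (H : IsUpperT1Form w c b near good r K a C θ)
    (hw : ∀ p, 0 < w p) (hc : NestedCells c) (ha : 0 ≤ a) (hC : 0 < C) (hθ : 0 ≤ θ) (hθ1 : θ < 1)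
    (hgood : ∀ n p q, c n p = c n q → good n p → good n q)
    (hsymm : ∀ v v', near v v' → near v' v) (hcard : NearCard c near K) {N : ℕ}
    (htop : ∀ n, N ≤ n → ∀ p q, c n p = c n q) {f : P → 𝕜}
    (hf : IsGoodFunction w c good f) (g : P → 𝕜) :
    ‖∑ n ∈ Finset.range N, bilin b (cellDiff w c n f) (cellAvg w (c n) g)‖ ≤
      upperConst r K a C θ * (√(normSq w f) * √(normSq w g)) := by
  have hθ' : 0 < 1 - θ := by linarith
  have split : ∀ n, bilin b (cellDiff w c n f) (cellAvg w (c n) g) =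
      ∑ k ∈ Finset.range (r + 1), bilin b (cellDiff w c n f) (cellDiff w c (k + n) g) +
      (∑ j ∈ Finset.range N, ∑ p, ∑ q, b p q * cellDiff w c n f p *
        (cellDiff w c (n + 1 + (r + j)) g q - cellDiff w c (n + 1 + (r + j)) g p) +
      ∑ p, cellDiff w c n f p * cellAvg w (c (n + r + 1)) g p * ∑ q, b p q) := by
    intro n
    rw [cellAvg_eq_sum_cellDiff n (r + 1) g, bilin_add_right, bilin_sum_right]
    simp only [add_comm n _]
    congr 1
    have h1 : ∀ p q, cellAvg w (c (r + 1 + n)) g q - cellAvg w (c (r + 1 + n)) g p =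
        ∑ j ∈ Finset.range N,
          (cellDiff w c (r + 1 + n + j) g q - cellDiff w c (r + 1 + n + j) g p) := by
      intro p q
      rw [cellAvg_eq_sum_cellDiff (r + 1 + n) N g, Finset.sum_sub_distrib]
      simp only [Pi.add_apply, Finset.sum_apply]
      -- There is only one cell from level `N` on, so the last average cancels.
      rw [cellAvg_congr g (htop (r + 1 + n + N) (by omega) p q)]
      ring
    have h2 : ∑ j ∈ Finset.range N, ∑ p, ∑ q, b p q * cellDiff w c n f p *
        (cellDiff w c (1 + n + (r + j)) g q - cellDiff w c (1 + n + (r + j)) g p) =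
        ∑ p, ∑ q, b p q * cellDiff w c n f p *
          (cellAvg w (c (r + 1 + n)) g q - cellAvg w (c (r + 1 + n)) g p) := by
      rw [Finset.sum_comm]
      refine Finset.sum_congr rfl fun p _ => ?_
      rw [Finset.sum_comm]
      refine Finset.sum_congr rfl fun q _ => ?_
      rw [h1, Finset.mul_sum]
      refine Finset.sum_congr rfl fun j _ => ?_
      rw [show 1 + n + (r + j) = r + 1 + n + j by ring]
    rw [h2, bilin, ← Finset.sum_add_distrib]
    refine Finset.sum_congr rfl fun p _ => ?_
    rw [Finset.mul_sum, ← Finset.sum_add_distrib]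
    refine Finset.sum_congr rfl fun q _ => ?_
    rw [show r + n + 1 = r + 1 + n by ring]
    ring
  rw [Finset.sum_congr rfl fun n _ => split n, Finset.sum_add_distrib, Finset.sum_add_distrib]
  set Z := √(normSq w f) * √(normSq w g)
  have hZ : 0 ≤ Z := by positivity
  have h1 : ‖∑ n ∈ Finset.range N, ∑ k ∈ Finset.range (r + 1),
      bilin b (cellDiff w c n f) (cellDiff w c (k + n) g)‖ ≤ (r + 1) * (a * K + C) * Z := by
    rw [Finset.sum_comm]
    calc _ ≤ ∑ k ∈ Finset.range (r + 1), (a * K + C) * Z := by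
          refine norm_sum_le_of_le _ fun k _ => ?_
          refine (norm_sum_le_of_le _ fun n _ =>
            H.norm_bilin_cellDiff_le hw hc ha hC.le hsymm hcard f g n k).trans ?_
          rw [← Finset.mul_sum]
          exact mul_le_mul_of_nonneg_left (sum_sqrt_normSq_cellDiff_le hw hc f g N k)
            (by positivity)
      _ = _ := by simp; ring
  have h2 : ‖∑ n ∈ Finset.range N, ∑ j ∈ Finset.range N, ∑ p, ∑ q, b p q * cellDiff w c n f p *
        (cellDiff w c (n + 1 + (r + j)) g q - cellDiff w c (n + 1 + (r + j)) g p)‖ ≤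
      2 * C / (1 - θ) * Z := by
    rw [Finset.sum_comm]
    calc _ ≤ ∑ j ∈ Finset.range N, 2 * C * θ ^ j * Z := by
          refine norm_sum_le_of_le _ fun j _ => ?_
          refine (norm_sum_le_of_le _ fun n _ =>
            H.norm_sum_sub_le hw hc hC.le hθ hf g n (r + j) (Nat.le_add_right r j)).trans ?_
          rw [← Finset.mul_sum]
          have h3 : 2 * C * θ ^ (r + j) ≤ 2 * C * θ ^ j := by
            have := pow_le_pow_of_le_one hθ hθ1.le (Nat.le_add_left j r)
            gcongr
          have h4 := sum_sqrt_normSq_cellDiff_le hw hc f g N (1 + (r + j))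
          refine mul_le_mul h3 (le_trans (le_of_eq ?_) h4) (Finset.sum_nonneg fun n _ => by
            positivity) (by positivity)
          refine Finset.sum_congr rfl fun n _ => ?_
          rw [show n + 1 + (r + j) = 1 + (r + j) + n by ring]
      _ = 2 * C * Z * ∑ j ∈ Finset.range N, θ ^ j := by
          rw [Finset.mul_sum]
          exact Finset.sum_congr rfl fun j _ => by ring
      _ ≤ 2 * C * Z * (1 / (1 - θ)) := by
          refine mul_le_mul_of_nonneg_left ?_ (by positivity)
          rw [geom_sum_eq hθ1.ne, ← neg_div_neg_eq, neg_sub, neg_sub]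
          gcongr
          linarith [pow_nonneg hθ N]
      _ = _ := by ring
  have h3 := H.norm_paraproduct_le hw hc hC hθ hθ1 hgood hf g N
  refine (norm_add_le _ _).trans ((add_le_add h1 ((norm_add_le _ _).trans
    (add_le_add h2 h3))).trans_eq ?_)
  rw [upperConst]
  ring

/-- The `T1` theorem on a finite tree, for good functions. -/
theorem norm_bilin_le_of_isUpperT1Form [DecidableRel near]
    (H : IsUpperT1Form w c b near good r K a C θ)
    (H' : IsUpperT1Form w c (fun p q => b q p) near good r K a C θ)
    (hw : ∀ p, 0 < w p) (hc : NestedCells c) (hinj : Function.Injective (c 0))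
    (ha : 0 ≤ a) (hC : 0 < C) (hθ : 0 ≤ θ) (hθ1 : θ < 1)
    (hgood : ∀ n p q, c n p = c n q → good n p → good n q)
    (hsymm : ∀ v v', near v v' → near v' v) (hcard : NearCard c near K) {N : ℕ}
    (htop : ∀ n, N ≤ n → ∀ p q, c n p = c n q) {f g : P → 𝕜}
    (hf : IsGoodFunction w c good f) (hg : IsGoodFunction w c good g) :
    ‖bilin b f g‖ ≤ (a + 2 * upperConst r K a C θ + (a * K + C)) *
      (√(normSq w f) * √(normSq w g)) := by
  have telescope : ∀ M, bilin b (cellAvg w (c 0) f) (cellAvg w (c 0) g) =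
      bilin b (cellAvg w (c M) f) (cellAvg w (c M) g) +
      ∑ n ∈ Finset.range M, (bilin b (cellDiff w c n f) (cellAvg w (c n) g) +
        bilin b (cellAvg w (c (n + 1)) f) (cellDiff w c n g)) := by
    intro M
    induction M with
    | zero => simp
    | succ M ih =>
      rw [ih, Finset.sum_range_succ]
      have e1 : ∀ h : P → 𝕜, cellAvg w (c M) h = cellDiff w c M h + cellAvg w (c (M + 1)) h :=
        fun h => by rw [cellDiff_apply, sub_add_cancel]
      have e2 : bilin b (cellAvg w (c M) f) (cellAvg w (c M) g) =
          bilin b (cellDiff w c M f) (cellAvg w (c M) g) +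
          (bilin b (cellAvg w (c (M + 1)) f) (cellDiff w c M g) +
            bilin b (cellAvg w (c (M + 1)) f) (cellAvg w (c (M + 1)) g)) := by
        rw [← bilin_add_right, ← e1, ← bilin_add_left, ← e1]
      rw [e2]
      ring
  have h0 : ∀ h : P → 𝕜, cellAvg w (c 0) h = h := fun h =>
    cellAvg_const hw h fun p q hpq => by rw [hinj hpq]
  have e := telescope N
  rw [h0, h0] at e
  -- The other half of the double sum is the upper half for the transposed form, except that the
  -- average of `f` starts one level higher; the correction is an interaction at equal levels.
  have e3 : ∀ n, bilin b (cellAvg w (c (n + 1)) f) (cellDiff w c n g) =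
      bilin (fun p q => b q p) (cellDiff w c n g) (cellAvg w (c n) f) -
        bilin (fun p q => b q p) (cellDiff w c n g) (cellDiff w c (0 + n) f) := by
    intro n
    rw [eq_sub_iff_add_eq, ← bilin_swap, ← bilin_add_right, zero_add, cellDiff_apply n f,
      add_sub_cancel]
  rw [e, Finset.sum_add_distrib, Finset.sum_congr rfl fun n _ => e3 n, Finset.sum_sub_distrib]
  have h1 : ‖bilin b (cellAvg w (c N) f) (cellAvg w (c N) g)‖ ≤
      a * (√(normSq w f) * √(normSq w g)) := by
    have hone : ((Finset.univ : Finset P).image (c N)).card ≤ 1 := by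
      rw [Finset.card_le_one]
      intro v hv v' hv'
      obtain ⟨p, -, rfl⟩ := Finset.mem_image.mp hv
      obtain ⟨q, -, rfl⟩ := Finset.mem_image.mp hv'
      exact htop N le_rfl p q
    have h := (H.testing N).norm_near_le hw ha (K := 1) (fun _ _ => True) (fun _ _ _ _ _ _ h => h)
      (fun p => by simpa using hone) (fun q => by simpa using hone)
      (cellAvg w (c N) f) (cellAvg w (c N) g)
      (fun p q h => cellAvg_congr f h) (fun p q h => cellAvg_congr g h)
    simp only [if_true, Nat.cast_one, mul_one] at h
    refine h.trans ?_
    gcongr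
    · exact normSq_cellAvg_le hw _ f
    · exact normSq_cellAvg_le hw _ g
  have h2 := H.norm_sum_bilin_le hw hc ha hC hθ hθ1 hgood hsymm hcard htop hf g
  have h3 := H'.norm_sum_bilin_le hw hc ha hC hθ hθ1 hgood hsymm hcard htop hg f
  have h4 : ‖∑ n ∈ Finset.range N,
      bilin (fun p q => b q p) (cellDiff w c n g) (cellDiff w c (0 + n) f)‖ ≤
      (a * K + C) * (√(normSq w g) * √(normSq w f)) := by
    refine (norm_sum_le_of_le _ fun n _ =>
      H'.norm_bilin_cellDiff_le hw hc ha hC.le hsymm hcard g f n 0).trans ?_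
    rw [← Finset.mul_sum]
    exact mul_le_mul_of_nonneg_left (sum_sqrt_normSq_cellDiff_le hw hc g f N 0) (by positivity)
  refine (norm_add_le _ _).trans ((add_le_add h1 ((norm_add_le _ _).trans
    (add_le_add h2 ((norm_sub_le _ _).trans (add_le_add h3 h4))))).trans_eq ?_)
  ring

/-- The martingale transform of `f` with multipliers `e n`. -/
noncomputable def martTransform (w : P → ℝ) (c : ℕ → P → ι) (e : ℕ → P → 𝕜) (N : ℕ)
    (f : P → 𝕜) : P → 𝕜 :=
  ∑ n ∈ Finset.range N, fun p => e n p * cellDiff w c n f p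

theorem cellAvg_martTransform (hw : ∀ p, 0 < w p) (hc : NestedCells c) {e : ℕ → P → 𝕜}
    (he : ∀ n p q, c (n + 1) p = c (n + 1) q → e n p = e n q) (N m : ℕ) (f : P → 𝕜) :
    cellAvg w (c m) (martTransform w c e N f) =
      ∑ n ∈ Finset.range N, if m ≤ n then (fun p => e n p * cellDiff w c n f p) else 0 := by
  rw [martTransform, map_sum]
  refine Finset.sum_congr rfl fun n _ => ?_
  obtain ⟨h1, h2⟩ := cellDiff_mul_of_const hw hc n f (e n) (he n)
  split_ifs with h
  · exact cellAvg_const hw _ fun p q hpq => h1 p q (hc.mono h p q hpq)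
  · rw [← cellAvg_cellAvg_of_le hw (hc.mono (show n + 1 ≤ m by omega)), h2, map_zero]

theorem cellDiff_martTransform (hw : ∀ p, 0 < w p) (hc : NestedCells c) {e : ℕ → P → 𝕜}
    (he : ∀ n p q, c (n + 1) p = c (n + 1) q → e n p = e n q) {N m : ℕ} (hm : m < N)
    (f : P → 𝕜) :
    cellDiff w c m (martTransform w c e N f) = fun p => e m p * cellDiff w c m f p := by
  rw [cellDiff_apply, cellAvg_martTransform hw hc he, cellAvg_martTransform hw hc he,
    ← Finset.sum_sub_distrib, Finset.sum_eq_single_of_mem m (Finset.mem_range.mpr hm)]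
  · simp
  · intro n _ hn
    by_cases h : m ≤ n
    · rw [if_pos h, if_pos (by omega), sub_self]
    · rw [if_neg h, if_neg (by omega), sub_self]

theorem normSq_martTransform (hw : ∀ p, 0 < w p) (hc : NestedCells c)
    (hinj : Function.Injective (c 0)) {e : ℕ → P → 𝕜}
    (he : ∀ n p q, c (n + 1) p = c (n + 1) q → e n p = e n q) (N : ℕ) (f : P → 𝕜) :
    normSq w (martTransform w c e N f) =
      ∑ n ∈ Finset.range N, ∑ p, w p * (‖e n p‖ ^ 2 * ‖cellDiff w c n f p‖ ^ 2) := by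
  have h0 : cellAvg w (c 0) (martTransform w c e N f) = martTransform w c e N f :=
    cellAvg_const hw _ fun p q hpq => by rw [hinj hpq]
  have h1 : cellAvg w (c N) (martTransform w c e N f) = 0 := by
    rw [cellAvg_martTransform hw hc he]
    exact Finset.sum_eq_zero fun n hn => if_neg (by simpa using hn)
  have h := normSq_eq_sum_cellDiff hw hc N (martTransform w c e N f)
  rw [h0, h1] at h
  rw [h, show normSq w (0 : P → 𝕜) = 0 by simp [normSq], add_zero]
  refine Finset.sum_congr rfl fun n hn => ?_
  rw [cellDiff_martTransform hw hc he (Finset.mem_range.mp hn), normSq]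
  simp only [norm_mul, mul_pow]

open Classical in
/-- Removal of the martingale differences on the cells that are not good. -/
theorem isGoodFunction_sub_martTransform (hw : ∀ p, 0 < w p) (hc : NestedCells c)
    (hgood : ∀ n p q, c n p = c n q → good n p → good n q) {N : ℕ}
    (htop : ∀ n, N ≤ n → ∀ p q, c n p = c n q) (f : P → 𝕜) :
    IsGoodFunction w c good
      (f - martTransform w c (fun n p => if good (n + 1) p then 0 else 1) N f) := by
  intro n p hp
  have he : ∀ n p q, c (n + 1) p = c (n + 1) q → (if good (n + 1) p then (0 : 𝕜) else 1) =
      if good (n + 1) q then 0 else 1 := by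
    intro n p q h
    have h1 : good (n + 1) p ↔ good (n + 1) q := ⟨hgood _ _ _ h, hgood _ _ _ h.symm⟩
    simp only [h1]
  rcases lt_or_ge n N with hn | hn
  · rw [map_sub, cellDiff_martTransform hw hc he hn] at hp
    by_contra hne
    simp [hne] at hp
  · exfalso
    refine hp ?_
    rw [cellDiff_apply, Pi.sub_apply, cellAvg_apply, cellAvg_apply, cellMass, cellMass]
    simp [htop n hn _ p, htop (n + 1) (by omega) _ p]

end TreeTheorem

/-! ### Random shifts of the dyadic grid on a discrete torus. -/

section RandomShift

variable {P 𝕜 : Type*} [Fintype P] [RCLike 𝕜] {d : ℕ}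

/-- The index of the dyadic cell of level `n` of the point `p` in the grid shifted by `a`. -/
def cellIdx (pos : P → Fin d → ℕ) (a : Fin d → ℕ) (n : ℕ) (p : P) : Fin d → ℕ :=
  fun k => (pos p k + a k) / 2 ^ n

/-- The cell of level `n` of `p` is far from the boundaries of all cells of much larger level
that contain it. -/
def IsGoodCell (r M : ℕ) (pos : P → Fin d → ℕ) (a : Fin d → ℕ) (n : ℕ) (p : P) : Prop :=
  ∀ j, r ≤ j → n + j ≤ M → ∀ k, 2 ^ (j / 2) ≤ cellIdx pos a n p k % 2 ^ j ∧
    cellIdx pos a n p k % 2 ^ j + 2 ^ (j / 2) < 2 ^ j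

/-- Two cell indices differ by at most `κ` in every coordinate. -/
def NearIdx (κ : ℕ) (v v' : Fin d → ℕ) : Prop := ∀ k, v k ≤ v' k + κ ∧ v' k ≤ v k + κ

instance (κ : ℕ) : DecidableRel (NearIdx (d := d) κ) := fun v v' =>
  inferInstanceAs (Decidable (∀ k, v k ≤ v' k + κ ∧ v' k ≤ v k + κ))

theorem NearIdx.symm {κ : ℕ} {v v' : Fin d → ℕ} (h : NearIdx κ v v') : NearIdx κ v' v :=
  fun k => ⟨(h k).2, (h k).1⟩

theorem nestedCells_cellIdx {P : Type*} (pos : P → Fin d → ℕ) (a : Fin d → ℕ) :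
    NestedCells (cellIdx pos a) := by
  intro n p q h
  ext k
  have := congrFun h k
  simp only [cellIdx] at this ⊢
  rw [pow_succ, ← Nat.div_div_eq_div_mul, this, Nat.div_div_eq_div_mul]

theorem cellIdx_zero_injective {P : Type*} {pos : P → Fin d → ℕ} (hpos : Function.Injective pos)
    (a : Fin d → ℕ) : Function.Injective (cellIdx pos a 0) := by
  intro p q h
  apply hpos
  ext k
  simpa [cellIdx] using congrFun h k

theorem cellIdx_top {P : Type*} {pos : P → Fin d → ℕ} {a : Fin d → ℕ} {M : ℕ}
    (hpos : ∀ p k, pos p k < 2 ^ M) (ha : ∀ k, a k < 2 ^ M) {n : ℕ} (hn : M + 1 ≤ n) (p : P) :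
    cellIdx pos a n p = 0 := by
  ext k
  refine Nat.div_eq_of_lt ?_
  calc pos p k + a k < 2 ^ M + 2 ^ M := add_lt_add (hpos p k) (ha k)
    _ = 2 ^ (M + 1) := by ring
    _ ≤ 2 ^ n := Nat.pow_le_pow_right two_pos hn

theorem isGoodCell_congr {P : Type*} {r M : ℕ} {pos : P → Fin d → ℕ} {a : Fin d → ℕ} (n : ℕ)
    (p q : P) (h : cellIdx pos a n p = cellIdx pos a n q) (hp : IsGoodCell r M pos a n p) :
    IsGoodCell r M pos a n q := by
  intro j hj hjM k
  rw [← h]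
  exact hp j hj hjM k

/-- In each coordinate the parents range over an interval of 2κ + 1 indices, and their children over
twice as many. -/
theorem nearCard_cellIdx (pos : P → Fin d → ℕ) (a : Fin d → ℕ) (κ : ℕ) :
    NearCard (cellIdx pos a) (NearIdx κ) ((4 * κ + 2) ^ d) := by
  intro n p
  set V := cellIdx pos a (n + 1) p with hV
  have hsub : (Finset.univ.filter fun q => NearIdx κ V (cellIdx pos a (n + 1) q)).image
      (cellIdx pos a n) ⊆
      Fintype.piFinset fun k => Finset.Icc (2 * V k - 2 * κ) (2 * V k + 2 * κ + 1) := by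
    intro v hv
    obtain ⟨q, hq, rfl⟩ := Finset.mem_image.mp hv
    rw [Fintype.mem_piFinset]
    intro k
    have h1 := (Finset.mem_filter.mp hq).2 k
    have h2 : cellIdx pos a (n + 1) q k = cellIdx pos a n q k / 2 := by
      simp only [cellIdx]
      rw [pow_succ, ← Nat.div_div_eq_div_mul]
    rw [h2] at h1
    rw [Finset.mem_Icc]
    omega
  refine (Finset.card_le_card hsub).trans ?_
  rw [Fintype.card_piFinset]
  refine (Finset.prod_le_pow_card _ _ (4 * κ + 2) fun k _ => ?_).trans (by simp)
  rw [Nat.card_Icc]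
  omega

/-- Needed because a shift of the grid relabels cells, while an average depends only on the set of
points in its cell. -/
theorem cellAvg_congr_cells {ι ι' : Type*} [DecidableEq ι] [DecidableEq ι'] {w : P → ℝ}
    {c : P → ι} {c' : P → ι'} (f : P → 𝕜) (p : P) (h : ∀ q, c q = c p ↔ c' q = c' p) :
    cellAvg w c f p = cellAvg w c' f p := by
  simp only [cellAvg_apply, cellMass, h]

theorem add_div_two_pow_of_eq {x A A' E V n : ℕ} (h : A' + E * 2 ^ n = A + V * 2 ^ n) :
    (x + A') / 2 ^ n + E = (x + A) / 2 ^ n + V := by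
  rw [← Nat.add_mul_div_right _ _ (by positivity), ← Nat.add_mul_div_right _ _ (by positivity),
    add_assoc, add_assoc, h]

/-- The wrap-around of the torus is a multiple of 2 ^ M, hence of every cell size up to level `M`,
and so does not disturb the grid at these levels. -/
theorem ZMod.exists_val_add_two_pow {M : ℕ} (a : ZMod (2 ^ M)) (x : ℕ) :
    ∃ E : ℕ, (a + (x : ZMod (2 ^ M))).val + E * 2 ^ M = a.val + x := by
  refine ⟨(a.val + x) / 2 ^ M, ?_⟩
  have h : (a + (x : ZMod (2 ^ M))).val = (a.val + x) % 2 ^ M := by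
    rw [ZMod.val_add, ZMod.val_natCast, Nat.add_mod_mod]
  rw [h, Nat.mod_add_div']

theorem card_filter_add_mod_le (m x : ℕ) (Z : Finset ℕ) :
    ((Finset.range m).filter fun v => (x + v) % m ∈ Z).card ≤ Z.card := by
  refine Finset.card_le_card_of_injOn (fun v => (x + v) % m) (fun v hv => by
    simpa using (Finset.mem_filter.mp hv).2) ?_
  intro v hv v' hv' h
  have hv1 := Finset.mem_range.mp (Finset.mem_filter.mp hv).1
  have hv1' := Finset.mem_range.mp (Finset.mem_filter.mp hv').1
  have h2 : v ≡ v' [MOD m] := Nat.ModEq.add_left_cancel' x h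
  exact Nat.ModEq.eq_of_lt_of_lt h2 hv1 hv1'

variable {M : ℕ}

/-- The natural number representatives of a shift in the discrete torus. -/
def shiftVal (a : Fin d → ZMod (2 ^ M)) : Fin d → ℕ := fun k => (a k).val

/-- Averaging over shifts: the position of a cell of level `n` inside the cell of level `n + j`
is equidistributed and independent of functions that are invariant under shifts by `2 ^ n`. -/
theorem sum_shift_le {P : Type*} (pos : P → Fin d → ℕ) {n j : ℕ} (hnj : n + j ≤ M)
    (k : Fin d) (p : P)
    (Z : Finset ℕ) (F : (Fin d → ZMod (2 ^ M)) → ℝ) (hF : ∀ a, 0 ≤ F a)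
    (hinv : ∀ a (v : ℕ), F (a + Pi.single k ((2 ^ n * v : ℕ) : ZMod (2 ^ M))) = F a) :
    2 ^ j * ∑ a, (if cellIdx pos (shiftVal a) n p k % 2 ^ j ∈ Z then F a else 0) ≤
      Z.card * ∑ a, F a := by
  -- Translating the shift by 2 ^ n * v moves the position inside the cell of level `n + j` by `v`
  -- modulo 2 ^ j and leaves `F` unchanged. As `v` runs over all residues, each position is hit
  -- once.
  have hshift : ∀ v : ℕ, ∑ a : Fin d → ZMod (2 ^ M),
      (if cellIdx pos (shiftVal a) n p k % 2 ^ j ∈ Z then F a else 0) =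
      ∑ a : Fin d → ZMod (2 ^ M),
        (if (cellIdx pos (shiftVal a) n p k + v) % 2 ^ j ∈ Z then F a else 0) := by
    intro v
    rw [← Equiv.sum_comp (Equiv.addRight (Pi.single k ((2 ^ n * v : ℕ) : ZMod (2 ^ M))))]
    refine Finset.sum_congr rfl fun a _ => ?_
    rw [Equiv.coe_addRight, hinv]
    have h : cellIdx pos (shiftVal (a + Pi.single k ((2 ^ n * v : ℕ) : ZMod (2 ^ M)))) n p k
        % 2 ^ j = (cellIdx pos (shiftVal a) n p k + v) % 2 ^ j := by
      obtain ⟨E, hE⟩ := ZMod.exists_val_add_two_pow (a k) (2 ^ n * v)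
      obtain ⟨e, rfl⟩ := Nat.exists_eq_add_of_le hnj
      have h1 := add_div_two_pow_of_eq (x := pos p k) (n := n)
        (A' := (a k + ((2 ^ n * v : ℕ) : ZMod (2 ^ (n + j + e)))).val) (A := (a k).val)
        (E := E * 2 ^ e * 2 ^ j) (V := v) (by rw [mul_comm v, ← hE]; ring)
      simp only [cellIdx, shiftVal, Pi.add_apply, Pi.single_eq_same]
      rw [← h1, Nat.add_mul_mod_self_right]
    rw [h]
  have h2 : ∑ v ∈ Finset.range (2 ^ j), ∑ a : Fin d → ZMod (2 ^ M),
      (if cellIdx pos (shiftVal a) n p k % 2 ^ j ∈ Z then F a else 0) =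
      ∑ a : Fin d → ZMod (2 ^ M), ((Finset.range (2 ^ j)).filter fun v =>
        (cellIdx pos (shiftVal a) n p k + v) % 2 ^ j ∈ Z).card * F a := by
    rw [Finset.sum_congr rfl fun v _ => hshift v, Finset.sum_comm]
    refine Finset.sum_congr rfl fun a _ => ?_
    rw [← Finset.sum_filter, Finset.sum_const, nsmul_eq_mul]
  rw [Finset.sum_const, Finset.card_range, nsmul_eq_mul] at h2
  push_cast at h2
  rw [h2, Finset.mul_sum]
  refine Finset.sum_le_sum fun a _ => mul_le_mul_of_nonneg_right ?_ (hF a)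
  exact_mod_cast card_filter_add_mod_le _ _ Z

/-- A shift by a multiple of 2 ^ n moves the grids of level at most `n` by whole cells: labels
change, the partition of the points does not. -/
theorem cellIdx_shift_eq_iff {P : Type*} (pos : P → Fin d → ℕ) {n n' : ℕ}
    (hn : n' ≤ n) (hnM : n ≤ M)
    (k : Fin d) (a : Fin d → ZMod (2 ^ M)) (v : ℕ) (p q : P) :
    cellIdx pos (shiftVal (a + Pi.single k ((2 ^ n * v : ℕ) : ZMod (2 ^ M)))) n' q =
      cellIdx pos (shiftVal (a + Pi.single k ((2 ^ n * v : ℕ) : ZMod (2 ^ M)))) n' p ↔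
    cellIdx pos (shiftVal a) n' q = cellIdx pos (shiftVal a) n' p := by
  rw [funext_iff, funext_iff]
  refine forall_congr' fun i => ?_
  by_cases hi : i = k
  · subst hi
    obtain ⟨E, hE⟩ := ZMod.exists_val_add_two_pow (a i) (2 ^ n * v)
    obtain ⟨s, rfl⟩ := Nat.exists_eq_add_of_le hn
    obtain ⟨e, rfl⟩ := Nat.exists_eq_add_of_le hnM
    have h1 : ∀ x : ℕ, _ := fun x => add_div_two_pow_of_eq (x := x) (n := n')
      (A' := (a i + ((2 ^ (n' + s) * v : ℕ) : ZMod (2 ^ (n' + s + e)))).val) (A := (a i).val)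
      (E := E * 2 ^ (s + e)) (V := v * 2 ^ s) (by
        rw [show v * 2 ^ s * 2 ^ n' = 2 ^ (n' + s) * v by ring, ← hE]; ring)
    have hp := h1 (pos p i)
    have hq := h1 (pos q i)
    simp only [cellIdx, shiftVal, Pi.add_apply, Pi.single_eq_same]
    omega
  · simp [cellIdx, shiftVal, hi]

/-- The proportion of shifts for which a given cell is bad. -/
noncomputable def badProb (d r M : ℕ) : ℝ :=
  ∑ j ∈ Finset.Ico r (M + 1), d * (2 * 2 ^ (j / 2) / 2 ^ j)

-- Union bound over the scales `j` and the coordinates: at most 2 * 2 ^ (j / 2) of the 2 ^ j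
-- positions are forbidden. The invariance of `F` plays the role of independence.
open Classical in
theorem sum_bad_le {P : Type*} (pos : P → Fin d → ℕ) (r n : ℕ) (p : P)
    (F : (Fin d → ZMod (2 ^ M)) → ℝ) (hF : ∀ a, 0 ≤ F a)
    (hinv : n ≤ M → ∀ k a (v : ℕ), F (a + Pi.single k ((2 ^ n * v : ℕ) : ZMod (2 ^ M))) = F a) :
    ∑ a, (if IsGoodCell r M pos (shiftVal a) n p then 0 else F a) ≤
      badProb d r M * ∑ a, F a := by
  let Z : ℕ → Finset ℕ := fun j => Finset.range (2 ^ (j / 2)) ∪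
    Finset.Ico (2 ^ j - 2 ^ (j / 2)) (2 ^ j)
  have hZ : ∀ j, ((Z j).card : ℝ) ≤ 2 * 2 ^ (j / 2) := by
    intro j
    have h1 : (Z j).card ≤ 2 ^ (j / 2) + 2 ^ (j / 2) := by
      refine (Finset.card_union_le _ _).trans ?_
      rw [Finset.card_range, Nat.card_Ico]
      exact Nat.add_le_add_left tsub_tsub_le _
    have h2 : ((Z j).card : ℝ) ≤ 2 ^ (j / 2) + 2 ^ (j / 2) := by exact_mod_cast h1
    linarith
  have hbad : ∀ a, (if IsGoodCell r M pos (shiftVal a) n p then 0 else F a) ≤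
      ∑ j ∈ Finset.Ico r (M + 1), ∑ k, if n + j ≤ M ∧
        cellIdx pos (shiftVal a) n p k % 2 ^ j ∈ Z j then F a else 0 := by
    intro a
    have hnn : ∀ j ∈ Finset.Ico r (M + 1), ∀ k, 0 ≤ if n + j ≤ M ∧
        cellIdx pos (shiftVal a) n p k % 2 ^ j ∈ Z j then F a else 0 := fun j _ k => by
      split_ifs
      · exact hF a
      · exact le_rfl
    split_ifs with hg
    · exact Finset.sum_nonneg fun j hj => Finset.sum_nonneg fun k _ => hnn j hj k
    · simp only [IsGoodCell, not_forall] at hg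
      obtain ⟨j, hj, hjM, k, hk⟩ := hg
      have hjm : j ∈ Finset.Ico r (M + 1) := Finset.mem_Ico.mpr ⟨hj, by omega⟩
      refine le_trans ?_ (Finset.single_le_sum (fun j hj => Finset.sum_nonneg fun k _ =>
        hnn j hj k) hjm)
      refine le_trans (le_of_eq ?_) (Finset.single_le_sum (fun k _ => hnn j hjm k)
        (Finset.mem_univ k))
      rw [if_pos]
      refine ⟨hjM, ?_⟩
      have hlt : cellIdx pos (shiftVal a) n p k % 2 ^ j < 2 ^ j := Nat.mod_lt _ (by positivity)
      have key : ∀ x X Y : ℕ, ¬(Y ≤ x ∧ x + Y < X) → x < X → x < Y ∨ X - Y ≤ x ∧ x < X := by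
        omega
      simpa only [Z, Finset.mem_union, Finset.mem_range, Finset.mem_Ico] using key _ _ _ hk hlt
  refine (Finset.sum_le_sum fun a _ => hbad a).trans ?_
  rw [Finset.sum_comm, badProb, Finset.sum_mul]
  refine Finset.sum_le_sum fun j _ => ?_
  rw [Finset.sum_comm]
  have hS : 0 ≤ ∑ a, F a := Finset.sum_nonneg fun a _ => hF a
  calc _ ≤ ∑ _k : Fin d, 2 * 2 ^ (j / 2) / 2 ^ j * ∑ a, F a := by
        refine Finset.sum_le_sum fun k _ => ?_
        by_cases hnj : n + j ≤ M
        · simp only [hnj, true_and]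
          rw [div_mul_eq_mul_div, le_div_iff₀ (by positivity), mul_comm]
          refine (sum_shift_le pos hnj k p (Z j) F hF (hinv (by omega) k)).trans ?_
          exact mul_le_mul_of_nonneg_right (hZ j) hS
        · simp only [hnj, false_and, if_false, Finset.sum_const_zero]
          positivity
    _ = _ := by
        rw [Finset.sum_const, Finset.card_univ, Fintype.card_fin, nsmul_eq_mul]
        ring

-- The difference of level `n` depends on the partitions up to level `n + 1` only, whereas badness
-- at level `n + 1` concerns the position of that cell in larger ones. The two are independent, so
-- averaging factors, and orthogonality sums the levels.
open Classical in
theorem sum_normSq_bad_le {w : P → ℝ} (hw : ∀ p, 0 < w p) {pos : P → Fin d → ℕ}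
    (hpos : Function.Injective pos) (r : ℕ) (f : P → 𝕜) :
    ∑ a : Fin d → ZMod (2 ^ M), normSq w (martTransform w (cellIdx pos (shiftVal a)) (fun n p =>
      if IsGoodCell r M pos (shiftVal a) (n + 1) p then 0 else 1) (M + 1) f) ≤
      badProb d r M * (Fintype.card (Fin d → ZMod (2 ^ M)) * normSq w f) := by
  have h1 : ∀ a : Fin d → ZMod (2 ^ M), normSq w (martTransform w (cellIdx pos (shiftVal a))
      (fun n p => if IsGoodCell r M pos (shiftVal a) (n + 1) p then 0 else 1) (M + 1) f) =
      ∑ n ∈ Finset.range (M + 1), ∑ p, w p * (if IsGoodCell r M pos (shiftVal a) (n + 1) p then 0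
        else ‖cellDiff w (cellIdx pos (shiftVal a)) n f p‖ ^ 2) := by
    intro a
    rw [normSq_martTransform hw (nestedCells_cellIdx _ _) (cellIdx_zero_injective hpos _)
      (fun n p q h => ?_)]
    · refine Finset.sum_congr rfl fun n _ => Finset.sum_congr rfl fun p _ => ?_
      split_ifs <;> simp
    · have : IsGoodCell r M pos (shiftVal a) (n + 1) p ↔
          IsGoodCell r M pos (shiftVal a) (n + 1) q :=
        ⟨isGoodCell_congr _ _ _ h, isGoodCell_congr _ _ _ h.symm⟩
      simp only [this]
  have hB : 0 ≤ badProb d r M := Finset.sum_nonneg fun j _ => by positivity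
  calc _ = ∑ n ∈ Finset.range (M + 1), ∑ p, w p * ∑ a : Fin d → ZMod (2 ^ M),
        (if IsGoodCell r M pos (shiftVal a) (n + 1) p then 0
        else ‖cellDiff w (cellIdx pos (shiftVal a)) n f p‖ ^ 2) := by
        rw [Finset.sum_congr rfl fun a _ => h1 a, Finset.sum_comm]
        refine Finset.sum_congr rfl fun n _ => ?_
        rw [Finset.sum_comm]
        simp only [Finset.mul_sum]
    _ ≤ ∑ n ∈ Finset.range (M + 1), ∑ p, w p * (badProb d r M * ∑ a : Fin d → ZMod (2 ^ M),
        ‖cellDiff w (cellIdx pos (shiftVal a)) n f p‖ ^ 2) := by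
        refine Finset.sum_le_sum fun n _ => Finset.sum_le_sum fun p _ =>
          mul_le_mul_of_nonneg_left ?_ (hw p).le
        refine sum_bad_le pos r (n + 1) p _ (fun a => by positivity) fun hn k a v => ?_
        simp only [cellDiff_apply, Pi.sub_apply]
        rw [cellAvg_congr_cells f p fun q => cellIdx_shift_eq_iff pos (Nat.le_succ n) hn k a v p q,
          cellAvg_congr_cells f p fun q => cellIdx_shift_eq_iff pos le_rfl hn k a v p q]
    _ = badProb d r M * ∑ a : Fin d → ZMod (2 ^ M), ∑ n ∈ Finset.range (M + 1),
        normSq w (cellDiff w (cellIdx pos (shiftVal a)) n f) := by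
        have e : ∀ n, ∑ a : Fin d → ZMod (2 ^ M),
            normSq w (cellDiff w (cellIdx pos (shiftVal a)) n f) =
            ∑ p, w p * ∑ a : Fin d → ZMod (2 ^ M),
              ‖cellDiff w (cellIdx pos (shiftVal a)) n f p‖ ^ 2 := by
          intro n
          simp only [normSq, Finset.mul_sum]
          exact Finset.sum_comm
        rw [Finset.sum_comm (s := (Finset.univ : Finset (Fin d → ZMod (2 ^ M)))),
          Finset.sum_congr rfl fun n _ => e n, Finset.mul_sum]
        refine Finset.sum_congr rfl fun n _ => ?_
        rw [Finset.mul_sum]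
        exact Finset.sum_congr rfl fun p _ => by ring
    _ ≤ badProb d r M * ∑ _a : Fin d → ZMod (2 ^ M), normSq w f := by
        refine mul_le_mul_of_nonneg_left (Finset.sum_le_sum fun a _ => ?_) hB
        exact sum_normSq_cellDiff_le hw (nestedCells_cellIdx _ _) (M + 1) f
    _ = _ := by rw [Finset.sum_const, nsmul_eq_mul, Finset.card_univ]

open Classical in
/-- There is a shift for which the bad parts of two given functions are small. -/
theorem exists_shift_normSq_bad_le {w : P → ℝ} (hw : ∀ p, 0 < w p) {pos : P → Fin d → ℕ}
    (hpos : Function.Injective pos) (r : ℕ) {f g : P → 𝕜} (hf : 0 < normSq w f)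
    (hg : 0 < normSq w g) :
    ∃ a : Fin d → ZMod (2 ^ M), ∀ h ∈ ({f, g} : Set (P → 𝕜)),
      normSq w (martTransform w (cellIdx pos (shiftVal a)) (fun n p =>
        if IsGoodCell r M pos (shiftVal a) (n + 1) p then 0 else 1) (M + 1) h) ≤
        2 * badProb d r M * normSq w h := by
  let B : (P → 𝕜) → (Fin d → ZMod (2 ^ M)) → ℝ := fun h a =>
    normSq w (martTransform w (cellIdx pos (shiftVal a)) (fun n p =>
        if IsGoodCell r M pos (shiftVal a) (n + 1) p then 0 else 1) (M + 1) h)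
  have hBf := sum_normSq_bad_le (M := M) hw hpos r f
  have hBg := sum_normSq_bad_le (M := M) hw hpos r g
  -- Weighting each bad part by the norm of the other function puts both on the same scale. A shift
  -- at which the sum does not exceed its average serves both, as the summands are nonnegative.
  obtain ⟨a, -, ha⟩ := Finset.exists_le_of_sum_le (s := Finset.univ)
    (f := fun a => B f a * normSq w g + B g a * normSq w f)
    (g := fun _ => 2 * badProb d r M * normSq w f * normSq w g) Finset.univ_nonempty (by
      rw [Finset.sum_add_distrib, ← Finset.sum_mul, ← Finset.sum_mul, Finset.sum_const,
        nsmul_eq_mul, Finset.card_univ]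
      have h1 := mul_le_mul_of_nonneg_right hBf hg.le
      have h2 := mul_le_mul_of_nonneg_right hBg hf.le
      refine (add_le_add h1 h2).trans_eq ?_
      ring)
  have hf0 : 0 ≤ B f a := normSq_nonneg hw _
  have hg0 : 0 ≤ B g a := normSq_nonneg hw _
  refine ⟨a, ?_⟩
  rintro h (rfl | rfl)
  · refine le_of_mul_le_mul_right ?_ hg
    change B h a * _ ≤ _
    have := mul_nonneg hg0 hf.le
    linarith
  · refine le_of_mul_le_mul_right ?_ hf
    change B h a * _ ≤ _
    have := mul_nonneg hf0 hg.le
    linarith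

/-- The terms are bounded by a geometric sequence of ratio √(1/2), so the tail from `r` on is small
uniformly in `M`. -/
theorem exists_badProb_le (d : ℕ) {ε : ℝ} (hε : 0 < ε) :
    ∃ r₀ : ℕ, ∀ r, r₀ ≤ r → ∀ M, badProb d r M ≤ ε := by
  set ρ : ℝ := √(1 / 2) with hρ
  have hρ2 : ρ ^ 2 = 1 / 2 := Real.sq_sqrt (by norm_num)
  have hρ0 : 0 < ρ := Real.sqrt_pos.mpr (by norm_num)
  have hρ1 : ρ < 1 := by nlinarith
  have hle : ∀ j : ℕ, (2 : ℝ) ^ (j / 2) / 2 ^ j ≤ ρ ^ j := by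
    intro j
    refine le_of_sq_le_sq ?_ (by positivity)
    rw [← pow_mul, mul_comm j 2, pow_mul, hρ2, div_pow, ← pow_mul, one_div, inv_pow,
      div_le_iff₀ (by positivity)]
    have e : ((2 : ℝ) ^ j)⁻¹ * (2 ^ j) ^ 2 = 2 ^ j := by
      field_simp
    rw [e]
    exact pow_le_pow_right₀ one_le_two (by omega)
  obtain ⟨r₀, hr₀⟩ := exists_pow_lt_of_lt_one
    (show 0 < ε * (1 - ρ) / (2 * (d + 1)) by
      have : 0 < 1 - ρ := by linarith
      positivity) hρ1
  refine ⟨r₀, fun r hrr M => ?_⟩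
  have hr := (pow_le_pow_of_le_one hρ0.le hρ1.le hrr).trans_lt hr₀
  have h1ρ : 0 < 1 - ρ := by linarith
  have hgeom : ∑ j ∈ Finset.Ico r (M + 1), ρ ^ j ≤ ρ ^ r / (1 - ρ) :=
    geom_sum_Ico_le_of_lt_one hρ0.le hρ1
  calc badProb d r M ≤ ∑ j ∈ Finset.Ico r (M + 1), d * (2 * ρ ^ j) := by
        refine Finset.sum_le_sum fun j _ => ?_
        rw [mul_div_assoc]
        have := hle j
        gcongr
    _ = d * 2 * ∑ j ∈ Finset.Ico r (M + 1), ρ ^ j := by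
        rw [Finset.mul_sum]
        exact Finset.sum_congr rfl fun j _ => by ring
    _ ≤ d * 2 * (ρ ^ r / (1 - ρ)) := by gcongr
    _ ≤ (d + 1) * 2 * (ε * (1 - ρ) / (2 * (d + 1)) / (1 - ρ)) := by
        gcongr
        linarith
    _ = ε := by field_simp

end RandomShift

/-! ### Off-diagonal integrals under growth above a scale. -/

section Growth

/-- Integration of `|x - y| ^ (-(m + τ))` away from `x` against a measure that has growth of
order `m` at `x` above the scale `D`. -/
theorem lintegral_dist_rpow_neg_le {E : Type*} [PseudoMetricSpace E] [MeasurableSpace E]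
    [OpensMeasurableSpace E] (μ : Measure E) (x : E) {D m τ s : ℝ} (hm : 0 < m)
    (hτ : 0 < τ) (hs : 0 < s)
    (hgrow : ∀ r, D < r → μ (ball x r) ≤ ENNReal.ofReal (r ^ m)) :
    ∫⁻ y, (if s ≤ dist x y ∧ D ≤ 16 * dist x y then
      ENNReal.ofReal (dist x y ^ (-(m + τ))) else 0) ∂μ ≤
      ENNReal.ofReal (32 ^ m / (1 - 2 ^ (-τ)) * s ^ (-τ)) := by
  -- Dyadic annuli starting at radius ρ. Growth is available only above `D`, so the annulus of index
  -- k is enclosed in the larger ball of radius 2 ^ (k + 5) * ρ, which exceeds `D`; this overshoot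
  -- costs 32 ^ m.
  set ρ := max s (D / 16) with hρ
  have hρ0 : 0 < ρ := lt_max_of_lt_left hs
  have hq : (2 : ℝ) ^ (-τ) < 1 := Real.rpow_lt_one_of_one_lt_of_neg one_lt_two (by linarith)
  have hq0 : (0 : ℝ) < 2 ^ (-τ) := by positivity
  have hpt : ∀ y, (if s ≤ dist x y ∧ D ≤ 16 * dist x y then
      ENNReal.ofReal (dist x y ^ (-(m + τ))) else 0) ≤
      ∑' k : ℕ, (ball x (2 ^ (k + 5) * ρ)).indicator
        (fun _ => ENNReal.ofReal ((2 ^ k * ρ) ^ (-(m + τ)))) y := by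
    intro y
    split_ifs with h
    · have h1 : ρ ≤ dist x y := max_le h.1 (by linarith [h.2])
      obtain ⟨k, hk1, hk2⟩ := exists_nat_pow_near (x := dist x y / ρ) (y := 2)
        ((one_le_div hρ0).mpr h1) one_lt_two
      rw [le_div_iff₀ hρ0] at hk1
      rw [div_lt_iff₀ hρ0] at hk2
      refine le_trans ?_ (ENNReal.le_tsum k)
      rw [indicator_of_mem]
      · refine ENNReal.ofReal_le_ofReal ?_
        exact Real.rpow_le_rpow_of_nonpos (by positivity) hk1 (by linarith)
      · rw [mem_ball, dist_comm]
        refine hk2.trans_le ?_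
        gcongr <;> norm_num
    · exact zero_le
  have hterm : ∀ k : ℕ, ∫⁻ y, (ball x (2 ^ (k + 5) * ρ)).indicator
        (fun _ => ENNReal.ofReal ((2 ^ k * ρ) ^ (-(m + τ)))) y ∂μ ≤
      ENNReal.ofReal (32 ^ m * s ^ (-τ) * (2 ^ (-τ)) ^ k) := by
    intro k
    rw [lintegral_indicator_const measurableSet_ball]
    have hlt : D < 2 ^ (k + 5) * ρ := by
      have h1 : (1 : ℝ) ≤ 2 ^ k := one_le_pow₀ one_le_two
      have h2 : D / 16 ≤ ρ := le_max_right _ _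
      have h3 : 32 * ρ ≤ 2 ^ (k + 5) * ρ := by
        rw [pow_add]
        nlinarith
      nlinarith
    refine (mul_le_mul_right (hgrow _ hlt) _).trans ?_
    rw [← ENNReal.ofReal_mul (by positivity)]
    refine ENNReal.ofReal_le_ofReal ?_
    have e : (2 ^ k * ρ) ^ (-(m + τ)) * (2 ^ (k + 5) * ρ) ^ m =
        32 ^ m * ρ ^ (-τ) * (2 ^ (-τ)) ^ k := by
      have h1 : (2 : ℝ) ^ (k + 5) * ρ = 32 * (2 ^ k * ρ) := by ring
      rw [h1, Real.mul_rpow (x := 32) (y := 2 ^ k * ρ) (by norm_num) (by positivity),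
        neg_add, Real.rpow_add (by positivity),
        Real.rpow_neg (by positivity) m]
      have h2 : (2 ^ k * ρ : ℝ) ^ (-τ) = ρ ^ (-τ) * (2 ^ (-τ)) ^ k := by
        rw [Real.mul_rpow (by positivity) hρ0.le, mul_comm, ← Real.rpow_natCast,
          ← Real.rpow_natCast, ← Real.rpow_mul zero_le_two, ← Real.rpow_mul zero_le_two,
          mul_comm (k : ℝ)]
      rw [h2]
      have : (2 ^ k * ρ : ℝ) ^ m ≠ 0 := by positivity
      field_simp
    rw [e]
    have : ρ ^ (-τ) ≤ s ^ (-τ) :=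
      Real.rpow_le_rpow_of_nonpos hs (le_max_left _ _) (by linarith)
    gcongr
  calc _ ≤ ∫⁻ y, ∑' k : ℕ, (ball x (2 ^ (k + 5) * ρ)).indicator
        (fun _ => ENNReal.ofReal ((2 ^ k * ρ) ^ (-(m + τ)))) y ∂μ := lintegral_mono hpt
    _ = ∑' k : ℕ, ∫⁻ y, (ball x (2 ^ (k + 5) * ρ)).indicator
        (fun _ => ENNReal.ofReal ((2 ^ k * ρ) ^ (-(m + τ)))) y ∂μ :=
        lintegral_tsum fun k => (measurable_const.indicator measurableSet_ball).aemeasurable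
    _ ≤ ∑' k : ℕ, ENNReal.ofReal (32 ^ m * s ^ (-τ) * (2 ^ (-τ)) ^ k) := ENNReal.tsum_le_tsum hterm
    _ = ENNReal.ofReal (∑' k : ℕ, 32 ^ m * s ^ (-τ) * (2 ^ (-τ)) ^ k) :=
        (ENNReal.ofReal_tsum_of_nonneg (fun k => by positivity)
          ((summable_geometric_of_lt_one hq0.le hq).mul_left _)).symm
    _ = _ := by
        rw [tsum_mul_left, tsum_geometric_of_lt_one hq0.le hq]
        congr 1
        ring

end Growth

/-! ### Splitting the kernel at the scale δ. -/

section Suppression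

variable {E : Type*} [MetricSpace E] {𝕜 : Type*} [RCLike 𝕜]

/-- A Calderón–Zygmund kernel on `S` that is bounded by `1` at the scale given by `δ`. -/
structure IsScaledKernel (S : Set E) (δ : E → ℝ) (m C τ : ℝ) (k : E → E → 𝕜) : Prop where
  nonneg : ∀ x, 0 ≤ δ x
  lipschitz : ∀ x y, δ x ≤ δ y + dist x y
  size : ∀ x ∈ S, ∀ y ∈ S, x ≠ y → ‖k x y‖ ≤ C / dist x y ^ m
  smooth : ∀ x ∈ S, ∀ x' ∈ S, ∀ y ∈ S, x ≠ y → dist x x' ≤ 1 / 2 * dist x y →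
    ‖k y x - k y x'‖ + ‖k x y - k x' y‖ ≤ C * (dist x x' ^ τ / dist x y ^ (m + τ))
  bound : ∀ x ∈ S, ∀ y ∈ S, δ x ^ m * ‖k x y‖ ≤ 1

/-- A cutoff function that vanishes at distances below `(δ x + δ y) / 8` and equals `1` at
distances above twice that. -/
noncomputable def cutoff (δ : E → ℝ) (x y : E) : ℝ :=
  min 1 (2 * (1 - min ((δ x + δ y) / 8) (dist x y) / dist x y))

/-- The weight of the smoothness estimate for suppressed kernels. -/
noncomputable def smoothWeight (δ : E → ℝ) (m τ : ℝ) (x y : E) : ℝ :=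
  if δ x + δ y ≤ 16 * dist x y then dist x y ^ (-(m + τ)) else 0

variable {δ : E → ℝ} {m C τ : ℝ}

theorem cutoff_comm (x y : E) : cutoff δ x y = cutoff δ y x := by
  rw [cutoff, cutoff, dist_comm, add_comm]

theorem smoothWeight_comm (x y : E) : smoothWeight δ m τ x y = smoothWeight δ m τ y x := by
  rw [smoothWeight, smoothWeight, dist_comm, add_comm]

theorem smoothWeight_nonneg (x y : E) : 0 ≤ smoothWeight δ m τ x y := by
  rw [smoothWeight]
  split_ifs <;> positivity

theorem cutoff_nonneg (x y : E) : 0 ≤ cutoff δ x y := by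
  have h : min ((δ x + δ y) / 8) (dist x y) / dist x y ≤ 1 :=
    div_le_one_of_le₀ (min_le_right _ _) dist_nonneg
  exact le_min zero_le_one (by linarith)

theorem cutoff_le_one (x y : E) : cutoff δ x y ≤ 1 := min_le_left _ _

theorem lt_of_cutoff_ne_zero {x y : E} (hxy : x ≠ y) (h : cutoff δ x y ≠ 0) :
    (δ x + δ y) / 8 < dist x y := by
  by_contra! hle
  refine h ?_
  rw [cutoff, min_eq_right hle, div_self (dist_ne_zero.mpr hxy)]
  norm_num

theorem lt_of_cutoff_ne_one {x y : E} (hxy : x ≠ y) (h : cutoff δ x y ≠ 1) :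
    dist x y < (δ x + δ y) / 4 := by
  by_contra! hle
  refine h ?_
  have hpos : 0 < dist x y := dist_pos.mpr hxy
  rw [cutoff, min_eq_left]
  have h2 : min ((δ x + δ y) / 8) (dist x y) / dist x y ≤ 1 / 2 := by
    rw [div_le_iff₀ hpos]
    exact (min_le_left _ _).trans (by linarith)
  linarith

/-- The minimum in the cutoff and the distance to `y` both change by at most dist x x', and the
minimum never exceeds the distance, so their quotient changes by at most twice dist x x' / dist x y.
The factor 2 in the cutoff makes this 4. -/
theorem abs_cutoff_sub_le (hδ0 : ∀ x, 0 ≤ δ x) (hδ : ∀ x y, δ x ≤ δ y + dist x y) {x x' y : E}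
    (hxy : x ≠ y) (hx : dist x x' ≤ 1 / 2 * dist x y) :
    |cutoff δ x y - cutoff δ x' y| ≤ 4 * (dist x x' / dist x y) := by
  have hpos : 0 < dist x y := dist_pos.mpr hxy
  have hpos' : 0 < dist x' y := by
    have := dist_triangle x x' y
    linarith
  set t := dist x x'
  set ρ := dist x y
  set ρ' := dist x' y
  have hρ : |ρ - ρ'| ≤ t := abs_dist_sub_le x x' y
  have hD : |(δ x + δ y) / 8 - (δ x' + δ y) / 8| ≤ t := by
    have h1 := hδ x x'
    have h2 := hδ x' x
    rw [dist_comm x' x] at h2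
    rw [abs_le]
    constructor <;> linarith [dist_nonneg (x := x) (y := x')]
  set N := min ((δ x + δ y) / 8) ρ
  set N' := min ((δ x' + δ y) / 8) ρ'
  have hN : |N - N'| ≤ t := (abs_min_sub_min_le_max _ _ _ _).trans (max_le hD hρ)
  have hN0 : 0 ≤ N' := le_min (by have := hδ0 x'; have := hδ0 y; positivity) hpos'.le
  have hN1 : N' ≤ ρ' := min_le_right _ _
  have key : |N / ρ - N' / ρ'| ≤ 2 * (t / ρ) := by
    have e : N / ρ - N' / ρ' = (N - N') / ρ + N' / ρ' * ((ρ' - ρ) / ρ) := by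
      field_simp
      ring
    rw [e]
    refine (abs_add_le _ _).trans ?_
    rw [abs_div, abs_mul, abs_div (ρ' - ρ), abs_of_pos hpos, abs_sub_comm ρ' ρ]
    have h1 : |N' / ρ'| ≤ 1 := by
      rw [abs_of_nonneg (by positivity)]
      exact div_le_one_of_le₀ hN1 hpos'.le
    have h2 : |N - N'| / ρ ≤ t / ρ := by gcongr
    have h3 : |ρ - ρ'| / ρ ≤ t / ρ := by gcongr
    have h4 : |N' / ρ'| * (|ρ - ρ'| / ρ) ≤ 1 * (t / ρ) := by gcongr
    linarith
  rw [cutoff, cutoff]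
  refine (abs_min_sub_min_le_max _ _ _ _).trans (max_le ?_ ?_)
  · rw [sub_self, abs_zero]
    positivity
  · have e : 2 * (1 - N / ρ) - 2 * (1 - N' / ρ') = -(2 * (N / ρ - N' / ρ')) := by ring
    rw [e, abs_neg, abs_mul, abs_two]
    linarith

open Classical in
/-- The part of the kernel `k` at large distances. -/
noncomputable def farKernel (S : Set E) (δ : E → ℝ) (k : E → E → 𝕜) (x y : E) : 𝕜 :=
  if x ∈ S ∧ y ∈ S ∧ x ≠ y then (cutoff δ x y : 𝕜) * k x y else 0

open Classical in
/-- The part of the kernel `k` at small distances. -/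
noncomputable def localKernel (S : Set E) (δ : E → ℝ) (k : E → E → 𝕜) (x y : E) : 𝕜 :=
  if x ∈ S ∧ y ∈ S ∧ x ≠ y then ((1 - cutoff δ x y : ℝ) : 𝕜) * k x y else 0

variable {S : Set E} {k : E → E → 𝕜}

theorem farKernel_add_localKernel {x y : E} (hx : x ∈ S) (hy : y ∈ S) (hxy : x ≠ y) :
    farKernel S δ k x y + localKernel S δ k x y = k x y := by
  rw [farKernel, localKernel, if_pos ⟨hx, hy, hxy⟩, if_pos ⟨hx, hy, hxy⟩]
  push_cast
  ring

theorem norm_farKernel_le (x y : E) : ‖farKernel S δ k x y‖ ≤ ‖k x y‖ := by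
  rw [farKernel]
  split_ifs
  · rw [norm_mul, RCLike.norm_ofReal, abs_of_nonneg (cutoff_nonneg x y)]
    exact mul_le_of_le_one_left (norm_nonneg _) (cutoff_le_one x y)
  · simp

theorem norm_localKernel_le (x y : E) : ‖localKernel S δ k x y‖ ≤ ‖k x y‖ := by
  rw [localKernel]
  split_ifs
  · rw [norm_mul, RCLike.norm_ofReal, abs_of_nonneg (sub_nonneg.mpr (cutoff_le_one x y))]
    exact mul_le_of_le_one_left (norm_nonneg _) (by linarith [cutoff_nonneg (δ := δ) x y])
  · simp

theorem farKernel_swap (x y : E) :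
    farKernel S δ (fun x y => k y x) x y = farKernel S δ k y x := by
  have h : (x ∈ S ∧ y ∈ S ∧ x ≠ y) ↔ (y ∈ S ∧ x ∈ S ∧ y ≠ x) := by
    rw [ne_comm]
    tauto
  by_cases hc : x ∈ S ∧ y ∈ S ∧ x ≠ y
  · rw [farKernel, farKernel, if_pos hc, if_pos (h.mp hc), cutoff_comm]
  · rw [farKernel, farKernel, if_neg hc, if_neg fun h' => hc (h.mpr h')]

theorem localKernel_swap (x y : E) :
    localKernel S δ (fun x y => k y x) x y = localKernel S δ k y x := by
  have h : (x ∈ S ∧ y ∈ S ∧ x ≠ y) ↔ (y ∈ S ∧ x ∈ S ∧ y ≠ x) := by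
    rw [ne_comm]
    tauto
  by_cases hc : x ∈ S ∧ y ∈ S ∧ x ≠ y
  · rw [localKernel, localKernel, if_pos hc, if_pos (h.mp hc), cutoff_comm]
  · rw [localKernel, localKernel, if_neg hc, if_neg fun h' => hc (h.mpr h')]

/-- Where the cutoff is not 1, dist x y < (δ x + δ y) / 4; with δ y ≤ δ x + dist x y this forces
dist x y < δ x. -/
theorem IsScaledKernel.norm_localKernel_le (hk : IsScaledKernel S δ m C τ k) (x y : E) :
    ‖localKernel S δ k x y‖ ≤ if dist x y < δ x then (δ x ^ m)⁻¹ else 0 := by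
  by_cases hxy : x ∈ S ∧ y ∈ S ∧ x ≠ y
  · by_cases hc : cutoff δ x y = 1
    · rw [localKernel, if_pos hxy, hc]
      simp only [sub_self, RCLike.ofReal_zero, zero_mul, norm_zero]
      have := hk.nonneg x
      split_ifs <;> positivity
    · have h1 := lt_of_cutoff_ne_one hxy.2.2 hc
      have h2 := hk.lipschitz y x
      rw [dist_comm] at h2
      have hpos : 0 < dist x y := dist_pos.mpr hxy.2.2
      rw [if_pos (by linarith)]
      refine (_root_.norm_localKernel_le x y).trans ?_
      have h3 : 0 < δ x ^ m := Real.rpow_pos_of_pos (by linarith) m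
      rw [← one_div, le_div_iff₀ h3, mul_comm]
      exact hk.bound x hxy.1 y hxy.2.1
  · rw [localKernel, if_neg hxy, norm_zero]
    have := hk.nonneg x
    split_ifs <;> positivity

/-- Product rule: smoothness of `k` contributes C, and the variation of the cutoff 4C, because t / ρ
≤ (t / ρ) ^ τ for t ≤ ρ and τ ≤ 1. If δ x + δ y > 16 ρ both cutoffs vanish; the threshold 16 leaves
room for the change of scale and distance when x moves to x' by at most ρ / 2. -/
theorem IsScaledKernel.norm_farKernel_sub_le (hk : IsScaledKernel S δ m C τ k)
    (hτ1 : τ ≤ 1) {x x' y : E} (hx : x ∈ S) (hx' : x' ∈ S) (hy : y ∈ S) (hxy : x ≠ y)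
    (hd : dist x x' ≤ 1 / 2 * dist x y) :
    ‖farKernel S δ k x y - farKernel S δ k x' y‖ ≤
      5 * C * dist x x' ^ τ * smoothWeight δ m τ x y := by
  have hpos : 0 < dist x y := dist_pos.mpr hxy
  have hx'y : x' ≠ y := by
    rintro rfl
    linarith
  have hkx := hk.smooth x hx x' hx' y hy hxy hd
  rw [farKernel, farKernel, if_pos ⟨hx, hy, hxy⟩, if_pos ⟨hx', hy, hx'y⟩, smoothWeight]
  split_ifs with hw
  · set ρ := dist x y
    set t := dist x x'
    have ht0 : 0 ≤ t := dist_nonneg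
    have e : (cutoff δ x y : 𝕜) * k x y - (cutoff δ x' y : 𝕜) * k x' y =
        (cutoff δ x' y : 𝕜) * (k x y - k x' y) +
          ((cutoff δ x y - cutoff δ x' y : ℝ) : 𝕜) * k x y := by
      push_cast
      ring
    rw [e]
    refine (norm_add_le _ _).trans ?_
    rw [norm_mul, norm_mul, RCLike.norm_ofReal, RCLike.norm_ofReal,
      abs_of_nonneg (cutoff_nonneg x' y)]
    have h1 : cutoff δ x' y * ‖k x y - k x' y‖ ≤ C * (t ^ τ / ρ ^ (m + τ)) := by
      refine (mul_le_of_le_one_left (norm_nonneg _) (cutoff_le_one x' y)).trans ?_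
      linarith [norm_nonneg (k y x - k y x')]
    have h2 : t / ρ ≤ (t / ρ) ^ τ := by
      have h4 : t / ρ ≤ 1 := by
        rw [div_le_one hpos]
        linarith
      rcases ht0.eq_or_lt with h0 | h0
      · rw [← h0, zero_div]
        positivity
      · calc t / ρ = (t / ρ) ^ (1 : ℝ) := (Real.rpow_one _).symm
          _ ≤ (t / ρ) ^ τ := Real.rpow_le_rpow_of_exponent_ge (by positivity) h4 hτ1
    have h3 : |cutoff δ x y - cutoff δ x' y| * ‖k x y‖ ≤ 4 * (t / ρ) ^ τ * (C / ρ ^ m) := by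
      refine mul_le_mul ((abs_cutoff_sub_le hk.nonneg hk.lipschitz hxy hd).trans (by linarith))
        (hk.size x hx y hy hxy) (norm_nonneg _) (by positivity)
    refine (add_le_add h1 h3).trans_eq ?_
    rw [Real.rpow_neg hpos.le, Real.rpow_add hpos, Real.div_rpow ht0 hpos.le]
    field_simp
    ring
  · have hpos' := dist_triangle x x' y
    have h0 : cutoff δ x y = 0 := by
      by_contra hne
      have := lt_of_cutoff_ne_zero hxy hne
      linarith
    have h0' : cutoff δ x' y = 0 := by
      by_contra hne
      have h1 := lt_of_cutoff_ne_zero hx'y hne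
      have h2 := hk.lipschitz x x'
      have h3 := dist_triangle x' x y
      rw [dist_comm x' x] at h3
      linarith
    simp [h0, h0']

end Suppression

/-! ### Measurability and Schur bounds of the two kernel parts. -/

section Measurability

variable {E : Type*} [MetricSpace E] {𝕜 : Type*} [RCLike 𝕜] {S : Set E} {δ : E → ℝ} {m C τ : ℝ}
  {k : E → E → 𝕜}

/-- `IsScaledKernel` bounds the kernel only by the scale of its first variable, so the transpose
needs the bound at the second. -/
theorem IsScaledKernel.swap (hk : IsScaledKernel S δ m C τ k)
    (hb : ∀ x ∈ S, ∀ y ∈ S, δ y ^ m * ‖k x y‖ ≤ 1) :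
    IsScaledKernel S δ m C τ fun x y => k y x where
  nonneg := hk.nonneg
  lipschitz := hk.lipschitz
  size x hx y hy hxy := by
    rw [dist_comm]
    exact hk.size y hy x hx hxy.symm
  smooth x hx x' hx' y hy hxy hd := by
    rw [add_comm]
    exact hk.smooth x hx x' hx' y hy hxy hd
  bound x hx y hy := hb y hy x hx

theorem IsScaledKernel.continuous_scale (hk : IsScaledKernel S δ m C τ k) : Continuous δ := by
  refine LipschitzWith.continuous (K := 1) (LipschitzWith.of_dist_le_mul fun x y => ?_)
  rw [NNReal.coe_one, one_mul, Real.dist_eq, abs_le]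
  have h1 := hk.lipschitz x y
  have h2 := hk.lipschitz y x
  rw [dist_comm y x] at h2
  constructor <;> linarith

/-- The kernel is not assumed measurable. Smoothness in each variable gives joint continuity off the
diagonal of `S`, with k x₀ y as the intermediate value, and this yields measurability of both kernel
parts. -/
theorem IsScaledKernel.continuousOn (hk : IsScaledKernel S δ m C τ k) (hC : 0 ≤ C) (hm : 0 < m)
    (hτ : 0 < τ) :
    ContinuousOn (fun z : E × E => k z.1 z.2) {z | z.1 ∈ S ∧ z.2 ∈ S ∧ z.1 ≠ z.2} := by
  rintro ⟨x₀, y₀⟩ ⟨hx₀, hy₀, hne⟩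
  set ρ := dist x₀ y₀ with hρ
  have hpos : 0 < ρ := dist_pos.mpr hne
  rw [ContinuousWithinAt, tendsto_iff_norm_sub_tendsto_zero]
  have hlim : Filter.Tendsto (fun z : E × E => C * (dist x₀ z.1 ^ τ / (ρ / 2) ^ (m + τ)) +
      C * (dist y₀ z.2 ^ τ / ρ ^ (m + τ)))
      (nhdsWithin (x₀, y₀) {z | z.1 ∈ S ∧ z.2 ∈ S ∧ z.1 ≠ z.2}) (nhds 0) := by
    have hc : Continuous (fun z : E × E => C * (dist x₀ z.1 ^ τ / (ρ / 2) ^ (m + τ)) +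
        C * (dist y₀ z.2 ^ τ / ρ ^ (m + τ))) := by
      refine ((Continuous.div_const ?_ _).const_mul C).add
        ((Continuous.div_const ?_ _).const_mul C)
      · exact (continuous_const.dist continuous_fst).rpow_const fun _ => Or.inr hτ.le
      · exact (continuous_const.dist continuous_snd).rpow_const fun _ => Or.inr hτ.le
    have h0 := hc.tendsto (x₀, y₀)
    simp only [dist_self, Real.zero_rpow hτ.ne', zero_div, mul_zero, add_zero] at h0
    exact h0.mono_left nhdsWithin_le_nhds
  refine squeeze_zero' (Filter.Eventually.of_forall fun _ => norm_nonneg _) ?_ hlim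
  have hnear : ∀ᶠ z : E × E in nhdsWithin (x₀, y₀) {z | z.1 ∈ S ∧ z.2 ∈ S ∧ z.1 ≠ z.2},
      dist z (x₀, y₀) < ρ / 4 :=
    nhdsWithin_le_nhds (ball_mem_nhds _ (by positivity))
  filter_upwards [hnear, self_mem_nhdsWithin] with z hz hzO
  obtain ⟨x, y⟩ := z
  obtain ⟨hx, hy, -⟩ := hzO
  rw [Prod.dist_eq, max_lt_iff, dist_comm x, dist_comm y] at hz
  obtain ⟨hz1, hz2⟩ := hz
  simp only at hx hy hz1 hz2 ⊢
  have htri := dist_triangle x₀ y y₀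
  rw [dist_comm y y₀] at htri
  have hxy : ρ / 2 ≤ dist x₀ y := by linarith
  have hxyne : x₀ ≠ y := dist_pos.mp (by linarith)
  have h1 := hk.smooth x₀ hx₀ x hx y hy hxyne (by linarith)
  have h2 := hk.smooth y₀ hy₀ y hy x₀ hx₀ hne.symm (by rw [dist_comm y₀ x₀]; linarith)
  rw [dist_comm y₀ x₀, ← hρ] at h2
  have h3 : C * (dist x₀ x ^ τ / dist x₀ y ^ (m + τ)) ≤
      C * (dist x₀ x ^ τ / (ρ / 2) ^ (m + τ)) := by gcongr
  have h4 : k x y - k x₀ y₀ = -(k x₀ y - k x y) - (k x₀ y₀ - k x₀ y) := by ring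
  rw [h4]
  refine (norm_sub_le _ _).trans ?_
  rw [norm_neg]
  linarith [norm_nonneg (k y x₀ - k y x), norm_nonneg (k y₀ x₀ - k y x₀)]

theorem continuousOn_cutoff (hδ : Continuous δ) :
    ContinuousOn (fun z : E × E => cutoff δ z.1 z.2) {z | z.1 ≠ z.2} := by
  have h1 : Continuous fun z : E × E => (δ z.1 + δ z.2) / 8 := by fun_prop
  have h2 : Continuous fun z : E × E => dist z.1 z.2 := by fun_prop
  refine ContinuousOn.inf continuousOn_const (continuousOn_const.mul
    (continuousOn_const.sub ((h1.min h2).continuousOn.div h2.continuousOn fun z hz => ?_)))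
  exact dist_ne_zero.mpr hz

/-- The weight of the smoothness estimate at distances at least `s`. -/
noncomputable def truncWeight (δ : E → ℝ) (m τ D s : ℝ) (x y : E) : ℝ≥0∞ :=
  if s ≤ dist x y then ENNReal.ofReal (D * smoothWeight δ m τ x y) else 0

theorem truncWeight_comm (D s : ℝ) (x y : E) :
    truncWeight δ m τ D s x y = truncWeight δ m τ D s y x := by
  rw [truncWeight, truncWeight, dist_comm, smoothWeight_comm]

variable [MeasurableSpace E] [BorelSpace E]

theorem lintegral_truncWeight_le {μ : Measure E} (hδ0 : ∀ x, 0 ≤ δ x) (hm : 0 < m) (hτ : 0 < τ)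
    {D s : ℝ} (hD : 0 ≤ D) (hs : 0 < s) (x : E)
    (hgrow : ∀ r, δ x < r → μ (ball x r) ≤ ENNReal.ofReal (r ^ m)) :
    ∫⁻ y, truncWeight δ m τ D s x y ∂μ ≤
      ENNReal.ofReal (D * (32 ^ m / (1 - 2 ^ (-τ)) * s ^ (-τ))) := by
  rw [ENNReal.ofReal_mul hD]
  refine le_trans ?_ (mul_le_mul_right (lintegral_dist_rpow_neg_le μ x hm hτ hs hgrow) _)
  rw [← lintegral_const_mul']
  · refine lintegral_mono fun y => ?_
    rw [truncWeight, smoothWeight]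
    by_cases h1 : s ≤ dist x y
    · by_cases h2 : δ x + δ y ≤ 16 * dist x y
      · rw [if_pos h1, if_pos h2, if_pos ⟨h1, by linarith [hδ0 y]⟩, ENNReal.ofReal_mul hD]
      · simp [h2]
    · simp [h1]
  · exact ENNReal.ofReal_ne_top

/-- The integrand is at most δ(x)^(-m) on the ball of radius δ x. Growth holds only for radii
strictly above δ x, so it is used at 2 δ x; for δ x = 0 the ball is empty. -/
theorem IsScaledKernel.lintegral_localKernel_le (hk : IsScaledKernel S δ m C τ k) {μ : Measure E}
    (x : E) (hgrow : ∀ r, δ x < r → μ (ball x r) ≤ ENNReal.ofReal (r ^ m)) :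
    ∫⁻ y, ‖localKernel S δ k x y‖ₑ ∂μ ≤ ENNReal.ofReal (2 ^ m) := by
  have hle : ∀ y, ‖localKernel S δ k x y‖ₑ ≤
      (ball x (δ x)).indicator (fun _ => ENNReal.ofReal (δ x ^ m)⁻¹) y := by
    intro y
    rw [← ofReal_norm]
    refine (ENNReal.ofReal_le_ofReal (hk.norm_localKernel_le x y)).trans ?_
    by_cases h : dist x y < δ x
    · rw [if_pos h, indicator_of_mem (by rwa [mem_ball, dist_comm])]
    · rw [if_neg h]
      simp
  refine (lintegral_mono hle).trans ?_
  rw [lintegral_indicator_const measurableSet_ball]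
  rcases (hk.nonneg x).eq_or_lt with h0 | h0
  · simp [← h0]
  · calc _ ≤ ENNReal.ofReal (δ x ^ m)⁻¹ * ENNReal.ofReal ((2 * δ x) ^ m) := by
          refine mul_le_mul_right ?_ _
          exact (measure_mono (ball_subset_ball (by linarith))).trans (hgrow _ (by linarith))
      _ = ENNReal.ofReal (2 ^ m) := by
          rw [← ENNReal.ofReal_mul (by positivity), Real.mul_rpow zero_le_two h0.le]
          congr 1
          have : δ x ^ m ≠ 0 := by positivity
          field_simp

variable [SecondCountableTopology E]

theorem stronglyMeasurable_indicator_of_continuousOn {α : Type*} [TopologicalSpace α]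
    [MeasurableSpace α] [OpensMeasurableSpace α] {f : α → 𝕜} {s : Set α} (hs : MeasurableSet s)
    (hf : ContinuousOn f s) : StronglyMeasurable (s.indicator f) := by
  classical
  borelize 𝕜
  rw [← piecewise_eq_indicator]
  exact (hf.measurable_piecewise continuousOn_const hs).stronglyMeasurable

theorem measurableSet_offDiag_of_isClosed (hS : IsClosed S) :
    MeasurableSet {z : E × E | z.1 ∈ S ∧ z.2 ∈ S ∧ z.1 ≠ z.2} := by
  refine (measurable_fst hS.measurableSet).inter
    ((measurable_snd hS.measurableSet).inter (MeasurableSet.compl ?_))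
  exact (isClosed_eq continuous_fst continuous_snd).measurableSet

theorem IsScaledKernel.stronglyMeasurable_farKernel (hk : IsScaledKernel S δ m C τ k)
    (hC : 0 ≤ C) (hm : 0 < m) (hτ : 0 < τ) (hS : IsClosed S) :
    StronglyMeasurable (Function.uncurry (farKernel S δ k)) := by
  have h := stronglyMeasurable_indicator_of_continuousOn (measurableSet_offDiag_of_isClosed hS)
    (f := fun z : E × E => (cutoff δ z.1 z.2 : 𝕜) * k z.1 z.2)
    ((RCLike.continuous_ofReal.comp_continuousOn ((continuousOn_cutoff
      hk.continuous_scale).mono fun z hz => hz.2.2)).mul (hk.continuousOn hC hm hτ))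
  convert h using 1
  ext ⟨x, y⟩
  simp [farKernel, indicator]

theorem IsScaledKernel.stronglyMeasurable_localKernel (hk : IsScaledKernel S δ m C τ k)
    (hC : 0 ≤ C) (hm : 0 < m) (hτ : 0 < τ) (hS : IsClosed S) :
    StronglyMeasurable (Function.uncurry (localKernel S δ k)) := by
  have h := stronglyMeasurable_indicator_of_continuousOn (measurableSet_offDiag_of_isClosed hS)
    (f := fun z : E × E => ((1 - cutoff δ z.1 z.2 : ℝ) : 𝕜) * k z.1 z.2)
    ((RCLike.continuous_ofReal.comp_continuousOn (continuousOn_const.sub ((continuousOn_cutoff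
      hk.continuous_scale).mono fun z hz => hz.2.2))).mul (hk.continuousOn hC hm hτ))
  convert h using 1
  ext ⟨x, y⟩
  simp [localKernel, indicator]

theorem measurable_truncWeight (hδ : Continuous δ) (D s : ℝ) :
    Measurable (Function.uncurry (truncWeight δ m τ D s)) := by
  have h2 : Measurable fun z : E × E => dist z.1 z.2 := measurable_dist
  have h1 : Measurable fun z : E × E => δ z.1 + δ z.2 :=
    (hδ.measurable.comp measurable_fst).add (hδ.measurable.comp measurable_snd)
  refine Measurable.ite (measurableSet_le measurable_const h2)
    (ENNReal.measurable_ofReal.comp (Measurable.const_mul (Measurable.ite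
      (measurableSet_le h1 (h2.const_mul 16)) (h2.pow_const _) measurable_const) D))
    measurable_const

end Measurability

/-! ### Matrices given by integrals of a kernel over pairs of cells. -/

section CellKernel

theorem sum_setLIntegral_le {E P : Type*} [MeasurableSpace E] [Fintype P] {μ : Measure E}
    {cell : P → Set E} (hcell : ∀ p, MeasurableSet (cell p))
    (hdisj : Pairwise (Function.onFun Disjoint cell)) (F : E → ℝ≥0∞) :
    ∑ p, ∫⁻ x in cell p, F x ∂μ ≤ ∫⁻ x, F x ∂μ := by
  rw [← lintegral_biUnion_finset (fun p _ q _ h => hdisj h) (fun p _ => hcell p)]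
  exact setLIntegral_le_lintegral _ _

variable {E : Type*} [MeasurableSpace E] {μ : Measure E} {P ι 𝕜 : Type*} [RCLike 𝕜]
  {cell : P → Set E}

/-- The integral of a weight over a product of cells. -/
noncomputable def cellWeight (μ : Measure E) (cell : P → Set E) (V : E → E → ℝ≥0∞) (p q : P) : ℝ :=
  (∫⁻ x in cell q, ∫⁻ y in cell p, V x y ∂μ ∂μ).toReal

variable [IsFiniteMeasure μ]

theorem cellWeight_ne_top {V : E → E → ℝ≥0∞} {C : ℝ}
    (hrow : ∀ x, ∫⁻ y, V x y ∂μ ≤ ENNReal.ofReal C) (p q : P) :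
    ∫⁻ x in cell q, ∫⁻ y in cell p, V x y ∂μ ∂μ ≠ ⊤ := by
  refine ne_top_of_le_ne_top ?_ (lintegral_mono fun x =>
    (setLIntegral_le_lintegral (cell p) (V x)).trans (hrow x))
  rw [lintegral_const]
  exact ENNReal.mul_ne_top ENNReal.ofReal_ne_top (measure_ne_top _ _)

variable [Fintype P]

theorem sum_cellWeight_left_le (hcell : ∀ p, MeasurableSet (cell p))
    (hdisj : Pairwise (Function.onFun Disjoint cell)) {V : E → E → ℝ≥0∞}
    (hV : Measurable (Function.uncurry V)) {C : ℝ} (hC : 0 ≤ C)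
    (hrow : ∀ x, ∫⁻ y, V x y ∂μ ≤ ENNReal.ofReal C) (q : P) :
    ∑ p, cellWeight μ cell V p q ≤ C * μ.real (cell q) := by
  simp only [cellWeight]
  rw [← ENNReal.toReal_sum fun p _ => cellWeight_ne_top hrow p q,
    ← lintegral_finsetSum Finset.univ fun p _ =>
      (show Measurable fun x => ∫⁻ y in cell p, V x y ∂μ from hV.lintegral_prod_right')]
  refine ENNReal.toReal_le_of_le_ofReal (by positivity) ?_
  calc _ ≤ ∫⁻ x in cell q, ENNReal.ofReal C ∂μ :=
        lintegral_mono fun x => (sum_setLIntegral_le hcell hdisj (V x)).trans (hrow x)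
    _ = _ := by
        rw [setLIntegral_const, ENNReal.ofReal_mul hC, ofReal_measureReal]

theorem sum_cellWeight_right_le (hcell : ∀ p, MeasurableSet (cell p))
    (hdisj : Pairwise (Function.onFun Disjoint cell)) {V : E → E → ℝ≥0∞}
    (hV : Measurable (Function.uncurry V)) {C : ℝ} (hC : 0 ≤ C)
    (hcol : ∀ y, ∫⁻ x, V x y ∂μ ≤ ENNReal.ofReal C) (p : P) :
    ∑ q, cellWeight μ cell V p q ≤ C * μ.real (cell p) := by
  have e : ∀ q, cellWeight μ cell V p q = cellWeight μ cell (fun x y => V y x) q p := by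
    intro q
    rw [cellWeight, cellWeight, lintegral_lintegral_swap hV.aemeasurable]
  rw [Finset.sum_congr rfl fun q _ => e q]
  exact sum_cellWeight_left_le hcell hdisj (V := fun x y => V y x)
    (hV.comp measurable_swap) hC hcol p

/-- As `h` has mean zero, K x y may be replaced by K x y - K x y₀ for a fixed y₀, and `V` dominates
this difference. The point y₀ is taken in `S`, where the bounds hold; it exists because the cell of
`p₀` has positive mass. -/
theorem decouples_of_kernel (hcell : ∀ p, MeasurableSet (cell p))
    (hdisj : Pairwise (Function.onFun Disjoint cell)) (hpos : ∀ p, 0 < μ.real (cell p))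
    {S : Set E} (hS : ∀ᵐ x ∂μ, x ∈ S) {K : E → E → 𝕜}
    (hK : StronglyMeasurable (Function.uncurry K)) {V : E → E → ℝ≥0∞}
    (hV : Measurable (Function.uncurry V)) {C B : ℝ} (hC : 0 ≤ C)
    (hrow : ∀ x, ∫⁻ y, V x y ∂μ ≤ ENNReal.ofReal C)
    (hcol : ∀ y, ∫⁻ x, V x y ∂μ ≤ ENNReal.ofReal C) {c : P → ι} {R : P → P → Prop}
    {b : P → P → 𝕜}
    (hb : ∀ p₀ p q, c p = c p₀ → R p₀ q → b p q = ∫ x in cell q, ∫ y in cell p, K x y ∂μ ∂μ)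
    (hB : ∀ p₀ p q, c p = c p₀ → R p₀ q → ∀ x ∈ cell q ∩ S, ∀ y ∈ cell p ∩ S, ‖K x y‖ ≤ B)
    (hsm : ∀ p₀ p q, c p = c p₀ → R p₀ q → ∀ x ∈ cell q ∩ S, ∀ y ∈ cell p ∩ S,
      ∀ y' ∈ cell p₀ ∩ S, ‖K x y - K x y'‖ₑ ≤ V x y) :
    Decouples (fun p => μ.real (cell p)) c b R C := by
  refine ⟨cellWeight μ cell V, fun p q => ENNReal.toReal_nonneg,
    sum_cellWeight_right_le hcell hdisj hV hC hcol,
    sum_cellWeight_left_le hcell hdisj hV hC hrow, fun p₀ h g hh hmean hg => ?_⟩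
  have hae : ∀ p, ∀ᵐ x ∂μ.restrict (cell p), x ∈ cell p ∩ S := fun p => by
    filter_upwards [ae_restrict_mem (hcell p), ae_restrict_of_ae hS] with x h1 h2 using ⟨h1, h2⟩
  obtain ⟨y₀, hy₀⟩ : ∃ y₀, y₀ ∈ cell p₀ ∩ S := by
    have hne : μ.restrict (cell p₀) ≠ 0 := by
      intro h0
      have := hpos p₀
      rw [Measure.restrict_eq_zero] at h0
      simp [Measure.real, h0] at this
    have : (ae (μ.restrict (cell p₀))).NeBot := ae_neBot.mpr hne
    exact (hae p₀).exists
  have hint : ∀ p q, c p = c p₀ → R p₀ q → ∀ x ∈ cell q ∩ S,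
      IntegrableOn (fun y => K x y) (cell p) μ := by
    intro p q hp hq x hx
    refine Measure.integrableOn_of_bounded (measure_ne_top _ _)
      (hK.comp_measurable measurable_prodMk_left).aestronglyMeasurable (M := B) ?_
    filter_upwards [hae p] with y hy using hB p₀ p q hp hq x hx y hy
  have hint₀ : ∀ q, R p₀ q → IntegrableOn (fun x => K x y₀) (cell q) μ := by
    intro q hq
    refine Measure.integrableOn_of_bounded (measure_ne_top _ _)
      (hK.comp_measurable measurable_prodMk_right).aestronglyMeasurable (M := B) ?_
    filter_upwards [hae q] with x hx using hB p₀ p₀ q rfl hq x hx y₀ hy₀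
  have hint₁ : ∀ p q, c p = c p₀ → R p₀ q →
      IntegrableOn (fun x => ∫ y in cell p, K x y ∂μ) (cell q) μ := by
    intro p q hp hq
    refine Measure.integrableOn_of_bounded (measure_ne_top _ _)
      hK.integral_prod_right.aestronglyMeasurable (M := B * μ.real (cell p)) ?_
    filter_upwards [hae q] with x hx
    refine norm_setIntegral_le_of_norm_le_const_ae (measure_lt_top _ _) ?_
    filter_upwards [hae p] with y hy using hB p₀ p q hp hq x hx y hy
  have hsub : ∀ p q, c p = c p₀ → R p₀ q →
      b p q - (μ.real (cell p) : 𝕜) * ∫ x in cell q, K x y₀ ∂μ =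
        ∫ x in cell q, ∫ y in cell p, (K x y - K x y₀) ∂μ ∂μ := by
    intro p q hp hq
    rw [hb p₀ p q hp hq, ← integral_const_mul, ← integral_sub (hint₁ p q hp hq)
      ((hint₀ q hq).const_mul _)]
    refine integral_congr_ae ?_
    filter_upwards [hae q] with x hx
    rw [integral_sub (hint p q hp hq x hx) (integrable_const _), setIntegral_const,
      RCLike.real_smul_eq_coe_mul]
  have hterm : ∀ p q, c p = c p₀ → R p₀ q →
      ‖b p q - (μ.real (cell p) : 𝕜) * ∫ x in cell q, K x y₀ ∂μ‖ ≤ cellWeight μ cell V p q := by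
    intro p q hp hq
    rw [hsub p q hp hq, cellWeight, ← toReal_enorm]
    refine ENNReal.toReal_mono (cellWeight_ne_top hrow p q) ?_
    refine (enorm_integral_le_lintegral_enorm _).trans (lintegral_mono_ae ?_)
    filter_upwards [hae q] with x hx
    refine (enorm_integral_le_lintegral_enorm _).trans (lintegral_mono_ae ?_)
    filter_upwards [hae p] with y hy using hsm p₀ p q hp hq x hx y hy y₀ hy₀
  have e : bilin b h g = ∑ p, ∑ q,
      (b p q - (μ.real (cell p) : 𝕜) * ∫ x in cell q, K x y₀ ∂μ) * h p * g q := by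
    have h1 : ∑ p, ∑ q, (μ.real (cell p) : 𝕜) * (∫ x in cell q, K x y₀ ∂μ) * h p * g q = 0 := by
      rw [Finset.sum_comm]
      refine Finset.sum_eq_zero fun q _ => ?_
      calc _ = (∑ p, (μ.real (cell p) : 𝕜) * h p) * ((∫ x in cell q, K x y₀ ∂μ) * g q) := by
            rw [Finset.sum_mul]
            exact Finset.sum_congr rfl fun p _ => by ring
        _ = 0 := by rw [hmean, zero_mul]
    rw [bilin, ← sub_zero (∑ p, ∑ q, b p q * h p * g q), ← h1, ← Finset.sum_sub_distrib]
    refine Finset.sum_congr rfl fun p _ => ?_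
    rw [← Finset.sum_sub_distrib]
    exact Finset.sum_congr rfl fun q _ => by ring
  rw [e]
  refine norm_sum_le_of_le _ fun p _ => norm_sum_le_of_le _ fun q _ => ?_
  rw [norm_mul, norm_mul, mul_assoc]
  by_cases hp : h p = 0
  · simp [hp]
  by_cases hq : g q = 0
  · simp [hq]
  exact mul_le_mul_of_nonneg_right (hterm p q (hh p hp) (hg q hq)) (by positivity)

/-- The form with the integrals of a kernel over products of cells is bounded if the kernel
satisfies the Schur test. -/
theorem norm_bilin_cellIntegral_le (hcell : ∀ p, MeasurableSet (cell p))
    (hdisj : Pairwise (Function.onFun Disjoint cell)) {κ : E → E → 𝕜}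
    (hκ : StronglyMeasurable (Function.uncurry κ)) {C : ℝ} (hC : 0 ≤ C)
    (hrow : ∀ x, ∫⁻ y, ‖κ x y‖ₑ ∂μ ≤ ENNReal.ofReal C)
    (hcol : ∀ y, ∫⁻ x, ‖κ x y‖ₑ ∂μ ≤ ENNReal.ofReal C) (f g : P → 𝕜) :
    ‖bilin (fun p q => ∫ x in cell q, ∫ y in cell p, κ x y ∂μ ∂μ) f g‖ ≤
      C * (√(normSq (fun p => μ.real (cell p)) f) * √(normSq (fun p => μ.real (cell p)) g)) := by
  refine le_trans ?_ (Finset.schur_test Finset.univ Finset.univ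
    (u := cellWeight μ cell fun x y => ‖κ x y‖ₑ) (fun p q => ENNReal.toReal_nonneg) hC
    (fun p _ => sum_cellWeight_right_le hcell hdisj (V := fun x y => ‖κ x y‖ₑ)
      hκ.enorm hC hcol p)
    (fun q _ => sum_cellWeight_left_le hcell hdisj (V := fun x y => ‖κ x y‖ₑ)
      hκ.enorm hC hrow q)
    (fun p => ‖f p‖) (fun q => ‖g q‖))
  refine norm_sum_le_of_le _ fun p _ => norm_sum_le_of_le _ fun q _ => ?_
  rw [norm_mul, norm_mul, mul_assoc]
  refine mul_le_mul_of_nonneg_right ?_ (by positivity)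
  rw [cellWeight, ← toReal_enorm]
  refine ENNReal.toReal_mono (cellWeight_ne_top hrow p q) ?_
  exact (enorm_integral_le_lintegral_enorm _).trans
    (lintegral_mono fun x => enorm_integral_le_lintegral_enorm _)

end CellKernel

/-! ### Step functions and the matrix of an operator. -/

section StepFunctions

variable {E : Type*} [MeasurableSpace E] {μ : Measure E} [IsFiniteMeasure μ] {P ι 𝕜 : Type*}
  [Fintype P] [DecidableEq ι] [RCLike 𝕜] {cell : P → Set E}

/-- The indicator function of a measurable set as an element of `L²`. -/
noncomputable def setLp (𝕜 : Type*) [RCLike 𝕜] (μ : Measure E) [IsFiniteMeasure μ] {Q : Set E}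
    (hQ : MeasurableSet Q) : Lp 𝕜 2 μ :=
  indicatorConstLp 2 hQ (measure_ne_top μ Q) (1 : 𝕜)

/-- The step function with the values `f p` on the cells. -/
noncomputable def stepLp (μ : Measure E) [IsFiniteMeasure μ] (hcell : ∀ p, MeasurableSet (cell p))
    (f : P → 𝕜) : Lp 𝕜 2 μ :=
  ∑ p, f p • setLp 𝕜 μ (hcell p)

theorem inner_setLp_setLp {Q Q' : Set E} (hQ : MeasurableSet Q) (hQ' : MeasurableSet Q') :
    inner 𝕜 (setLp 𝕜 μ hQ) (setLp 𝕜 μ hQ') = (μ.real (Q ∩ Q') : 𝕜) :=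
  L2.inner_indicatorConstLp_one_indicatorConstLp_one hQ hQ' _ _

theorem norm_setLp_sq {Q : Set E} (hQ : MeasurableSet Q) :
    ‖setLp 𝕜 μ hQ‖ ^ 2 = μ.real Q := by
  have h := inner_setLp_setLp (𝕜 := 𝕜) (μ := μ) hQ hQ
  rw [inner_self_eq_norm_sq_to_K, inter_self] at h
  exact_mod_cast h

theorem stepLp_add (hcell : ∀ p, MeasurableSet (cell p)) (f g : P → 𝕜) :
    stepLp μ hcell (f + g) = stepLp μ hcell f + stepLp μ hcell g := by
  simp [stepLp, add_smul, Finset.sum_add_distrib]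

/-- Conjugating `g` turns the sesquilinear inner product into a bilinear form, which can be
transposed without conjugates. -/
theorem inner_stepLp_stepLp (hcell : ∀ p, MeasurableSet (cell p))
    (T : Lp 𝕜 2 μ →L[𝕜] Lp 𝕜 2 μ) (f g : P → 𝕜) :
    inner 𝕜 (stepLp μ hcell fun p => (starRingEnd 𝕜) (g p)) (T (stepLp μ hcell f)) =
      bilin (fun p q => inner 𝕜 (setLp 𝕜 μ (hcell q)) (T (setLp 𝕜 μ (hcell p)))) f g := by
  simp only [stepLp, map_sum, map_smul, sum_inner, inner_sum, inner_smul_left, inner_smul_right,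
    RCLike.conj_conj, bilin]
  refine Finset.sum_congr rfl fun p _ => ?_
  rw [Finset.mul_sum]
  exact Finset.sum_congr rfl fun q _ => by ring

theorem norm_stepLp_sq (hcell : ∀ p, MeasurableSet (cell p))
    (hdisj : Pairwise (Function.onFun Disjoint cell)) (f : P → 𝕜) :
    ‖stepLp μ hcell f‖ ^ 2 = normSq (fun p => μ.real (cell p)) f := by
  classical
  have h := inner_stepLp_stepLp (μ := μ) hcell (ContinuousLinearMap.id 𝕜 _) f
    (fun p => (starRingEnd 𝕜) (f p))
  simp only [RCLike.conj_conj, ContinuousLinearMap.id_apply, inner_self_eq_norm_sq_to_K] at h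
  have e : bilin (fun p q => inner 𝕜 (setLp 𝕜 μ (hcell q)) (setLp 𝕜 μ (hcell p))) f
      (fun p => (starRingEnd 𝕜) (f p)) =
      ((normSq (fun p => μ.real (cell p)) f : ℝ) : 𝕜) := by
    rw [bilin, normSq]
    push_cast
    refine Finset.sum_congr rfl fun p _ => ?_
    rw [Finset.sum_eq_single_of_mem p (Finset.mem_univ p), inner_setLp_setLp, inter_self,
      mul_assoc, RCLike.mul_conj]
    intro q _ hqp
    rw [inner_setLp_setLp, disjoint_iff_inter_eq_empty.mp (hdisj hqp)]
    simp
  rw [e] at h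
  exact_mod_cast h

theorem norm_stepLp (hcell : ∀ p, MeasurableSet (cell p))
    (hdisj : Pairwise (Function.onFun Disjoint cell)) (f : P → 𝕜) :
    ‖stepLp μ hcell f‖ = √(normSq (fun p => μ.real (cell p)) f) := by
  rw [← norm_stepLp_sq hcell hdisj, Real.sqrt_sq (norm_nonneg _)]

theorem norm_stepLp_conj (hcell : ∀ p, MeasurableSet (cell p))
    (hdisj : Pairwise (Function.onFun Disjoint cell)) (f : P → 𝕜) :
    ‖stepLp μ hcell fun p => (starRingEnd 𝕜) (f p)‖ =
      √(normSq (fun p => μ.real (cell p)) f) := by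
  rw [norm_stepLp hcell hdisj]
  simp [normSq]

theorem norm_bilin_inner_le (hcell : ∀ p, MeasurableSet (cell p))
    (hdisj : Pairwise (Function.onFun Disjoint cell)) (T : Lp 𝕜 2 μ →L[𝕜] Lp 𝕜 2 μ)
    (f g : P → 𝕜) :
    ‖bilin (fun p q => inner 𝕜 (setLp 𝕜 μ (hcell q)) (T (setLp 𝕜 μ (hcell p)))) f g‖ ≤
      ‖T‖ * (√(normSq (fun p => μ.real (cell p)) f) * √(normSq (fun p => μ.real (cell p)) g)) := by
  rw [← inner_stepLp_stepLp, ← norm_stepLp hcell hdisj, ← norm_stepLp_conj hcell hdisj g]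
  refine (norm_inner_le_norm _ _).trans ?_
  calc _ ≤ ‖stepLp μ hcell fun p => (starRingEnd 𝕜) (g p)‖ * (‖T‖ * ‖stepLp μ hcell f‖) := by
        gcongr
        exact T.le_opNorm _
    _ = _ := by ring

open Classical in
theorem stepLp_coeFn (hcell : ∀ p, MeasurableSet (cell p)) (f : P → 𝕜) :
    ∀ᵐ x ∂μ, stepLp μ hcell f x = ∑ p, if x ∈ cell p then f p else 0 := by
  have h1 : ∀ᵐ x ∂μ, stepLp μ hcell f x = ∑ p, (f p • setLp 𝕜 μ (hcell p) : Lp 𝕜 2 μ) x := by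
    filter_upwards [Lp.coeFn_finsetSum Finset.univ fun p => f p • setLp 𝕜 μ (hcell p)]
      with x hx
    rw [stepLp, hx, Finset.sum_apply]
  have h2 : ∀ᵐ x ∂μ, ∀ p, (f p • setLp 𝕜 μ (hcell p) : Lp 𝕜 2 μ) x =
      if x ∈ cell p then f p else 0 := by
    rw [Filter.eventually_all]
    intro p
    filter_upwards [Lp.coeFn_smul (f p) (setLp 𝕜 μ (hcell p)),
      indicatorConstLp_coeFn (p := 2) (hs := hcell p) (hμs := measure_ne_top μ (cell p))
        (c := (1 : 𝕜))] with x hx hx'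
    rw [hx, Pi.smul_apply, setLp, hx', indicator]
    split_ifs <;> simp
  filter_upwards [h1, h2] with x hx1 hx2
  rw [hx1]
  exact Finset.sum_congr rfl fun p _ => hx2 p

theorem stepLp_apply_of_mem (hcell : ∀ p, MeasurableSet (cell p))
    (hdisj : Pairwise (Function.onFun Disjoint cell)) (f : P → 𝕜) :
    ∀ᵐ x ∂μ, ∀ p, x ∈ cell p → stepLp μ hcell f x = f p := by
  classical
  filter_upwards [stepLp_coeFn hcell f] with x hx p hp
  rw [hx, Finset.sum_eq_single_of_mem p (Finset.mem_univ p), if_pos hp]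
  intro q _ hqp
  rw [if_neg fun hq => disjoint_left.mp (hdisj hqp) hq hp]

/-- The indicator function of a union of cells is a step function. -/
theorem stepLp_ite (hcell : ∀ p, MeasurableSet (cell p))
    (hdisj : Pairwise (Function.onFun Disjoint cell)) (hcover : ∀ᵐ x ∂μ, ∃ p, x ∈ cell p)
    {Q : Set E} (hQ : MeasurableSet Q) {c : P → ι} {v : ι}
    (hcQ : ∀ p, ∀ x ∈ cell p, x ∈ Q ↔ c p = v) :
    stepLp μ hcell (fun p => if c p = v then (1 : 𝕜) else 0) = setLp 𝕜 μ hQ := by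
  refine Lp.ext ?_
  filter_upwards [stepLp_apply_of_mem hcell hdisj fun p => if c p = v then (1 : 𝕜) else 0, hcover,
    indicatorConstLp_coeFn (p := 2) (hs := hQ) (hμs := measure_ne_top μ Q) (c := (1 : 𝕜))]
    with x hx ⟨p, hp⟩ hx'
  rw [hx p hp, setLp, hx', indicator]
  simp only [hcQ p x hp]

/-- The testing condition for an operator implies the testing condition for its matrix. -/
theorem cellTesting_inner (hcell : ∀ p, MeasurableSet (cell p))
    (hdisj : Pairwise (Function.onFun Disjoint cell)) (hcover : ∀ᵐ x ∂μ, ∃ p, x ∈ cell p)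
    {c : P → ι} (Q : P → Set E) (hQ : ∀ p, MeasurableSet (Q p))
    (hcQ : ∀ p₀ p, ∀ x ∈ cell p, x ∈ Q p₀ ↔ c p = c p₀) (T : Lp 𝕜 2 μ →L[𝕜] Lp 𝕜 2 μ)
    {a : ℝ}
    (hT : ∀ p, ‖T (setLp 𝕜 μ (hQ p))‖ ≤ a * √(μ.real (Q p)))
    (hT' : ∀ p, ‖ContinuousLinearMap.adjoint T (setLp 𝕜 μ (hQ p))‖ ≤ a * √(μ.real (Q p))) :
    CellTesting (fun p => μ.real (cell p)) c
        (fun p q => inner 𝕜 (setLp 𝕜 μ (hcell q)) (T (setLp 𝕜 μ (hcell p)))) a ∧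
      CellTesting (fun p => μ.real (cell p)) c
        (fun p q => inner 𝕜 (setLp 𝕜 μ (hcell p)) (T (setLp 𝕜 μ (hcell q)))) a := by
  have hmass : ∀ p₀, cellMass (fun p => μ.real (cell p)) c p₀ = μ.real (Q p₀) := by
    intro p₀
    rw [← norm_setLp_sq (𝕜 := 𝕜) (hQ p₀), ← stepLp_ite hcell hdisj hcover (hQ p₀) (hcQ p₀),
      norm_stepLp_sq hcell hdisj, normSq, cellMass, Finset.sum_filter]
    refine Finset.sum_congr rfl fun p _ => ?_
    split_ifs <;> simp
  constructor
  · intro p₀ g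
    have h := inner_stepLp_stepLp (μ := μ) hcell T (fun p => if c p = c p₀ then 1 else 0) g
    rw [stepLp_ite hcell hdisj hcover (hQ p₀) (hcQ p₀)] at h
    have e : ∑ p with c p = c p₀, ∑ q,
        inner 𝕜 (setLp 𝕜 μ (hcell q)) (T (setLp 𝕜 μ (hcell p))) * g q =
        inner 𝕜 (stepLp μ hcell fun p => (starRingEnd 𝕜) (g p)) (T (setLp 𝕜 μ (hQ p₀))) := by
      rw [h, bilin, Finset.sum_filter]
      refine Finset.sum_congr rfl fun p _ => ?_
      split_ifs <;> simp
    rw [e, hmass]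
    refine (norm_inner_le_norm _ _).trans ?_
    rw [norm_stepLp_conj hcell hdisj]
    calc _ ≤ √(normSq (fun p => μ.real (cell p)) g) * (a * √(μ.real (Q p₀))) := by
          gcongr
          exact hT p₀
      _ = _ := by ring
  · intro p₀ g
    have h := inner_stepLp_stepLp (μ := μ) hcell T g (fun p => if c p = c p₀ then 1 else 0)
    have e1 : (fun p => (starRingEnd 𝕜) (if c p = c p₀ then (1 : 𝕜) else 0)) =
        fun p => if c p = c p₀ then (1 : 𝕜) else 0 := by
      ext p
      split_ifs <;> simp
    rw [e1, stepLp_ite hcell hdisj hcover (hQ p₀) (hcQ p₀)] at h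
    have e : ∑ p with c p = c p₀, ∑ q,
        inner 𝕜 (setLp 𝕜 μ (hcell p)) (T (setLp 𝕜 μ (hcell q))) * g q =
        inner 𝕜 (setLp 𝕜 μ (hQ p₀)) (T (stepLp μ hcell g)) := by
      rw [h, bilin, Finset.sum_filter]
      conv_rhs => rw [Finset.sum_comm]
      refine Finset.sum_congr rfl fun p _ => ?_
      split_ifs <;> simp
    -- Here `T` falls on an arbitrary step function, so it is moved to the cube, where the testing
    -- condition for the adjoint applies.
    rw [e, hmass, ← ContinuousLinearMap.adjoint_inner_left]
    refine (norm_inner_le_norm _ _).trans ?_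
    rw [norm_stepLp hcell hdisj, ← mul_assoc]
    gcongr
    exact hT' p₀

/-- A form that is bounded satisfies the testing condition. -/
theorem CellTesting.of_norm_bilin_le {w : P → ℝ} {b : P → P → 𝕜} {C : ℝ}
    (h : ∀ f g : P → 𝕜, ‖bilin b f g‖ ≤ C * (√(normSq w f) * √(normSq w g))) (c : P → ι) :
    CellTesting w c b C := by
  intro p₀ g
  have h1 := h (fun p => if c p = c p₀ then 1 else 0) g
  have e1 : bilin b (fun p => if c p = c p₀ then 1 else 0) g =
      ∑ p with c p = c p₀, ∑ q, b p q * g q := by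
    rw [bilin, Finset.sum_filter]
    refine Finset.sum_congr rfl fun p _ => ?_
    split_ifs <;> simp
  have e2 : normSq w (fun p => if c p = c p₀ then (1 : 𝕜) else 0) = cellMass w c p₀ := by
    rw [normSq, cellMass, Finset.sum_filter]
    refine Finset.sum_congr rfl fun p _ => ?_
    split_ifs <;> simp
  rwa [e1, e2] at h1

theorem CellTesting.sub {w : P → ℝ} {b b' : P → P → 𝕜} {a a' : ℝ} {c : P → ι}
    (h : CellTesting w c b a) (h' : CellTesting w c b' a') :
    CellTesting w c (fun p q => b p q - b' p q) (a + a') := by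
  intro p₀ g
  simp only [sub_mul, Finset.sum_sub_distrib, add_mul]
  exact (norm_sub_le _ _).trans (add_le_add (h p₀ g) (h' p₀ g))

end StepFunctions

/-! ### The kernel representation on separated sets. -/

section Operator

variable {d : ℕ} {𝕜 : Type*} [RCLike 𝕜] {μ : Measure (EuclideanSpace ℝ (Fin d))}
  [IsFiniteMeasure μ] {k : EuclideanSpace ℝ (Fin d) → EuclideanSpace ℝ (Fin d) → 𝕜}
  {T : Lp 𝕜 2 μ →L[𝕜] Lp 𝕜 2 μ}

theorem IsCZOperator.apply_setLp (hT : IsCZOperator μ k T)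
    {F : Set (EuclideanSpace ℝ (Fin d))} (hF : MeasurableSet F) :
    ∀ᵐ x ∂μ, x ∉ closure F → T (setLp 𝕜 μ hF) x = ∫ y in F, k x y ∂μ := by
  have hcoe : setLp 𝕜 μ hF =ᵐ[μ] F.indicator fun _ => (1 : 𝕜) := indicatorConstLp_coeFn
  have hset : {y | setLp 𝕜 μ hF y ≠ 0} =ᵐ[μ] F := by
    filter_upwards [hcoe] with y hy
    refine propext ?_
    change setLp 𝕜 μ hF y ≠ 0 ↔ y ∈ F
    rw [hy]
    simp
  filter_upwards [hT (setLp 𝕜 μ hF)] with x hx hxF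
  rw [hx, ← integral_indicator hF]
  · refine integral_congr_ae ?_
    filter_upwards [hcoe] with y hy
    rw [hy]
    by_cases h : y ∈ F <;> simp [h]
  · rw [essSupport, Measure.restrict_congr_set hset]
    exact fun h => hxF (Measure.support_restrict_subset h).1

/-- Positive separation keeps `G` off the closure of `F`, hence off the essential support of its
indicator. -/
theorem IsCZOperator.inner_setLp (hT : IsCZOperator μ k T)
    {F G : Set (EuclideanSpace ℝ (Fin d))} (hF : MeasurableSet F) (hG : MeasurableSet G)
    {s : ℝ} (hs : 0 < s) (hFG : ∀ x ∈ G, ∀ y ∈ F, s ≤ dist x y) :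
    inner 𝕜 (setLp 𝕜 μ hG) (T (setLp 𝕜 μ hF)) = ∫ x in G, ∫ y in F, k x y ∂μ ∂μ := by
  rw [setLp, L2.inner_indicatorConstLp_one]
  refine setIntegral_congr_ae hG ?_
  filter_upwards [hT.apply_setLp hF] with x hx hxG
  refine hx fun hcl => ?_
  obtain ⟨y, hy, hxy⟩ := Metric.mem_closure_iff.mp hcl s hs
  exact absurd (hFG x hxG y hy) (not_le.mpr hxy)

end Operator

/-! ### Geometry of the shifted dyadic grids. -/

section Grid

variable {d : ℕ}

/-- The point with the coordinates `-R + η * y i`. -/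
noncomputable def gridPoint (R η : ℝ) (y : Fin d → ℝ) : EuclideanSpace ℝ (Fin d) :=
  WithLp.toLp 2 fun i => -R + η * y i

/-- The cells of side length `η` of the grid with corner `(-R, …, -R)`. -/
def gridCell (R η : ℝ) (z : Fin d → ℕ) : Set (EuclideanSpace ℝ (Fin d)) :=
  cube (gridPoint R η fun i => z i) η

/-- The cubes of side length `2 ^ n * η` of the grid shifted by `-a`. -/
def shiftedCube (R η : ℝ) (a : Fin d → ℕ) (n : ℕ) (v : Fin d → ℕ) :
    Set (EuclideanSpace ℝ (Fin d)) :=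
  cube (gridPoint R η fun i => 2 ^ n * v i - a i) (η * 2 ^ n)

theorem measurableSet_gridCell (R η : ℝ) (z : Fin d → ℕ) : MeasurableSet (gridCell R η z) :=
  measurableSet_cube _ _

theorem measurableSet_shiftedCube (R η : ℝ) (a : Fin d → ℕ) (n : ℕ) (v : Fin d → ℕ) :
    MeasurableSet (shiftedCube R η a n v) :=
  measurableSet_cube _ _

theorem mem_cube_gridPoint {R η : ℝ} (hη : 0 < η) {y : Fin d → ℝ} {l : ℝ}
    {x : EuclideanSpace ℝ (Fin d)} :
    x ∈ cube (gridPoint R η y) (η * l) ↔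
      ∀ i, y i ≤ (x i + R) / η ∧ (x i + R) / η < y i + l := by
  refine forall_congr' fun i => ?_
  rw [mem_Ico, le_div_iff₀ hη, div_lt_iff₀ hη, gridPoint]
  change -R + η * y i ≤ x i ∧ x i < -R + η * y i + η * l ↔ _
  constructor <;> rintro ⟨h1, h2⟩ <;> constructor <;> linarith

theorem mem_gridCell {R η : ℝ} (hη : 0 < η) {z : Fin d → ℕ} {x : EuclideanSpace ℝ (Fin d)} :
    x ∈ gridCell R η z ↔ ∀ i, (z i : ℝ) ≤ (x i + R) / η ∧ (x i + R) / η < z i + 1 := by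
  have h := mem_cube_gridPoint (R := R) hη (y := fun i => (z i : ℝ)) (l := 1) (x := x)
  rwa [mul_one] at h

theorem disjoint_gridCell {R η : ℝ} (hη : 0 < η) {z z' : Fin d → ℕ} (h : z ≠ z') :
    Disjoint (gridCell R η z) (gridCell R η z') := by
  rw [disjoint_left]
  intro x hx hx'
  refine h (funext fun i => ?_)
  have h1 := (mem_gridCell hη).mp hx i
  have h2 := (mem_gridCell hη).mp hx' i
  have h3 : (z i : ℝ) < z' i + 1 := h1.1.trans_lt h2.2
  have h4 : (z' i : ℝ) < z i + 1 := h2.1.trans_lt h1.2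
  norm_cast at h3 h4
  omega

/-- Shifts are integer multiples of the mesh, so every cube of the shifted grid contains or avoids
each small cell entirely, and integer indices decide which. -/
theorem mem_shiftedCube_iff {R η : ℝ} (hη : 0 < η) {P : Type*} {pos : P → Fin d → ℕ}
    {a : Fin d → ℕ} {n : ℕ} {v : Fin d → ℕ} {p : P} {x : EuclideanSpace ℝ (Fin d)}
    (hx : x ∈ gridCell R η (pos p)) :
    x ∈ shiftedCube R η a n v ↔ cellIdx pos a n p = v := by
  rw [shiftedCube, mem_cube_gridPoint hη, funext_iff]
  refine forall_congr' fun i => ?_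
  obtain ⟨h1, h2⟩ := (mem_gridCell hη).mp hx i
  rw [cellIdx, Nat.div_eq_iff (by positivity)]
  have hpow : 0 < 2 ^ n := by positivity
  constructor
  · rintro ⟨h3, h4⟩
    have h5 : (2 ^ n * v i : ℝ) < pos p i + a i + 1 := by linarith
    have h6 : (pos p i + a i : ℝ) < 2 ^ n * v i + 2 ^ n := by linarith
    norm_cast at h5 h6
    constructor
    · rw [mul_comm]; omega
    · rw [mul_comm]; omega
  · rintro ⟨h3, h4⟩
    have h5 : 2 ^ n * v i ≤ pos p i + a i := by rw [mul_comm]; exact h3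
    have h6 : pos p i + a i + 1 ≤ 2 ^ n * v i + 2 ^ n := by rw [mul_comm (2 ^ n)]; omega
    have h5' : (2 ^ n * v i : ℝ) ≤ pos p i + a i := by exact_mod_cast h5
    have h6' : (pos p i + a i + 1 : ℝ) ≤ 2 ^ n * v i + 2 ^ n := by exact_mod_cast h6
    constructor <;> linarith

theorem coord_mem_of_mem_gridCell {R η : ℝ} (hη : 0 < η) {P : Type*} {pos : P → Fin d → ℕ}
    (a : Fin d → ℕ) (n : ℕ) {p : P} {x : EuclideanSpace ℝ (Fin d)}
    (hx : x ∈ gridCell R η (pos p)) (i : Fin d) :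
    η * 2 ^ n * cellIdx pos a n p i ≤ x i + R + η * a i ∧
      x i + R + η * a i < η * 2 ^ n * (cellIdx pos a n p i + 1) := by
  have h := (mem_cube_gridPoint hη).mp ((mem_shiftedCube_iff (a := a) (n := n) hη hx).mpr rfl) i
  rw [le_div_iff₀ hη, div_lt_iff₀ hη] at h
  constructor <;> nlinarith [h.1, h.2]

theorem EuclideanSpace.dist_le_of_forall_abs_sub_le {x y : EuclideanSpace ℝ (Fin d)} {l : ℝ}
    (hl : 0 ≤ l) (h : ∀ i, |x i - y i| ≤ l) : dist x y ≤ d * l := by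
  rw [EuclideanSpace.dist_eq]
  refine Real.sqrt_le_iff.mpr ⟨by positivity, ?_⟩
  calc ∑ i, dist (x i) (y i) ^ 2 ≤ ∑ _i : Fin d, l ^ 2 := by
        gcongr with i
        exact h i
    _ = d * l ^ 2 := by simp
    _ ≤ (d * l) ^ 2 := by
        rw [mul_pow]
        gcongr
        rcases Nat.eq_zero_or_pos d with h0 | h0
        · simp [h0]
        · exact_mod_cast Nat.le_self_pow two_ne_zero d

theorem EuclideanSpace.abs_sub_le_dist (x y : EuclideanSpace ℝ (Fin d)) (i : Fin d) :
    |x i - y i| ≤ dist x y := by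
  rw [EuclideanSpace.dist_eq]
  refine Real.le_sqrt_of_sq_le ?_
  have := Finset.single_le_sum (f := fun i => dist (x i) (y i) ^ 2) (fun i _ => sq_nonneg _)
    (Finset.mem_univ i)
  simpa [Real.dist_eq] using this

theorem dist_le_of_cellIdx_eq {R η : ℝ} (hη : 0 < η) {P : Type*} {pos : P → Fin d → ℕ}
    {a : Fin d → ℕ} {n : ℕ} {p q : P} (h : cellIdx pos a n p = cellIdx pos a n q)
    {x y : EuclideanSpace ℝ (Fin d)} (hx : x ∈ gridCell R η (pos p))
    (hy : y ∈ gridCell R η (pos q)) : dist x y ≤ d * (η * 2 ^ n) := by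
  refine EuclideanSpace.dist_le_of_forall_abs_sub_le (by positivity) fun i => ?_
  have h1 := coord_mem_of_mem_gridCell hη a n hx i
  have h2 := coord_mem_of_mem_gridCell hη a n hy i
  rw [h] at h1
  rw [abs_le]
  constructor <;> nlinarith [h1.1, h1.2, h2.1, h2.2]

/-- An index gap of σ + 1 leaves σ full cells in between. -/
theorem le_dist_of_cellIdx_add_le {R η : ℝ} (hη : 0 < η) {P : Type*} {pos : P → Fin d → ℕ}
    {a : Fin d → ℕ} {n σ : ℕ} {p q : P} {i : Fin d}
    (h : cellIdx pos a n p i + σ + 1 ≤ cellIdx pos a n q i)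
    {x y : EuclideanSpace ℝ (Fin d)} (hx : x ∈ gridCell R η (pos p))
    (hy : y ∈ gridCell R η (pos q)) : σ * (η * 2 ^ n) ≤ dist x y := by
  refine le_trans ?_ (EuclideanSpace.abs_sub_le_dist x y i)
  have h1 := coord_mem_of_mem_gridCell hη a n hx i
  have h2 := coord_mem_of_mem_gridCell hη a n hy i
  have h3 : (cellIdx pos a n p i + σ + 1 : ℝ) ≤ cellIdx pos a n q i := by exact_mod_cast h
  have h4 : 0 < η * 2 ^ n := by positivity
  have h5 := mul_le_mul_of_nonneg_left h3 h4.le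
  rw [abs_sub_comm]
  refine le_trans ?_ (le_abs_self _)
  nlinarith [h1.2, h2.1]

theorem le_dist_of_cellIdx_far {R η : ℝ} (hη : 0 < η) {P : Type*} {pos : P → Fin d → ℕ}
    {a : Fin d → ℕ} {n σ : ℕ} {p q : P}
    (h : ∃ i, cellIdx pos a n p i + σ + 1 ≤ cellIdx pos a n q i ∨
      cellIdx pos a n q i + σ + 1 ≤ cellIdx pos a n p i)
    {x y : EuclideanSpace ℝ (Fin d)} (hx : x ∈ gridCell R η (pos q))
    (hy : y ∈ gridCell R η (pos p)) : σ * (η * 2 ^ n) ≤ dist x y := by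
  obtain ⟨i, h | h⟩ := h
  · rw [dist_comm]
    exact le_dist_of_cellIdx_add_le hη h hy hx
  · exact le_dist_of_cellIdx_add_le hη h hx hy

theorem exists_cellIdx_far_of_not_nearIdx {κ : ℕ} {v v' : Fin d → ℕ} (h : ¬NearIdx κ v v') :
    ∃ i, v i + κ + 1 ≤ v' i ∨ v' i + κ + 1 ≤ v i := by
  simp only [NearIdx, not_forall] at h
  obtain ⟨i, hi⟩ := h
  exact ⟨i, by omega⟩

/-- In a coordinate where the ancestors differ, `q` lies beyond one end of the block of 2 ^ j
indices below the ancestor of `p`, and goodness keeps `p` at distance 2 ^ (j / 2) from both ends. -/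
theorem IsGoodCell.exists_cellIdx_far {P : Type*} {r M : ℕ} {pos : P → Fin d → ℕ}
    {a : Fin d → ℕ} {n j : ℕ} {p q : P} (hp : IsGoodCell r M pos a n p) (hj : r ≤ j)
    (hjM : n + j ≤ M) (h : cellIdx pos a (n + j) q ≠ cellIdx pos a (n + j) p) :
    ∃ i, cellIdx pos a n p i + 2 ^ (j / 2) + 1 ≤ cellIdx pos a n q i ∨
      cellIdx pos a n q i + 2 ^ (j / 2) + 1 ≤ cellIdx pos a n p i := by
  obtain ⟨i, hi⟩ := Function.ne_iff.mp h
  obtain ⟨h1, h2⟩ := hp j hj hjM i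
  refine ⟨i, ?_⟩
  have e : ∀ q, cellIdx pos a (n + j) q i = cellIdx pos a n q i / 2 ^ j := fun q => by
    simp only [cellIdx]
    rw [pow_add, ← Nat.div_div_eq_div_mul]
  rw [e, e] at hi
  have h3 := Nat.div_add_mod (cellIdx pos a n p i) (2 ^ j)
  have h4 := Nat.div_add_mod (cellIdx pos a n q i) (2 ^ j)
  have h5 : cellIdx pos a n q i % 2 ^ j < 2 ^ j := Nat.mod_lt _ (by positivity)
  rcases Nat.lt_or_gt_of_ne hi with hlt | hlt
  · right
    have := Nat.mul_le_mul_left (2 ^ j) hlt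
    rw [Nat.mul_succ] at this
    omega
  · left
    have := Nat.mul_le_mul_left (2 ^ j) hlt
    rw [Nat.mul_succ] at this
    omega

theorem exists_mem_gridCell {R η : ℝ} (hη : 0 < η) {M : ℕ} (hM : η * 2 ^ M = 2 * R)
    {x : EuclideanSpace ℝ (Fin d)} (hx : x ∈ ball 0 R) :
    ∃ z : Fin d → Fin (2 ^ M), x ∈ gridCell R η fun i => (z i : ℕ) := by
  have hxi : ∀ i, |x i| < R := fun i => by
    have := EuclideanSpace.abs_sub_le_dist x 0 i
    simp only [PiLp.zero_apply, sub_zero] at this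
    exact this.trans_lt hx
  have h0 : ∀ i, 0 ≤ (x i + R) / η := fun i =>
    div_nonneg (by linarith [(abs_lt.mp (hxi i)).1]) hη.le
  have h1 : ∀ i, ⌊(x i + R) / η⌋₊ < 2 ^ M := fun i => by
    rw [Nat.floor_lt (h0 i), div_lt_iff₀ hη]
    push_cast
    linarith [(abs_lt.mp (hxi i)).2]
  refine ⟨fun i => ⟨_, h1 i⟩, (mem_gridCell hη).mpr fun i => ?_⟩
  exact ⟨Nat.floor_le (h0 i), Nat.lt_floor_add_one _⟩

/-- Cells of measure zero are dropped because the tree argument divides by masses; being finitely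
many, they form a null set. -/
theorem ae_exists_mem_gridCell {μ : Measure (EuclideanSpace ℝ (Fin d))} [IsFiniteMeasure μ]
    {R η : ℝ} (hη : 0 < η) {M : ℕ} (hM : η * 2 ^ M = 2 * R) (hR : μ.support ⊆ ball 0 R) :
    ∀ᵐ x ∂μ, ∃ p : {z : Fin d → Fin (2 ^ M) // 0 < μ.real (gridCell R η fun i => (z i : ℕ))},
      x ∈ gridCell R η fun i => (p.1 i : ℕ) := by
  have h1 : ∀ᵐ x ∂μ, ∀ z : Fin d → Fin (2 ^ M),
      ¬0 < μ.real (gridCell R η fun i => (z i : ℕ)) → x ∉ gridCell R η fun i => (z i : ℕ) := by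
    rw [Filter.eventually_all]
    intro z
    by_cases hz : 0 < μ.real (gridCell R η fun i => (z i : ℕ))
    · exact .of_forall fun x h => absurd hz h
    · have h2 : μ (gridCell R η fun i => (z i : ℕ)) = 0 := by
        rw [← measureReal_eq_zero_iff]
        exact le_antisymm (not_lt.mp hz) measureReal_nonneg
      filter_upwards [measure_eq_zero_iff_ae_notMem.mp h2] with x hx _ using hx
  filter_upwards [h1, Measure.support_mem_ae] with x hx hxS
  obtain ⟨z, hz⟩ := exists_mem_gridCell hη hM (hR hxS)
  by_cases h : 0 < μ.real (gridCell R η fun i => (z i : ℕ))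
  · exact ⟨⟨z, h⟩, hz⟩
  · exact absurd hz (hx z h)

end Grid

/-! ### Approximation by step functions. -/

section Density

/-- Step functions on fine partitions are dense in `L²`. -/
theorem exists_norm_sub_stepLp_le {E 𝕜 : Type*} [MetricSpace E] [MeasurableSpace E] [BorelSpace E]
    [LocallyCompactSpace E] [RCLike 𝕜] {μ : Measure E} [IsProbabilityMeasure μ] [μ.Regular]
    (F : Lp 𝕜 2 μ) {ε : ℝ} (hε : 0 < ε) :
    ∃ ρ > 0, ∀ (P : Type) [Fintype P] (cell : P → Set E) (hcell : ∀ p, MeasurableSet (cell p)),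
      Pairwise (Function.onFun Disjoint cell) → (∀ᵐ x ∂μ, ∃ p, x ∈ cell p) →
      (∀ p, (cell p).Nonempty) → (∀ p, ∀ x ∈ cell p, ∀ y ∈ cell p, dist x y < ρ) →
      ∃ f : P → 𝕜, ‖F - stepLp μ hcell f‖ ≤ ε := by
  obtain ⟨g, hgc, hg, hgcont, hgm⟩ := (Lp.memLp F).exists_hasCompactSupport_eLpNorm_sub_le
    (by simp) (ε := ENNReal.ofReal (ε / 2)) (by simpa using hε)
  obtain ⟨ρ, hρ, hu⟩ := Metric.uniformContinuous_iff.mp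
    (hgc.uniformContinuous_of_continuous hgcont) (ε / 2) (by positivity)
  refine ⟨ρ, hρ, fun P _ cell hcell hdisj hcover hne hsmall => ?_⟩
  choose y hy using hne
  refine ⟨fun p => g (y p), ?_⟩
  have h1 : ‖F - hgm.toLp g‖ ≤ ε / 2 := by
    rw [Lp.norm_def]
    refine ENNReal.toReal_le_of_le_ofReal (by positivity) ?_
    rw [← Lp.toLp_coeFn F (Lp.memLp F), ← MemLp.toLp_sub, eLpNorm_congr_ae (MemLp.coeFn_toLp _)]
    exact hg
  have h2 : ‖hgm.toLp g - stepLp μ hcell fun p => g (y p)‖ ≤ ε / 2 := by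
    -- On a probability space a uniform bound is an L² bound.
    refine (Lp.norm_le_of_ae_bound (C := ε / 2) (by positivity) ?_).trans
      (by simp [measureUnivNNReal])
    filter_upwards [Lp.coeFn_sub (hgm.toLp g) (stepLp μ hcell fun p => g (y p)), hgm.coeFn_toLp,
      stepLp_apply_of_mem hcell hdisj fun p => g (y p), hcover] with x hx hx1 hx2 ⟨p, hp⟩
    rw [hx, Pi.sub_apply, hx1, hx2 p hp, ← dist_eq_norm]
    exact (hu (hsmall p x hp _ (hy p))).le
  calc _ = ‖(F - hgm.toLp g) + (hgm.toLp g - stepLp μ hcell fun p => g (y p))‖ := by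
        rw [sub_add_sub_cancel]
    _ ≤ ε / 2 + ε / 2 := (norm_add_le _ _).trans (add_le_add h1 h2)
    _ = ε := by ring

end Density

/-! ### Decoupling for the far kernel and boundedness of the local one. -/

section FarKernel

theorem integrable_prod_restrict_of_bound {E 𝕜 : Type*} [MeasurableSpace E] [RCLike 𝕜]
    {μ : Measure E} [IsFiniteMeasure μ] {κ : E → E → 𝕜}
    (hκ : StronglyMeasurable (Function.uncurry κ)) {F G : Set E} (hF : MeasurableSet F)
    (hG : MeasurableSet G) {B : ℝ} (hB : ∀ x ∈ G, ∀ y ∈ F, ‖κ x y‖ ≤ B) :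
    Integrable (Function.uncurry κ) ((μ.restrict G).prod (μ.restrict F)) := by
  refine Integrable.of_bound hκ.aestronglyMeasurable B ?_
  rw [Measure.prod_restrict]
  filter_upwards [ae_restrict_mem (hG.prod hF)] with z hz using hB z.1 hz.1 z.2 hz.2

variable {E : Type*} [MetricSpace E] {𝕜 : Type*} [RCLike 𝕜] {S : Set E} {δ : E → ℝ} {m C τ : ℝ}
  {k : E → E → 𝕜}

theorem IsScaledKernel.norm_le_of_le_dist (hk : IsScaledKernel S δ m C τ k) (hC : 0 ≤ C)
    (hm : 0 < m) {s : ℝ} (hs : 0 < s) {x y : E} (hx : x ∈ S) (hy : y ∈ S) (h : s ≤ dist x y) :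
    ‖k x y‖ ≤ C / s ^ m := by
  refine (hk.size x hx y hy (dist_pos.mp (hs.trans_le h))).trans ?_
  gcongr

theorem IsScaledKernel.norm_farKernel_le_of_le_dist (hk : IsScaledKernel S δ m C τ k) (hC : 0 ≤ C)
    (hm : 0 < m) {s : ℝ} (hs : 0 < s) {x y : E} (h : s ≤ dist x y) :
    ‖farKernel S δ k x y‖ ≤ C / s ^ m := by
  by_cases hxy : x ∈ S ∧ y ∈ S
  · exact (norm_farKernel_le x y).trans (hk.norm_le_of_le_dist hC hm hs hxy.1 hxy.2 h)
  · rw [farKernel, if_neg fun h => hxy ⟨h.1, h.2.1⟩, norm_zero]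
    positivity

theorem IsScaledKernel.norm_localKernel_le_of_le_dist (hk : IsScaledKernel S δ m C τ k)
    (hC : 0 ≤ C) (hm : 0 < m) {s : ℝ} (hs : 0 < s) {x y : E} (h : s ≤ dist x y) :
    ‖localKernel S δ k x y‖ ≤ C / s ^ m := by
  by_cases hxy : x ∈ S ∧ y ∈ S
  · exact (_root_.norm_localKernel_le x y).trans
      (hk.norm_le_of_le_dist hC hm hs hxy.1 hxy.2 h)
  · rw [localKernel, if_neg fun h => hxy ⟨h.1, h.2.1⟩, norm_zero]
    positivity

variable [MeasurableSpace E] [BorelSpace E] [SecondCountableTopology E] {μ : Measure E}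
  [IsFiniteMeasure μ]

/-- Identifies the separated entries that remain after subtraction of the local matrix. Separation
makes both parts bounded, hence integrable on the product. -/
theorem IsScaledKernel.integral_sub_localKernel (hk : IsScaledKernel S δ m C τ k) (hC : 0 ≤ C)
    (hm : 0 < m) (hτ : 0 < τ) (hS : IsClosed S) (hSμ : ∀ᵐ x ∂μ, x ∈ S) {F G : Set E}
    (hF : MeasurableSet F) (hG : MeasurableSet G) {s : ℝ} (hs : 0 < s)
    (hFG : ∀ x ∈ G, ∀ y ∈ F, s ≤ dist x y) :
    (∫ x in G, ∫ y in F, k x y ∂μ ∂μ) - ∫ x in G, ∫ y in F, localKernel S δ k x y ∂μ ∂μ =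
      ∫ x in G, ∫ y in F, farKernel S δ k x y ∂μ ∂μ := by
  have hf : Integrable (Function.uncurry (farKernel S δ k)) ((μ.restrict G).prod (μ.restrict F)) :=
    integrable_prod_restrict_of_bound (hk.stronglyMeasurable_farKernel hC hm hτ hS) hF hG
      fun x hx y hy => hk.norm_farKernel_le_of_le_dist hC hm hs (hFG x hx y hy)
  have hl : Integrable (Function.uncurry (localKernel S δ k))
      ((μ.restrict G).prod (μ.restrict F)) :=
    integrable_prod_restrict_of_bound (hk.stronglyMeasurable_localKernel hC hm hτ hS) hF hG
      fun x hx y hy => hk.norm_localKernel_le_of_le_dist hC hm hs (hFG x hx y hy)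
  have e : ∫ x in G, ∫ y in F, k x y ∂μ ∂μ =
      ∫ x in G, ∫ y in F, (farKernel S δ k x y + localKernel S δ k x y) ∂μ ∂μ := by
    refine integral_congr_ae ?_
    filter_upwards [ae_restrict_mem hG, ae_restrict_of_ae hSμ] with x hx hxS
    refine integral_congr_ae ?_
    filter_upwards [ae_restrict_mem hF, ae_restrict_of_ae hSμ] with y hy hyS
    rw [farKernel_add_localKernel hxS hyS (dist_pos.mp (hs.trans_le (hFG x hx y hy)))]
  rw [e, integral_integral (f := fun x y => farKernel S δ k x y + localKernel S δ k x y)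
    (hf.add hl), integral_integral hf, integral_integral hl, sub_eq_iff_eq_add]
  exact integral_add hf hl

theorem IsScaledKernel.integral_farKernel_swap (hk : IsScaledKernel S δ m C τ k) (hC : 0 ≤ C)
    (hm : 0 < m) (hτ : 0 < τ) (hS : IsClosed S) {F G : Set E}
    (hF : MeasurableSet F) (hG : MeasurableSet G) {s : ℝ} (hs : 0 < s)
    (hFG : ∀ x ∈ G, ∀ y ∈ F, s ≤ dist x y) :
    ∫ x in G, ∫ y in F, farKernel S δ k x y ∂μ ∂μ =
      ∫ y in F, ∫ x in G, farKernel S δ (fun x y => k y x) y x ∂μ ∂μ := by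
  rw [integral_integral_swap (integrable_prod_restrict_of_bound
    (hk.stronglyMeasurable_farKernel hC hm hτ hS) hF hG
      fun x hx y hy => hk.norm_farKernel_le_of_le_dist hC hm hs (hFG x hx y hy))]
  simp only [farKernel_swap]

/-- The matrix of a suppressed kernel on the cells of a partition at distance `s` from cells of
diameter at most `L`. -/
theorem IsScaledKernel.decouples {P ι : Type*} [Fintype P] [DecidableEq ι] {cell : P → Set E}
    (hk : IsScaledKernel S δ m C τ k) (hkb : ∀ x ∈ S, ∀ y ∈ S, δ y ^ m * ‖k x y‖ ≤ 1)
    (hC : 0 ≤ C) (hm : 0 < m) (hτ : 0 < τ) (hτ1 : τ ≤ 1) (hS : IsClosed S)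
    (hSμ : ∀ᵐ x ∂μ, x ∈ S)
    (hgrow : ∀ x r, δ x < r → μ (ball x r) ≤ ENNReal.ofReal (r ^ m))
    (hcell : ∀ p, MeasurableSet (cell p)) (hdisj : Pairwise (Function.onFun Disjoint cell))
    (hpos : ∀ p, 0 < μ.real (cell p)) {c : P → ι} {R : P → P → Prop} {b : P → P → 𝕜}
    {L s C' : ℝ} (hL : 0 ≤ L) (hs : 0 < s) (hLs : L ≤ s / 2)
    (hC' : 5 * C * (32 ^ m / (1 - 2 ^ (-τ))) * (L / s) ^ τ ≤ C')
    (hb : ∀ p₀ p q, c p = c p₀ → R p₀ q →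
      b p q = ∫ x in cell q, ∫ y in cell p, farKernel S δ k x y ∂μ ∂μ)
    (hdiam : ∀ p p₀, c p = c p₀ → ∀ y ∈ cell p, ∀ y' ∈ cell p₀, dist y y' ≤ L)
    (hsep : ∀ p₀ p q, c p = c p₀ → R p₀ q → ∀ x ∈ cell q, ∀ y ∈ cell p, s ≤ dist x y) :
    Decouples (fun p => μ.real (cell p)) c b R C' := by
  have hΓ : (0 : ℝ) ≤ 32 ^ m / (1 - 2 ^ (-τ)) :=
    div_nonneg (by positivity) (sub_nonneg.mpr
      (Real.rpow_le_one_of_one_le_of_nonpos (by norm_num) (by linarith)))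
  have hC0 : 0 ≤ C' := le_trans (by positivity) hC'
  have hD : 0 ≤ 5 * C * L ^ τ := by positivity
  -- The displacement inside a cell contributes L ^ τ and the integral beyond distance s contributes
  -- s ^ (-τ), whence the factor (L / s) ^ τ.
  have hrow : ∀ x, ∫⁻ y, truncWeight δ m τ (5 * C * L ^ τ) s x y ∂μ ≤ ENNReal.ofReal C' := by
    intro x
    refine (lintegral_truncWeight_le hk.nonneg hm hτ hD hs x (hgrow x)).trans
      (ENNReal.ofReal_le_ofReal (le_trans (le_of_eq ?_) hC'))
    rw [Real.div_rpow hL hs.le, Real.rpow_neg hs.le]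
    ring
  refine decouples_of_kernel hcell hdisj hpos hSμ
    (hk.stronglyMeasurable_farKernel hC hm hτ hS)
    (measurable_truncWeight hk.continuous_scale (5 * C * L ^ τ) s) hC0 hrow
    (fun y => by simp only [truncWeight_comm (5 * C * L ^ τ) s _ y]; exact hrow y)
    (B := C / s ^ m) hb
    (fun p₀ p q hp hR x hx y hy =>
      hk.norm_farKernel_le_of_le_dist hC hm hs (hsep p₀ p q hp hR x hx.1 y hy.1)) ?_
  intro p₀ p q hp hR x hx y hy y' hy'
  have hxy : s ≤ dist x y := hsep p₀ p q hp hR x hx.1 y hy.1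
  have hyy : dist y y' ≤ L := hdiam p p₀ hp y hy.1 y' hy'.1
  -- Regularity is needed in the second variable, so the estimate is applied to the transposed
  -- kernel; L ≤ s / 2 makes the displacement admissible.
  have h := (hk.swap hkb).norm_farKernel_sub_le hτ1 hy.2 hy'.2 hx.2
    (dist_pos.mp (by rw [dist_comm]; linarith)) (by rw [dist_comm y x]; linarith)
  rw [farKernel_swap (k := k) y x, farKernel_swap (k := k) y' x, smoothWeight_comm] at h
  rw [truncWeight, if_pos hxy, ← ofReal_norm]
  refine ENNReal.ofReal_le_ofReal (h.trans ?_)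
  have := smoothWeight_nonneg (δ := δ) (m := m) (τ := τ) x y
  gcongr

theorem IsScaledKernel.norm_bilin_localKernel_le {P : Type*} [Fintype P] {cell : P → Set E}
    (hk : IsScaledKernel S δ m C τ k) (hkb : ∀ x ∈ S, ∀ y ∈ S, δ y ^ m * ‖k x y‖ ≤ 1)
    (hC : 0 ≤ C) (hm : 0 < m) (hτ : 0 < τ) (hS : IsClosed S)
    (hgrow : ∀ x r, δ x < r → μ (ball x r) ≤ ENNReal.ofReal (r ^ m))
    (hcell : ∀ p, MeasurableSet (cell p)) (hdisj : Pairwise (Function.onFun Disjoint cell))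
    (f g : P → 𝕜) :
    ‖bilin (fun p q => ∫ x in cell q, ∫ y in cell p, localKernel S δ k x y ∂μ ∂μ) f g‖ ≤
      2 ^ m * (√(normSq (fun p => μ.real (cell p)) f) *
        √(normSq (fun p => μ.real (cell p)) g)) := by
  refine norm_bilin_cellIntegral_le hcell hdisj (hk.stronglyMeasurable_localKernel hC hm hτ hS)
    (by positivity) (fun x => hk.lintegral_localKernel_le x (hgrow x)) (fun y => ?_) f g
  have h := (hk.swap hkb).lintegral_localKernel_le y (hgrow y)
  simpa only [localKernel_swap] using h

end FarKernel

/-! ### The hypotheses of the tree theorem on a shifted grid. -/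

section GridForm

variable {d : ℕ} {𝕜 : Type*} [RCLike 𝕜] {S : Set (EuclideanSpace ℝ (Fin d))}
  {δ : EuclideanSpace ℝ (Fin d) → ℝ} {m C τ : ℝ}
  {k : EuclideanSpace ℝ (Fin d) → EuclideanSpace ℝ (Fin d) → 𝕜}
  {μ : Measure (EuclideanSpace ℝ (Fin d))} [IsFiniteMeasure μ]

/-- The constant in the off-diagonal estimates for a kernel. -/
noncomputable def offDiagConst (d : ℕ) (m C τ : ℝ) : ℝ :=
  5 * C * (32 ^ m / (1 - 2 ^ (-τ))) * (2 * d) ^ τ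

theorem offDiagConst_pos (hd : 0 < d) (hC : 0 < C) (hτ : 0 < τ) : 0 < offDiagConst d m C τ := by
  have h : (2 : ℝ) ^ (-τ) < 1 :=
    Real.rpow_lt_one_of_one_lt_of_neg (by norm_num) (by linarith)
  have h1 : 0 < 1 - (2 : ℝ) ^ (-τ) := sub_pos.mpr h
  unfold offDiagConst
  positivity

/-- Rounding down in j / 2 costs at most a factor 2, which turns d into 2d. -/
theorem div_two_pow_half_rpow_le (hτ : 0 < τ) (j : ℕ) :
    ((d : ℝ) / 2 ^ (j / 2)) ^ τ ≤ (2 * d) ^ τ * ((2 : ℝ) ^ (-(τ / 2))) ^ j := by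
  have h1 : (d : ℝ) / 2 ^ (j / 2) ≤ 2 * d * (2 : ℝ) ^ (-(j / 2 : ℝ)) := by
    rw [div_le_iff₀ (by positivity), mul_assoc, ← Real.rpow_natCast 2 (j / 2),
      ← Real.rpow_add two_pos, mul_comm 2, mul_assoc]
    refine le_mul_of_one_le_right (by positivity) ?_
    rw [← Real.rpow_one_add' two_pos.le]
    · refine Real.one_le_rpow one_le_two ?_
      have h : (j : ℝ) ≤ 2 * (j / 2 : ℕ) + 1 := by exact_mod_cast (by omega : j ≤ 2 * (j / 2) + 1)
      linarith
    · have h : (j : ℝ) ≤ 2 * (j / 2 : ℕ) + 1 := by exact_mod_cast (by omega : j ≤ 2 * (j / 2) + 1)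
      linarith
  calc _ ≤ (2 * d * (2 : ℝ) ^ (-(j / 2 : ℝ))) ^ τ := by gcongr
    _ = _ := by
      rw [Real.mul_rpow (by positivity) (by positivity), ← Real.rpow_natCast, ← Real.rpow_mul
        two_pos.le, ← Real.rpow_mul two_pos.le]
      ring_nf

/-- Cells of level n have diameter at most L = d η 2 ^ n. Cells that are not near are 2L apart,
which is why nearness is taken with 2d. Good cells are 2 ^ (j / 2) η 2 ^ n away from the outside of
their ancestor j levels up; `hr` makes this at least 2L, and the ratio d / 2 ^ (j / 2) gives the
decay 2 ^ (-τ / 2) per level. -/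
theorem IsScaledKernel.isUpperT1Form {P : Type*} [Fintype P] {R η : ℝ} {pos : P → Fin d → ℕ}
    {a : Fin d → ℕ} {r M : ℕ} {b : P → P → 𝕜} {A : ℝ}
    (hk : IsScaledKernel S δ m C τ k) (hkb : ∀ x ∈ S, ∀ y ∈ S, δ y ^ m * ‖k x y‖ ≤ 1)
    (hC : 0 ≤ C) (hm : 0 < m) (hτ : 0 < τ) (hτ1 : τ ≤ 1) (hS : IsClosed S)
    (hSμ : ∀ᵐ x ∂μ, x ∈ S)
    (hgrow : ∀ x r, δ x < r → μ (ball x r) ≤ ENNReal.ofReal (r ^ m))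
    (hd : 0 < d) (hr : 2 * d ≤ 2 ^ (r / 2)) (hη : 0 < η) (hinj : Function.Injective pos)
    (hpos : ∀ p, 0 < μ.real (gridCell R η (pos p)))
    (hposM : ∀ p i, pos p i < 2 ^ M) (ha : ∀ i, a i < 2 ^ M)
    (hb : ∀ p q s, 0 < s →
      (∀ x ∈ gridCell R η (pos q), ∀ y ∈ gridCell R η (pos p), s ≤ dist x y) →
      b p q = ∫ x in gridCell R η (pos q), ∫ y in gridCell R η (pos p),
        farKernel S δ k x y ∂μ ∂μ)
    (h1 : ∀ n, CellTesting (fun p => μ.real (gridCell R η (pos p))) (cellIdx pos a n) b A)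
    (h2 : ∀ n, CellTesting (fun p => μ.real (gridCell R η (pos p))) (cellIdx pos a n)
      (fun p q => b q p) A) :
    IsUpperT1Form (fun p => μ.real (gridCell R η (pos p))) (cellIdx pos a) b (NearIdx (2 * d))
      (IsGoodCell r M pos a) r ((4 * (2 * d) + 2) ^ d) A (offDiagConst d m C τ)
      (2 ^ (-(τ / 2))) where
  testing := h1
  testing_swap := h2
  near_far n := by
    have hsep : ∀ p₀ p q, cellIdx pos a n p = cellIdx pos a n p₀ →
        ¬NearIdx (2 * d) (cellIdx pos a n p₀) (cellIdx pos a n q) →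
        ∀ x ∈ gridCell R η (pos q), ∀ y ∈ gridCell R η (pos p),
          (2 * d : ℕ) * (η * 2 ^ n) ≤ dist x y := by
      intro p₀ p q hp hR x hx y hy
      rw [← hp] at hR
      exact le_dist_of_cellIdx_far hη (exists_cellIdx_far_of_not_nearIdx hR) hx hy
    have hs : 0 < ((2 * d : ℕ) : ℝ) * (η * 2 ^ n) := by positivity
    refine hk.decouples hkb hC hm hτ hτ1 hS hSμ hgrow (fun p => measurableSet_gridCell _ _ _)
      (fun p q hpq => disjoint_gridCell hη (hinj.ne hpq)) hpos (L := d * (η * 2 ^ n))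
      (by positivity) hs (by push_cast; linarith) ?_
      (fun p₀ p q hp hR => hb p q _ hs (hsep p₀ p q hp hR))
      (fun p p₀ hp y hy y' hy' => dist_le_of_cellIdx_eq hη hp hy hy') hsep
    have hΓ : (0 : ℝ) ≤ 32 ^ m / (1 - 2 ^ (-τ)) :=
      div_nonneg (by positivity) (sub_nonneg.mpr
        (Real.rpow_le_one_of_one_le_of_nonpos (by norm_num) (by linarith)))
    unfold offDiagConst
    gcongr
    have hd1 : (1 : ℝ) ≤ d := by exact_mod_cast hd
    rw [mul_div_mul_right _ _ (by positivity)]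
    push_cast
    rw [div_le_iff₀ (by positivity)]
    nlinarith
  good_far n j hj := by
    have hs : 0 < ((2 ^ (j / 2) : ℕ) : ℝ) * (η * 2 ^ n) := by positivity
    have hsep : ∀ p₀ p q, cellIdx pos a n p = cellIdx pos a n p₀ →
        IsGoodCell r M pos a n p₀ ∧ cellIdx pos a (n + j) q ≠ cellIdx pos a (n + j) p₀ →
        ∀ x ∈ gridCell R η (pos q), ∀ y ∈ gridCell R η (pos p),
          (2 ^ (j / 2) : ℕ) * (η * 2 ^ n) ≤ dist x y := by
      rintro p₀ p q hp ⟨hg, hne⟩ x hx y hy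
      -- Above level `M` all points share one cell, so ancestors that differ must lie within the
      -- range covered by goodness.
      have hjM : n + j ≤ M := by
        by_contra h
        exact hne (by rw [cellIdx_top hposM ha (by omega), cellIdx_top hposM ha (by omega)])
      rw [← (nestedCells_cellIdx pos a).mono (Nat.le_add_right n j) p p₀ hp] at hne
      exact le_dist_of_cellIdx_far hη
        ((isGoodCell_congr n p₀ p hp.symm hg).exists_cellIdx_far hj hjM hne) hx hy
    have h2j : (2 * d : ℝ) ≤ 2 ^ (j / 2) := by
      have : 2 * d ≤ 2 ^ (j / 2) :=
        hr.trans (Nat.pow_le_pow_right two_pos (Nat.div_le_div_right hj))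
      exact_mod_cast this
    refine hk.decouples hkb hC hm hτ hτ1 hS hSμ hgrow (fun p => measurableSet_gridCell _ _ _)
      (fun p q hpq => disjoint_gridCell hη (hinj.ne hpq)) hpos (L := d * (η * 2 ^ n))
      (by positivity) hs ?_ ?_
      (fun p₀ p q hp hR => hb p q _ hs (hsep p₀ p q hp hR))
      (fun p p₀ hp y hy y' hy' => dist_le_of_cellIdx_eq hη hp hy hy') hsep
    · push_cast
      have : 0 < η * 2 ^ n := by positivity
      nlinarith
    · have hΓ : (0 : ℝ) ≤ 32 ^ m / (1 - 2 ^ (-τ)) :=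
        div_nonneg (by positivity) (sub_nonneg.mpr
          (Real.rpow_le_one_of_one_le_of_nonpos (by norm_num) (by linarith)))
      rw [mul_div_mul_right _ _ (by positivity)]
      unfold offDiagConst
      rw [mul_assoc _ ((2 * d : ℝ) ^ τ)]
      push_cast
      gcongr
      exact div_two_pow_half_rpow_le hτ j

end GridForm

/-! ### The bound for good functions on a grid. -/

section GridOperator

variable {d : ℕ} {𝕜 : Type*} [RCLike 𝕜] {S : Set (EuclideanSpace ℝ (Fin d))}
  {δ : EuclideanSpace ℝ (Fin d) → ℝ} {m C τ : ℝ}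
  {k : EuclideanSpace ℝ (Fin d) → EuclideanSpace ℝ (Fin d) → 𝕜}
  {μ : Measure (EuclideanSpace ℝ (Fin d))} [IsFiniteMeasure μ] {A : ℝ}
  {T : Lp 𝕜 2 μ →L[𝕜] Lp 𝕜 2 μ}

theorem bilin_sub_matrix {P : Type*} [Fintype P] (b b' : P → P → 𝕜) (f g : P → 𝕜) :
    bilin (fun p q => b p q - b' p q) f g = bilin b f g - bilin b' f g := by
  simp only [bilin, sub_mul, Finset.sum_sub_distrib]

theorem T1Condition.norm_le (h : T1Condition μ A T) {R η : ℝ} (hη : 0 < η) (a : Fin d → ℕ) (n : ℕ)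
    (v : Fin d → ℕ) :
    ‖T (setLp 𝕜 μ (measurableSet_shiftedCube R η a n v))‖ ≤
      √|A| * √(μ.real (shiftedCube R η a n v)) := by
  rw [← Real.sqrt_mul (abs_nonneg A)]
  refine Real.le_sqrt_of_sq_le ((h _ (η * 2 ^ n) (by positivity)).trans ?_)
  exact mul_le_mul_of_nonneg_right (le_abs_self A) measureReal_nonneg

/-- The bound for good functions. -/
noncomputable def goodConst (d r : ℕ) (A m C τ : ℝ) : ℝ :=
  (√|A| + 2 ^ m) + 2 * upperConst r ((4 * (2 * d) + 2) ^ d) (√|A| + 2 ^ m) (offDiagConst d m C τ)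
    (2 ^ (-(τ / 2))) + ((√|A| + 2 ^ m) * ((4 * (2 * d) + 2) ^ d : ℕ) + offDiagConst d m C τ)

/-- The tree theorem is applied to the matrix of `T` minus the local matrix. The subtraction costs 2
^ m in the testing constant and leaves the far kernel on separated cells; entries near the diagonal
need no formula. The local matrix is added back with its own bound 2 ^ m. -/
theorem norm_bilin_inner_le_of_isGoodFunction {P : Type*} [Fintype P] {R η : ℝ}
    {pos : P → Fin d → ℕ} {a : Fin d → ℕ} {r M : ℕ}
    (hk : IsScaledKernel S δ m C τ k) (hkb : ∀ x ∈ S, ∀ y ∈ S, δ y ^ m * ‖k x y‖ ≤ 1)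
    (hC : 0 < C) (hm : 0 < m) (hτ : 0 < τ) (hτ1 : τ ≤ 1) (hS : IsClosed S)
    (hSμ : ∀ᵐ x ∂μ, x ∈ S)
    (hgrow : ∀ x r, δ x < r → μ (ball x r) ≤ ENNReal.ofReal (r ^ m))
    (hd : 0 < d) (hr : 2 * d ≤ 2 ^ (r / 2)) (hη : 0 < η) (hinj : Function.Injective pos)
    (hpos : ∀ p, 0 < μ.real (gridCell R η (pos p)))
    (hcover : ∀ᵐ x ∂μ, ∃ p, x ∈ gridCell R η (pos p))
    (hposM : ∀ p i, pos p i < 2 ^ M) (ha : ∀ i, a i < 2 ^ M)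
    (hT : IsCZOperator μ k T) (hA : T1Condition μ A T)
    (hA' : T1Condition μ A (ContinuousLinearMap.adjoint T)) {f g : P → 𝕜}
    (hf : IsGoodFunction (fun p => μ.real (gridCell R η (pos p))) (cellIdx pos a)
      (IsGoodCell r M pos a) f)
    (hg : IsGoodFunction (fun p => μ.real (gridCell R η (pos p))) (cellIdx pos a)
      (IsGoodCell r M pos a) g) :
    ‖bilin (fun p q => inner 𝕜 (setLp 𝕜 μ (measurableSet_gridCell R η (pos q)))
      (T (setLp 𝕜 μ (measurableSet_gridCell R η (pos p))))) f g‖ ≤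
      (goodConst d r A m C τ + 2 ^ m) * (√(normSq (fun p => μ.real (gridCell R η (pos p))) f) *
        √(normSq (fun p => μ.real (gridCell R η (pos p))) g)) := by
  have hcell : ∀ p, MeasurableSet (gridCell R η (pos p)) := fun p => measurableSet_gridCell _ _ _
  have hdisj : Pairwise (Function.onFun Disjoint fun p => gridCell R η (pos p)) :=
    fun p q hpq => disjoint_gridCell hη (hinj.ne hpq)
  set bT : P → P → 𝕜 := fun p q => inner 𝕜 (setLp 𝕜 μ (measurableSet_gridCell R η (pos q)))
    (T (setLp 𝕜 μ (measurableSet_gridCell R η (pos p)))) with hbT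
  set bL : P → P → 𝕜 := fun p q => ∫ x in gridCell R η (pos q), ∫ y in gridCell R η (pos p),
    localKernel S δ k x y ∂μ ∂μ with hbL
  have hL : ∀ f g : P → 𝕜, ‖bilin bL f g‖ ≤ 2 ^ m *
      (√(normSq (fun p => μ.real (gridCell R η (pos p))) f) *
        √(normSq (fun p => μ.real (gridCell R η (pos p))) g)) :=
    hk.norm_bilin_localKernel_le hkb hC.le hm hτ hS hgrow hcell hdisj
  have hL' : ∀ f g : P → 𝕜, ‖bilin (fun p q => bL q p) f g‖ ≤ 2 ^ m *
      (√(normSq (fun p => μ.real (gridCell R η (pos p))) f) *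
        √(normSq (fun p => μ.real (gridCell R η (pos p))) g)) := fun f g => by
    rw [bilin_swap, mul_comm √(normSq _ f)]
    exact hL g f
  have htest := fun n => cellTesting_inner (μ := μ) hcell hdisj hcover
    (c := cellIdx pos a n) (fun p => shiftedCube R η a n (cellIdx pos a n p))
    (fun p => measurableSet_shiftedCube _ _ _ _ _)
    (fun p₀ p x hx => mem_shiftedCube_iff hη hx) T
    (fun p => hA.norm_le hη a n _) (fun p => hA'.norm_le hη a n _)
  have h1 : ∀ n, CellTesting (fun p => μ.real (gridCell R η (pos p))) (cellIdx pos a n)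
      (fun p q => bT p q - bL p q) (√|A| + 2 ^ m) := fun n =>
    (htest n).1.sub (.of_norm_bilin_le hL _)
  have h2 : ∀ n, CellTesting (fun p => μ.real (gridCell R η (pos p))) (cellIdx pos a n)
      (fun p q => bT q p - bL q p) (√|A| + 2 ^ m) := fun n =>
    (htest n).2.sub (.of_norm_bilin_le hL' _)
  have hb : ∀ p q s, 0 < s →
      (∀ x ∈ gridCell R η (pos q), ∀ y ∈ gridCell R η (pos p), s ≤ dist x y) →
      bT p q - bL p q = ∫ x in gridCell R η (pos q), ∫ y in gridCell R η (pos p),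
        farKernel S δ k x y ∂μ ∂μ := by
    intro p q s hs hpq
    rw [← hk.integral_sub_localKernel hC.le hm hτ hS hSμ (hcell p) (hcell q) hs hpq,
      ← hT.inner_setLp (hcell p) (hcell q) hs hpq]
  have hb' : ∀ p q s, 0 < s →
      (∀ x ∈ gridCell R η (pos q), ∀ y ∈ gridCell R η (pos p), s ≤ dist x y) →
      bT q p - bL q p = ∫ x in gridCell R η (pos q), ∫ y in gridCell R η (pos p),
        farKernel S δ (fun x y => k y x) x y ∂μ ∂μ := by
    intro p q s hs hpq
    have hqp : ∀ x ∈ gridCell R η (pos p), ∀ y ∈ gridCell R η (pos q), s ≤ dist x y :=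
      fun x hx y hy => by rw [dist_comm]; exact hpq y hy x hx
    rw [hb q p s hs hqp, hk.integral_farKernel_swap hC.le hm hτ hS (hcell q) (hcell p) hs hqp]
  have H := hk.isUpperT1Form hkb hC.le hm hτ hτ1 hS hSμ hgrow hd hr hη hinj hpos hposM ha hb h1 h2
  have H' := (hk.swap hkb).isUpperT1Form (fun x hx y hy => hk.bound y hy x hx) hC.le hm hτ hτ1 hS
    hSμ hgrow hd hr hη hinj hpos hposM ha hb' h2 h1
  have hmain := norm_bilin_le_of_isUpperT1Form H H' hpos (nestedCells_cellIdx pos a)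
    (cellIdx_zero_injective hinj a) (by positivity) (offDiagConst_pos hd hC hτ) (by positivity)
    (Real.rpow_lt_one_of_one_lt_of_neg (by norm_num) (by linarith))
    isGoodCell_congr (fun _ _ h => h.symm) (nearCard_cellIdx pos a (2 * d)) (N := M + 1)
    (fun n hn p q => by rw [cellIdx_top hposM ha hn, cellIdx_top hposM ha hn]) hf hg
  rw [bilin_sub_matrix] at hmain
  calc ‖bilin bT f g‖ = ‖(bilin bT f g - bilin bL f g) + bilin bL f g‖ := by rw [sub_add_cancel]
    _ ≤ _ := norm_add_le _ _
    _ ≤ _ := add_le_add hmain (hL f g)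
    _ = _ := by rw [goodConst]; exact (add_mul _ _ _).symm

end GridOperator

/-! ### Absorption of bad parts, passage to L² and choice of the scale. -/

section Absorption

variable {d : ℕ} {𝕜 : Type*} [RCLike 𝕜] {S : Set (EuclideanSpace ℝ (Fin d))}
  {δ : EuclideanSpace ℝ (Fin d) → ℝ} {m C τ : ℝ}
  {k : EuclideanSpace ℝ (Fin d) → EuclideanSpace ℝ (Fin d) → 𝕜}
  {μ : Measure (EuclideanSpace ℝ (Fin d))} {A : ℝ}

/-- The shift is chosen after `f` and `g`. Since 2 / 128 = (1 / 8) ^ 2, the bad parts have at most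
an eighth of the norm. The good parts cost (9 / 8) ^ 2 ≤ 2 times the good constant, and the rest (9
/ 64 + 1 / 8) ‖T‖ ≤ ‖T‖ / 2. -/
theorem norm_bilin_inner_le_add_half {P : Type*} [Fintype P] [IsFiniteMeasure μ]
    {T : Lp 𝕜 2 μ →L[𝕜] Lp 𝕜 2 μ} {R η : ℝ}
    {pos : P → Fin d → ℕ} {r M : ℕ}
    (hk : IsScaledKernel S δ m C τ k) (hkb : ∀ x ∈ S, ∀ y ∈ S, δ y ^ m * ‖k x y‖ ≤ 1)
    (hC : 0 < C) (hm : 0 < m) (hτ : 0 < τ) (hτ1 : τ ≤ 1) (hS : IsClosed S)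
    (hSμ : ∀ᵐ x ∂μ, x ∈ S)
    (hgrow : ∀ x r, δ x < r → μ (ball x r) ≤ ENNReal.ofReal (r ^ m))
    (hd : 0 < d) (hr : 2 * d ≤ 2 ^ (r / 2)) (hbad : badProb d r M ≤ 1 / 128) (hη : 0 < η)
    (hinj : Function.Injective pos)
    (hpos : ∀ p, 0 < μ.real (gridCell R η (pos p)))
    (hcover : ∀ᵐ x ∂μ, ∃ p, x ∈ gridCell R η (pos p))
    (hposM : ∀ p i, pos p i < 2 ^ M)
    (hT : IsCZOperator μ k T) (hA : T1Condition μ A T)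
    (hA' : T1Condition μ A (ContinuousLinearMap.adjoint T)) (f g : P → 𝕜) :
    ‖bilin (fun p q => inner 𝕜 (setLp 𝕜 μ (measurableSet_gridCell R η (pos q)))
      (T (setLp 𝕜 μ (measurableSet_gridCell R η (pos p))))) f g‖ ≤
      (2 * max 0 (goodConst d r A m C τ + 2 ^ m) + ‖T‖ / 2) *
        (√(normSq (fun p => μ.real (gridCell R η (pos p))) f) *
        √(normSq (fun p => μ.real (gridCell R η (pos p))) g)) := by
  classical
  have hcell : ∀ p, MeasurableSet (gridCell R η (pos p)) := fun p => measurableSet_gridCell _ _ _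
  have hdisj : Pairwise (Function.onFun Disjoint fun p => gridCell R η (pos p)) :=
    fun p q hpq => disjoint_gridCell hη (hinj.ne hpq)
  set w : P → ℝ := fun p => μ.real (gridCell R η (pos p)) with hw
  set b : P → P → 𝕜 := fun p q => inner 𝕜 (setLp 𝕜 μ (measurableSet_gridCell R η (pos q)))
    (T (setLp 𝕜 μ (measurableSet_gridCell R η (pos p)))) with hb
  set U := max 0 (goodConst d r A m C τ + 2 ^ m) with hU
  have hbd : ∀ f g : P → 𝕜, ‖bilin b f g‖ ≤ ‖T‖ * (√(normSq w f) * √(normSq w g)) :=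
    norm_bilin_inner_le hcell hdisj T
  by_cases h0 : 0 < normSq w f ∧ 0 < normSq w g
  swap
  · have h1 : √(normSq w f) * √(normSq w g) = 0 := by
      rcases not_and_or.mp h0 with h | h
      · rw [Real.sqrt_eq_zero_of_nonpos (not_lt.mp h), zero_mul]
      · rw [Real.sqrt_eq_zero_of_nonpos (not_lt.mp h), mul_zero]
    have := hbd f g
    rw [h1, mul_zero] at this ⊢
    exact this
  obtain ⟨a, ha⟩ := exists_shift_normSq_bad_le (M := M) hpos hinj r h0.1 h0.2
  have haM : ∀ i, shiftVal a i < 2 ^ M := fun i => ZMod.val_lt _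
  set B : (P → 𝕜) → P → 𝕜 := martTransform w (cellIdx pos (shiftVal a)) (fun n p =>
    if IsGoodCell r M pos (shiftVal a) (n + 1) p then 0 else 1) (M + 1) with hB
  have hgood : ∀ h, IsGoodFunction w (cellIdx pos (shiftVal a)) (IsGoodCell r M pos (shiftVal a))
      (h - B h) := fun h =>
    isGoodFunction_sub_martTransform hpos (nestedCells_cellIdx pos _) isGoodCell_congr
      (N := M + 1) (fun n hn p q => by rw [cellIdx_top hposM haM hn, cellIdx_top hposM haM hn]) h
  have hBn : ∀ h ∈ ({f, g} : Set (P → 𝕜)), √(normSq w (B h)) ≤ 1 / 8 * √(normSq w h) := by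
    intro h hh
    have h1 := normSq_nonneg (𝕜 := 𝕜) hpos h
    rw [show (1 / 8 : ℝ) = √(1 / 64) by
      rw [show (1 / 64 : ℝ) = (1 / 8) ^ 2 by norm_num, Real.sqrt_sq (by norm_num)],
      ← Real.sqrt_mul (by norm_num)]
    refine Real.sqrt_le_sqrt ((ha h hh).trans ?_)
    gcongr
    linarith
  have hGn : ∀ h ∈ ({f, g} : Set (P → 𝕜)), √(normSq w (h - B h)) ≤ 9 / 8 * √(normSq w h) := by
    intro h hh
    have h1 : stepLp μ hcell (h - B h) = stepLp μ hcell h - stepLp μ hcell (B h) := by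
      rw [eq_sub_iff_add_eq, ← stepLp_add, sub_add_cancel]
    rw [← norm_stepLp hcell hdisj, h1]
    refine (norm_sub_le _ _).trans ?_
    rw [norm_stepLp hcell hdisj, norm_stepLp hcell hdisj]
    linarith [hBn h hh]
  have hsplit : bilin b f g =
      bilin b (f - B f) (g - B g) + bilin b (f - B f) (B g) + bilin b (B f) g := by
    rw [← bilin_add_right, sub_add_cancel, ← bilin_add_left, sub_add_cancel]
  have h1 : ‖bilin b (f - B f) (g - B g)‖ ≤
      U * ((9 / 8 * √(normSq w f)) * (9 / 8 * √(normSq w g))) := by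
    refine (norm_bilin_inner_le_of_isGoodFunction hk hkb hC hm hτ hτ1 hS hSμ hgrow hd hr hη hinj
      hpos hcover hposM haM hT hA hA' (hgood f) (hgood g)).trans ?_
    refine mul_le_mul (le_max_right _ _) (mul_le_mul (hGn f (by simp)) (hGn g (by simp))
      (Real.sqrt_nonneg _) (by positivity)) (by positivity) (le_max_left _ _)
  have h2 : ‖bilin b (f - B f) (B g)‖ ≤
      ‖T‖ * ((9 / 8 * √(normSq w f)) * (1 / 8 * √(normSq w g))) :=
    (hbd _ _).trans (by
      gcongr
      exacts [hGn f (by simp), hBn g (by simp)])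
  have h3 : ‖bilin b (B f) g‖ ≤ ‖T‖ * ((1 / 8 * √(normSq w f)) * √(normSq w g)) :=
    (hbd _ _).trans (by
      gcongr
      exact hBn f (by simp))
  rw [hsplit]
  have hU0 : 0 ≤ U * (√(normSq w f) * √(normSq w g)) :=
    mul_nonneg (le_max_left _ _) (by positivity)
  have hN0 : 0 ≤ ‖T‖ * (√(normSq w f) * √(normSq w g)) := by positivity
  calc _ ≤ _ := norm_add₃_le
    _ ≤ _ := add_le_add (add_le_add h1 h2) h3
    _ ≤ _ := by nlinarith

/-- The pairs that satisfy the bound form a closed set, here also dense; then `T f` is used as the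
second vector. -/
theorem ContinuousLinearMap.opNorm_le_of_norm_inner_le {F : Type*} [NormedAddCommGroup F]
    [InnerProductSpace 𝕜 F] (T : F →L[𝕜] F) {c : ℝ} (hc : 0 ≤ c)
    (h : ∀ ε > 0, ∀ f g : F, ∃ f' g' : F, ‖f - f'‖ ≤ ε ∧ ‖g - g'‖ ≤ ε ∧
      ‖inner 𝕜 g' (T f')‖ ≤ c * (‖f'‖ * ‖g'‖)) : ‖T‖ ≤ c := by
  have hcl : IsClosed {z : F × F | ‖inner 𝕜 z.2 (T z.1)‖ ≤ c * (‖z.1‖ * ‖z.2‖)} :=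
    isClosed_le (by fun_prop) (by fun_prop)
  have hall : ∀ z : F × F, ‖inner 𝕜 z.2 (T z.1)‖ ≤ c * (‖z.1‖ * ‖z.2‖) := by
    intro z
    have hz : z ∈ closure {z : F × F | ‖inner 𝕜 z.2 (T z.1)‖ ≤ c * (‖z.1‖ * ‖z.2‖)} := by
      rw [Metric.mem_closure_iff]
      intro ε hε
      obtain ⟨f', g', hf, hg, hfg⟩ := h (ε / 2) (by positivity) z.1 z.2
      refine ⟨(f', g'), hfg, ?_⟩
      rw [Prod.dist_eq, dist_eq_norm, dist_eq_norm]
      exact max_lt (by linarith) (by linarith)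
    rwa [hcl.closure_eq] at hz
  refine T.opNorm_le_bound hc fun f => ?_
  have h1 := hall (f, T f)
  rw [inner_self_eq_norm_sq_to_K, norm_pow, RCLike.norm_ofReal, abs_norm] at h1
  rcases (norm_nonneg (T f)).eq_or_lt with h0 | h0
  · rw [← h0]
    positivity
  · exact le_of_mul_le_mul_right (by simp only at h1; linarith) h0

/-- The mesh depends on the functions and on ε, the constant does not. Half of ‖T‖ is absorbed on
the left, which is where a priori boundedness enters. -/
theorem IsScaledKernel.opNorm_le [IsProbabilityMeasure μ] {T : Lp 𝕜 2 μ →L[𝕜] Lp 𝕜 2 μ} {r : ℕ}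
    (hk : IsScaledKernel μ.support δ m C τ k)
    (hkb : ∀ x ∈ μ.support, ∀ y ∈ μ.support, δ y ^ m * ‖k x y‖ ≤ 1)
    (hC : 0 < C) (hm : 0 < m) (hτ : 0 < τ) (hτ1 : τ ≤ 1) (hcpt : IsCompact μ.support)
    (hgrow : ∀ x r, δ x < r → μ (ball x r) ≤ ENNReal.ofReal (r ^ m))
    (hd : 0 < d) (hr : 2 * d ≤ 2 ^ (r / 2)) (hbad : ∀ M, badProb d r M ≤ 1 / 128)
    (hT : IsCZOperator μ k T) (hA : T1Condition μ A T)
    (hA' : T1Condition μ A (ContinuousLinearMap.adjoint T)) :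
    ‖T‖ ≤ 4 * max 0 (goodConst d r A m C τ + 2 ^ m) := by
  suffices h : ‖T‖ ≤ 2 * max 0 (goodConst d r A m C τ + 2 ^ m) + ‖T‖ / 2 by linarith
  have hU : 0 ≤ max 0 (goodConst d r A m C τ + 2 ^ m) := le_max_left _ _
  refine T.opNorm_le_of_norm_inner_le (by positivity) fun ε hε F G => ?_
  obtain ⟨R₀, hR₀⟩ := hcpt.isBounded.subset_ball 0
  obtain ⟨R, hR, hR'⟩ : ∃ R : ℝ, 0 < R ∧ μ.support ⊆ ball 0 R :=
    ⟨max R₀ 1, by positivity, hR₀.trans (ball_subset_ball (le_max_left _ _))⟩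
  obtain ⟨ρ, hρ, hF⟩ := exists_norm_sub_stepLp_le F hε
  obtain ⟨ρ', hρ', hG⟩ := exists_norm_sub_stepLp_le G hε
  obtain ⟨M, hM⟩ : ∃ M : ℕ, d * (2 * R) / min ρ ρ' < 2 ^ M :=
    pow_unbounded_of_one_lt _ one_lt_two
  have hmin : 0 < min ρ ρ' := lt_min hρ hρ'
  set η := 2 * R / 2 ^ M with hη_def
  have hη : 0 < η := by positivity
  have hηM : η * 2 ^ M = 2 * R := div_mul_cancel₀ _ (by positivity)
  have hηρ : d * η < min ρ ρ' := by
    rw [div_lt_iff₀ hmin] at hM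
    rw [hη_def, mul_div_assoc', div_lt_iff₀ (by positivity)]
    linarith
  let P := {z : Fin d → Fin (2 ^ M) // 0 < μ.real (gridCell R η fun i => (z i : ℕ))}
  let _ : Fintype P := Fintype.ofFinite P
  let pos : P → Fin d → ℕ := fun p i => (p.1 i : ℕ)
  have hinj : Function.Injective pos := fun p q h =>
    Subtype.ext (funext fun i => Fin.ext (congrFun h i))
  have hpos : ∀ p, 0 < μ.real (gridCell R η (pos p)) := fun p => p.2
  have hcover : ∀ᵐ x ∂μ, ∃ p, x ∈ gridCell R η (pos p) := ae_exists_mem_gridCell hη hηM hR'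
  have hcell : ∀ p, MeasurableSet (gridCell R η (pos p)) := fun p => measurableSet_gridCell _ _ _
  have hdisj : Pairwise (Function.onFun Disjoint fun p => gridCell R η (pos p)) :=
    fun p q hpq => disjoint_gridCell hη (hinj.ne hpq)
  have hne : ∀ p, (gridCell R η (pos p)).Nonempty := fun p =>
    nonempty_of_measureReal_ne_zero (hpos p).ne'
  have hdiam : ∀ p, ∀ x ∈ gridCell R η (pos p), ∀ y ∈ gridCell R η (pos p),
      dist x y < min ρ ρ' := fun p x hx y hy => by
    have := dist_le_of_cellIdx_eq (pos := pos) (a := 0) (n := 0) hη rfl hx hy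
    rw [pow_zero, mul_one] at this
    exact this.trans_lt hηρ
  obtain ⟨f, hf⟩ := hF P _ hcell hdisj hcover hne fun p x hx y hy =>
    (hdiam p x hx y hy).trans_le (min_le_left _ _)
  obtain ⟨g, hg⟩ := hG P _ hcell hdisj hcover hne fun p x hx y hy =>
    (hdiam p x hx y hy).trans_le (min_le_right _ _)
  refine ⟨_, _, hf, hg, ?_⟩
  have e := inner_stepLp_stepLp (μ := μ) hcell T f fun p => (starRingEnd 𝕜) (g p)
  have e' := norm_stepLp_conj (μ := μ) hcell hdisj fun p => (starRingEnd 𝕜) (g p)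
  simp only [RCLike.conj_conj] at e e'
  rw [e, norm_stepLp hcell hdisj, e']
  exact norm_bilin_inner_le_add_half hk hkb hC hm hτ hτ1 Measure.isClosed_support
    Measure.support_mem_ae hgrow hd hr (hbad M) hη hinj hpos hcover
    (fun p i => (p.1 i).isLt) hT hA hA' _ _

/-- The distance to the complement of the set that contains the non-Ahlfors balls is a scale
for which the kernel and the measure have the required bounds. -/
theorem exists_scale [IsProbabilityMeasure μ] {X H : Set (EuclideanSpace ℝ (Fin d))} (hm : 0 < m)
    (hX : S ⊆ X) (hk : IsCZKernel X m C τ k) (hH : NonAhlforsBallsIn μ m H)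
    (hB : HasBergmanBound X H m k) :
    ∃ δ : EuclideanSpace ℝ (Fin d) → ℝ, IsScaledKernel S δ m C τ k ∧
      (∀ x ∈ S, ∀ y ∈ S, δ y ^ m * ‖k x y‖ ≤ 1) ∧
      ∀ x r, δ x < r → μ (ball x r) ≤ ENNReal.ofReal (r ^ m) := by
  have hsize := fun x hx y hy => hk.size x (hX hx) y (hX hy)
  have hsmooth := fun x hx x' hx' y hy => hk.smooth x (hX hx) x' (hX hx') y (hX hy)
  rcases Hᶜ.eq_empty_or_nonempty with he | hne
  -- If H is the whole space, the kernel bound reads 1 / ∞ and `k` vanishes on `S`. The scale 1 is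
  -- suitable for the measure, whose total mass is one.
  · have h0 : ∀ x ∈ S, ∀ y ∈ S, (1 : ℝ) ^ m * ‖k x y‖ ≤ 1 := by
      intro x hx y hy
      have h := hB x (hX hx) y (hX hy)
      rw [he, infEDist_empty, infEDist_empty, ENNReal.top_rpow_of_pos hm, max_self,
        ENNReal.div_top, nonpos_iff_eq_zero, enorm_eq_zero] at h
      simp [h]
    refine ⟨fun _ => 1, ⟨fun _ => zero_le_one, fun x y => ?_, hsize, hsmooth, h0⟩, h0,
      fun x r hr => ?_⟩
    · linarith [dist_nonneg (x := x) (y := y)]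
    · exact prob_le_one.trans (ENNReal.one_le_ofReal.mpr (Real.one_le_rpow hr.le hm.le))
  · have hb : ∀ z, ∀ x ∈ S, ∀ y ∈ S, (z = x ∨ z = y) → infDist z Hᶜ ^ m * ‖k x y‖ ≤ 1 := by
      intro z x hx y hy hz
      have h1 : infEDist z Hᶜ ^ m ≤ max (infEDist x Hᶜ ^ m) (infEDist y Hᶜ ^ m) := by
        rcases hz with rfl | rfl
        · exact le_max_left _ _
        · exact le_max_right _ _
      have h2 : ‖k x y‖ₑ * infEDist z Hᶜ ^ m ≤ 1 :=
        ENNReal.mul_le_of_le_div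
          ((hB x (hX hx) y (hX hy)).trans (ENNReal.div_le_div_left h1 1))
      have h3 := ENNReal.toReal_mono ENNReal.one_ne_top h2
      rw [ENNReal.toReal_mul, toReal_enorm, ← ENNReal.toReal_rpow, ENNReal.toReal_one] at h3
      rw [mul_comm]
      exact h3
    refine ⟨fun x => infDist x Hᶜ, ⟨fun _ => infDist_nonneg,
      fun x y => infDist_le_infDist_add_dist, hsize, hsmooth,
      fun x hx y hy => hb x x hx y hy (.inl rfl)⟩, fun x hx y hy => hb y x hx y hy (.inr rfl),
      fun x r hr => ?_⟩
    -- A ball of radius larger than the distance to the complement of H meets that complement, so it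
    -- cannot be non-Ahlfors.
    by_contra! h
    obtain ⟨y, hy, hxy⟩ := (infDist_lt_iff hne).mp hr
    exact hy (hH x r (infDist_nonneg.trans_lt hr) h (mem_ball'.mpr hxy))

end Absorption

/-! ### Choice of the goodness parameter and the main theorem. -/

/-- Both demands on r persist when r grows: one gives the separation of good cells, the other the
rarity of bad ones. -/
theorem exists_bad_parameter (d : ℕ) :
    ∃ r : ℕ, 2 * d ≤ 2 ^ (r / 2) ∧ ∀ M, badProb d r M ≤ 1 / 128 := by
  obtain ⟨r₀, hr₀⟩ := exists_badProb_le d (ε := 1 / 128) (by norm_num)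
  refine ⟨r₀ + 4 * d, ?_, hr₀ _ (by omega)⟩
  calc 2 * d ≤ 2 ^ (2 * d) := Nat.lt_two_pow_self.le
    _ ≤ _ := Nat.pow_le_pow_right two_pos (by omega)

/-- The constant `C` depends only on `A`, `m`, `d` and the Calderón–Zygmund constants. The
Hilbert space adjoint of `T` has kernel `conj k(y,x)`; it maps the real function `χ_Q` to the
complex conjugate of the image of `χ_Q` under the operator `T*` with kernel `k(y,x)`, so the
testing condition on the adjoint is the one on `T*`. -/
theorem theorem1 {𝕜 : Type*} [RCLike 𝕜] (d : ℕ) (m : ℝ) (hm : 0 < m) (hmd : m ≤ d)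
    (C_CZ τ : ℝ) (hCZ : 0 < C_CZ) (hτ : 0 < τ) (hτ1 : τ ≤ 1) (A : ℝ) :
    ∃ C : ℝ, ∀ (X H : Set (EuclideanSpace ℝ (Fin d)))
      (k : EuclideanSpace ℝ (Fin d) → EuclideanSpace ℝ (Fin d) → 𝕜)
      (μ : Measure (EuclideanSpace ℝ (Fin d))) [IsProbabilityMeasure μ]
      (T : Lp 𝕜 2 μ →L[𝕜] Lp 𝕜 2 μ),
      IsCZKernel X m C_CZ τ k →
      IsCompact μ.support → μ.support ⊆ X →
      IsOpen H → NonAhlforsBallsIn μ m H →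
      HasBergmanBound X H m k →
      IsCZOperator μ k T →
      T1Condition μ A T → T1Condition μ A (ContinuousLinearMap.adjoint T) →
      ‖T‖ ≤ C := by
  have hd : 0 < d := by exact_mod_cast hm.trans_le hmd
  obtain ⟨r, hr, hbad⟩ := exists_bad_parameter d
  refine ⟨4 * max 0 (goodConst d r A m C_CZ τ + 2 ^ m), ?_⟩
  intro X H k μ _ T hk hcpt hX _ hH hB hT hA hA'
  obtain ⟨δ, hδ, hδb, hgrow⟩ := exists_scale hm hX hk hH hB
  exact hδ.opNorm_le hδb hCZ hm hτ hτ1 hcpt hgrow hd hr hbad hT hA hA'
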